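/- Let $F$ be a probability distribution on $\mathbb{R}^d$ carried by a set $\mathcal{X}$ such that $x^\top y\in[0,1]$ for all $x,y\in\mathcal{X}$, and suppose that the second moment matrix $\Delta=\mathbb{E}[X_1X_1^\top]$, $X_1\sim F$, has rank $d$ (its eigenvalues need not be distinct). Let $(\rho_n)$ be a sequence in $(0,1]$. For each $n$ let $(X,A)$ be a random dot product graph on $n$ vertices with sparsity factor $\rho_n$: the rows $X_1,\dots,X_n$ of $X\in\mathbb{R}^{n\times d}$ are i.i.d. with law $F$, $P=\rho_nXX^\top$, and $A\in\{0,1\}^{n\times n}$ is a symmetric matrix with zero diagonal such that $\Pr[A\mid X]=\prod_{i<j}P_{ij}^{A_{ij}}(1-P_{ij})^{1-A_{ij}}$. Let $S_A$ be the diagonal matrix of the $d$ largest eigenvalues, in decreasing order, of $|A|=(A^\top A)^{1/2}$, let $U_A\in\mathbb{R}^{n\times d}$ have corresponding orthonormal eigenvectors as columns, and put $\hat X=U_AS_A^{1/2}$. Let $S_P$ and $U_P\in\mathbb{R}^{n\times d}$ be defined in the same way from the $d$ largest eigenvalues of $P$. Then there is a constant $C>0$, depending only on the distribution $F$ (hence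 on $d$) and the sequence $(\rho_n)$, such that the following event $E_n$ occurs asymptotically almost surely: $P$ has rank $d$ and, for every admissible choice of the eigenvectors $U_A$ and $U_P$, there is an orthogonal matrix $W\in\mathbb{R}^{d\times d}$ with $$\Bigl|\,\|\hat X-\rho_n^{1/2}XW\|_F-\|(A-P)U_PS_P^{-1/2}\|_F\Bigr|\le C\,\log(n)\,(n\rho_n)^{-1/2}.$$ Here "$E_n$ occurs asymptotically almost surely" means that for every $c>0$ there is $n_0(c)$ such that $\Pr(E_n)\ge 1-\eta$ whenever $n>n_0(c)$ and $n^{-c}<\eta<1/2$. -/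

import Mathlib

open MeasureTheory
open scoped Matrix MatrixOrder Matrix.Norms.Frobenius

noncomputable section

namespace RDPG

/-- A distribution on `ℝᵈ` carried by a set on which all inner products lie in `[0, 1]`. -/
def IsInnerProductDistribution {d : ℕ} (F : Measure (EuclideanSpace ℝ (Fin d))) : Prop :=
  IsProbabilityMeasure F ∧
    ∃ S : Set (EuclideanSpace ℝ (Fin d)),
      (∀ᵐ x ∂F, x ∈ S) ∧ ∀ x ∈ S, ∀ y ∈ S, inner ℝ x y ∈ Set.Icc (0 : ℝ) 1

/-- The second moment matrix `Δ = 𝔼[X₁ X₁ᵀ]` of `X₁ ∼ F`. -/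
def secondMoment {d : ℕ} (F : Measure (EuclideanSpace ℝ (Fin d))) :
    Matrix (Fin d) (Fin d) ℝ :=
  Matrix.of fun k l => ∫ x, x k * x l ∂F

/-- The `n × d` matrix whose rows are the latent positions. -/
def latentMatrix {n d : ℕ} (x : Fin n → EuclideanSpace ℝ (Fin d)) :
    Matrix (Fin n) (Fin d) ℝ :=
  Matrix.of fun i k => x i k

/-- The edge probability matrix `P = ρ X Xᵀ`. -/
def edgeProb {n d : ℕ} (r : ℝ) (x : Fin n → EuclideanSpace ℝ (Fin d)) :
    Matrix (Fin n) (Fin n) ℝ :=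
  r • (latentMatrix x * (latentMatrix x)ᵀ)

/-- Symmetric hollow matrices with entries in `{0, 1}`. -/
structure IsAdjacency {n : ℕ} (a : Matrix (Fin n) (Fin n) ℝ) : Prop where
  zero_or_one : ∀ i j, a i j = 0 ∨ a i j = 1
  symm : aᵀ = a
  hollow : ∀ i, a i i = 0

open scoped Classical in
/-- `∏_{i < j} P_{ij}^{a_{ij}} (1 - P_{ij})^{1 - a_{ij}}`, the conditional probability of the
adjacency matrix `a` given that the latent positions are `x`. -/
def condProb {n d : ℕ} (r : ℝ) (x : Fin n → EuclideanSpace ℝ (Fin d))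
    (a : Matrix (Fin n) (Fin n) ℝ) : ℝ :=
  ∏ i, ∏ j ∈ Finset.Ioi i, if a i j = 1 then edgeProb r x i j else 1 - edgeProb r x i j

/-- `(X, A) ∼ RDPG(F)` on `n` vertices with sparsity factor `r`: the latent positions are i.i.d.
with law `F`, and given `X` the matrix `A` has the conditional law `condProb r X`. -/
structure IsRDPG {Ω : Type*} [MeasurableSpace Ω] (μ : Measure Ω) {n d : ℕ}
    (F : Measure (EuclideanSpace ℝ (Fin d))) (r : ℝ)
    (X : Ω → Fin n → EuclideanSpace ℝ (Fin d)) (A : Ω → Matrix (Fin n) (Fin n) ℝ) : Prop where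
  measurable_latent : Measurable X
  measurable_adj : ∀ a, MeasurableSet {ω | A ω = a}
  law_latent : μ.map X = Measure.pi fun _ => F
  isAdjacency : ∀ ω, IsAdjacency (A ω)
  cond_law : ∀ a, IsAdjacency a → ∀ B : Set (Fin n → EuclideanSpace ℝ (Fin d)),
    MeasurableSet B →
      μ {ω | X ω ∈ B ∧ A ω = a} =
        ∫⁻ x in B, ENNReal.ofReal (condProb r x a) ∂(Measure.pi fun _ => F)

/-- `M = [U|U'] (S ⊕ S') [U|U']ᵀ` is a spectral decomposition in which `S = diag s` carries the
`d` largest eigenvalues of the symmetric matrix `M` in decreasing order, and the columns of `U`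
are corresponding orthonormal eigenvectors. -/
def IsLeadingEigen {n d : ℕ} (M : Matrix (Fin n) (Fin n) ℝ)
    (U : Matrix (Fin n) (Fin d) ℝ) (s : Fin d → ℝ) : Prop :=
  Antitone s ∧
    ∃ (m : ℕ) (U' : Matrix (Fin n) (Fin m) ℝ) (s' : Fin m → ℝ),
      (Matrix.fromCols U U')ᵀ * Matrix.fromCols U U' = 1 ∧
      Matrix.fromCols U U' * (Matrix.fromCols U U')ᵀ = 1 ∧
      M = Matrix.fromCols U U' * Matrix.diagonal (Sum.elim s s') * (Matrix.fromCols U U')ᵀ ∧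
      ∀ i j, s' j ≤ s i

/-- `|A| = (Aᵀ A)^{1/2}`. -/
def absMatrix {n : ℕ} (a : Matrix (Fin n) (Fin n) ℝ) : Matrix (Fin n) (Fin n) ℝ :=
  CFC.sqrt (aᵀ * a)

/-- `U S^{1/2}` for `S = diag s`. -/
def embedding {n d : ℕ} (U : Matrix (Fin n) (Fin d) ℝ) (s : Fin d → ℝ) :
    Matrix (Fin n) (Fin d) ℝ :=
  U * Matrix.diagonal fun k => √(s k)

/-- A sequence of events `E n` occurs asymptotically almost surely: for every `c > 0` and all
large `n`, the event `E n` has probability at least `1 - η` whenever `n^{-c} < η < 1/2`.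
It is phrased through the (outer) measure of the complement. -/
def AsymptoticallyAlmostSurely {Ω : ℕ → Type*} [∀ n, MeasurableSpace (Ω n)]
    (μ : ∀ n, Measure (Ω n)) (E : ∀ n, Set (Ω n)) : Prop :=
  ∀ c : ℝ, 0 < c → ∃ n₀ : ℕ, ∀ n : ℕ, n₀ < n → ∀ η : ℝ,
    (n : ℝ) ^ (-c) < η → η < 1 / 2 → μ n (E n)ᶜ ≤ ENNReal.ofReal η

/-- For latent positions `x` and adjacency matrix `a`: the matrix `P = r X Xᵀ` has rank `d`, and
for every choice of leading eigenpairs of `|A|` and of `P` there is an orthogonal `W` for which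
`‖X̂ - r^{1/2} X W‖_F` and `‖(A - P) U_P S_P^{-1/2}‖_F` differ by at most `ε`.
All norms are Frobenius norms. -/
def FrobeniusExpansion {n d : ℕ} (r : ℝ) (x : Fin n → EuclideanSpace ℝ (Fin d))
    (a : Matrix (Fin n) (Fin n) ℝ) (ε : ℝ) : Prop :=
  (edgeProb r x).rank = d ∧
    ∀ (UA : Matrix (Fin n) (Fin d) ℝ) (sA : Fin d → ℝ), IsLeadingEigen (absMatrix a) UA sA →
    ∀ (UP : Matrix (Fin n) (Fin d) ℝ) (sP : Fin d → ℝ), IsLeadingEigen (edgeProb r x) UP sP →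
      ∃ W ∈ Matrix.orthogonalGroup (Fin d) ℝ,
        |‖embedding UA sA - √r • (latentMatrix x * W)‖ -
          ‖(a - edgeProb r x) * UP * Matrix.diagonal fun k => (√(sP k))⁻¹‖| ≤ ε

end RDPG

end

/-! Put `D = nρ`, `Y = √ρ X`, `E = A - P` and `Z = X̂`, so that `P = Y Yᵀ`. Full rank of the second
moment matrix gives `YᵀY ≥ g` with `g` of order `D`, by Hoeffding's inequality.

Deterministic part. If `E` has operator norm at most `b ≤ g/8`, the leading eigenvectors of `|A|`
are eigenvectors of `A` itself, so `R = A - Z Zᵀ` satisfies `R Z = 0` and has norm at most `b`.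
Polar decomposition of `Zᵀ Y` gives an orthogonal `W` for which `Z' = Z W` has `Z'ᵀ Y` symmetric and
positive definite. This alignment needs no gap between leading eigenvalues. With `Δ = Z' - Y`, `G =
YᵀY` and the symmetric `K = YᵀΔ` there is the exact identity `Δ G + Z' K - R Δ = E Y`. Pairing it
with `Δ` bounds `Δ` by `E Y`. Multiplying by `Yᵀ` gives a Lyapunov equation for `K`, which is
therefore controlled by `YᵀEY` and quadratic terms. Hence `Δ = E Y G⁻¹` up to a small error
(`exists_orthogonal_expansion`). Since `Y = U_P S_P^{1/2} O` with `O` orthogonal, `E Y G⁻¹` has the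
Frobenius norm of `E U_P S_P^{-1/2}`.

Sizes. With high probability `b` is at most of order `√D (1 + log D)`, `‖E Y‖` of order `D` and
`‖YᵀEY‖` of order `D log n`. Then `‖Δ‖` is bounded up to constants, `‖K‖` is of order `log n`, and
the error is of order `log n / √D`. The operator norm comes from a discrepancy bound on all block
sums together with row sums, at the cost of a factor `log D` that the statement can afford. The
bound on `E Y` comes from a union bound over integer vectors, and the one on `YᵀEY` from a direct
Chernoff bound (`IsRDPG.measure_bilinear_ge_le` supplies all tail bounds for `E`).

Uniformity. The final constant must not depend on the exponent of the failure probability, while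
bounds on degrees do when `D` is comparable to `log n`. If `D` is below a small multiple of `log n`,
each term is separately of order `log n / √D`. If `D` is above a large multiple, fixed constants
suffice. In between, the bad constants multiply only `1 + log D`, of order `log log n`, and `log n`
absorbs them. -/

namespace RDPG

/-! ### Frobenius norms, operator bounds and quadratic forms. -/

section FrobeniusNorm

variable {l m n : Type*} [Fintype l] [Fintype m] [Fintype n]

theorem frobenius_sq (M : Matrix m n ℝ) : ‖M‖ ^ 2 = ∑ i, ∑ j, M i j ^ 2 := by
  rw [Matrix.frobenius_norm_def, ← Real.sqrt_eq_rpow, Real.sq_sqrt (by positivity)]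
  simp

theorem frobenius_sq_cols (M : Matrix m n ℝ) : ‖M‖ ^ 2 = ∑ j, Mᵀ j ⬝ᵥ Mᵀ j := by
  rw [frobenius_sq, Finset.sum_comm]
  simp [dotProduct, sq]

theorem frobenius_sq_trace (M : Matrix m n ℝ) : ‖M‖ ^ 2 = (Mᵀ * M).trace := by
  rw [frobenius_sq_cols]; rfl

theorem trace_transpose_mul_le (M N : Matrix m n ℝ) : (Mᵀ * N).trace ≤ ‖M‖ * ‖N‖ := by
  have h : (Mᵀ * N).trace = ∑ p : m × n, M p.1 p.2 * N p.1 p.2 := by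
    rw [Fintype.sum_prod_type, Finset.sum_comm]
    simp [Matrix.trace, Matrix.mul_apply]
  have e : ∀ K : Matrix m n ℝ, ‖K‖ = √(∑ p : m × n, K p.1 p.2 ^ 2) := fun K => by
    rw [Fintype.sum_prod_type]; exact (Real.sqrt_sq (norm_nonneg K) ▸ congrArg _ (frobenius_sq K))
  rw [h, e M, e N]
  exact Real.sum_mul_le_sqrt_mul_sqrt _ _ _

theorem dotProduct_self_nonneg_real (v : n → ℝ) : 0 ≤ v ⬝ᵥ v :=
  Finset.sum_nonneg fun _ _ => mul_self_nonneg _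

theorem dotProduct_sq_le (v w : n → ℝ) : (v ⬝ᵥ w) ^ 2 ≤ (v ⬝ᵥ v) * (w ⬝ᵥ w) := by
  simpa [dotProduct, sq] using Finset.sum_mul_sq_le_sq_mul_sq Finset.univ v w

theorem mulVec_dotProduct_mulVec (M : Matrix m n ℝ) (v w : n → ℝ) :
    (M *ᵥ v) ⬝ᵥ (M *ᵥ w) = v ⬝ᵥ ((Mᵀ * M) *ᵥ w) := by
  rw [← Matrix.mulVec_mulVec, Matrix.dotProduct_mulVec v, Matrix.vecMul_transpose]

theorem frobenius_mul_of_orthonormal [DecidableEq m] (U : Matrix n m ℝ) (hU : Uᵀ * U = 1)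
    (M : Matrix m l ℝ) : ‖U * M‖ = ‖M‖ := by
  have h : ‖U * M‖ ^ 2 = ‖M‖ ^ 2 := by
    rw [frobenius_sq_trace, frobenius_sq_trace, Matrix.transpose_mul, Matrix.mul_assoc,
      ← Matrix.mul_assoc Uᵀ, hU, Matrix.one_mul]
  exact (pow_left_inj₀ (norm_nonneg _) (norm_nonneg _) two_ne_zero).1 h

theorem frobenius_mul_transpose_of_orthonormal [DecidableEq m] (U : Matrix n m ℝ)
    (hU : Uᵀ * U = 1) (M : Matrix l m ℝ) : ‖M * Uᵀ‖ = ‖M‖ := by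
  rw [← Matrix.frobenius_norm_transpose, Matrix.transpose_mul, Matrix.transpose_transpose,
    frobenius_mul_of_orthonormal U hU, Matrix.frobenius_norm_transpose]

end FrobeniusNorm

section OpBound

variable {l n : Type*} [Fintype l] [Fintype n]

/-- The Euclidean operator norm of `M` is at most `b`. -/
def OpBound (M : Matrix n n ℝ) (b : ℝ) : Prop :=
  0 ≤ b ∧ ∀ v : n → ℝ, (M *ᵥ v) ⬝ᵥ (M *ᵥ v) ≤ b ^ 2 * (v ⬝ᵥ v)

theorem OpBound.norm_mul_le {M : Matrix n n ℝ} {b : ℝ} (h : OpBound M b) (B : Matrix n l ℝ) :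
    ‖M * B‖ ≤ b * ‖B‖ := by
  refine abs_le_of_sq_le_sq' ?_ (mul_nonneg h.1 (norm_nonneg _)) |>.2
  rw [mul_pow, frobenius_sq_cols, frobenius_sq_cols, Finset.mul_sum]
  refine Finset.sum_le_sum fun j _ => ?_
  exact h.2 (Bᵀ j)

theorem OpBound.dotProduct_le {M : Matrix n n ℝ} {b : ℝ} (h : OpBound M b) (v : n → ℝ) :
    v ⬝ᵥ (M *ᵥ v) ≤ b * (v ⬝ᵥ v) := by
  have h0 := dotProduct_self_nonneg_real v
  refine abs_le_of_sq_le_sq' ?_ (mul_nonneg h.1 h0) |>.2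
  nlinarith [dotProduct_sq_le v (M *ᵥ v), mul_le_mul_of_nonneg_left (h.2 v) h0]

theorem OpBound.neg {M : Matrix n n ℝ} {b : ℝ} (h : OpBound M b) : OpBound (-M) b :=
  ⟨h.1, fun v => by simpa [Matrix.neg_mulVec] using h.2 v⟩

theorem OpBound.neg_le_dotProduct {M : Matrix n n ℝ} {b : ℝ} (h : OpBound M b) (v : n → ℝ) :
    -(b * (v ⬝ᵥ v)) ≤ v ⬝ᵥ (M *ᵥ v) := by
  have := h.neg.dotProduct_le v
  rw [Matrix.neg_mulVec, dotProduct_neg] at this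
  linarith

theorem OpBound.trace_le {M : Matrix n n ℝ} {b : ℝ} (h : OpBound M b) (B : Matrix n l ℝ) :
    (Bᵀ * (M * B)).trace ≤ b * ‖B‖ ^ 2 := by
  have := (trace_transpose_mul_le B (M * B)).trans
    (mul_le_mul_of_nonneg_left (h.norm_mul_le B) (norm_nonneg _))
  linarith [this, show ‖B‖ * (b * ‖B‖) = b * ‖B‖ ^ 2 by ring]

end OpBound

section QuadraticLowerBound

variable {l n : Type*} [Fintype l] [Fintype n]

/-- A lower bound on a quadratic form gives a lower bound on traces. -/
theorem trace_mul_mul_ge {Q : Matrix n n ℝ} {c : ℝ}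
    (h : ∀ v : n → ℝ, c * (v ⬝ᵥ v) ≤ v ⬝ᵥ (Q *ᵥ v)) (B : Matrix l n ℝ) :
    c * ‖B‖ ^ 2 ≤ (B * Q * Bᵀ).trace := by
  rw [← Matrix.frobenius_norm_transpose, frobenius_sq_cols, Finset.mul_sum]
  refine Finset.sum_le_sum fun i _ => (h _).trans (le_of_eq ?_)
  simp only [Matrix.transpose_transpose, Matrix.mul_assoc, Matrix.diag_apply]
  rw [Matrix.mul_apply]
  rfl

theorem norm_le_norm_mul_of_quadratic {Q : Matrix n n ℝ} {c : ℝ}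
    (h : ∀ v : n → ℝ, c * (v ⬝ᵥ v) ≤ v ⬝ᵥ (Q *ᵥ v)) (B : Matrix l n ℝ) :
    c * ‖B‖ ≤ ‖B * Q‖ := by
  rcases (norm_nonneg B).eq_or_lt with h0 | h0
  · rw [← h0]; simp
  · have h1 := trace_mul_mul_ge h B
    have h2 := trace_transpose_mul_le B (B * Q)
    rw [Matrix.trace_mul_comm] at h1
    have : c * ‖B‖ * ‖B‖ ≤ ‖B * Q‖ * ‖B‖ := by nlinarith
    exact le_of_mul_le_mul_right this h0

theorem isUnit_of_quadratic [DecidableEq n] {Q : Matrix n n ℝ} {c : ℝ} (hc : 0 < c)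
    (h : ∀ v : n → ℝ, c * (v ⬝ᵥ v) ≤ v ⬝ᵥ (Q *ᵥ v)) : IsUnit Q.det := by
  rw [isUnit_iff_ne_zero]
  intro h0
  obtain ⟨v, hv, hQ⟩ := Matrix.exists_mulVec_eq_zero_iff.2 h0
  have := h v
  rw [hQ, dotProduct_zero] at this
  have h1 : v ⬝ᵥ v = 0 := le_antisymm (by nlinarith) (dotProduct_self_nonneg_real v)
  exact hv (dotProduct_self_eq_zero.1 h1)

/-- A positive square root that inherits lower bounds. -/
theorem exists_sqrt_of_quadratic [DecidableEq n] {S : Matrix n n ℝ} (hS : Sᵀ = S) {c : ℝ}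
    (h : ∀ v : n → ℝ, c ^ 2 * (v ⬝ᵥ v) ≤ v ⬝ᵥ (S *ᵥ v)) :
    ∃ Q : Matrix n n ℝ, Qᵀ = Q ∧ Q * Q = S ∧ ∀ v : n → ℝ, c * (v ⬝ᵥ v) ≤ v ⬝ᵥ (Q *ᵥ v) := by
  have hH : S.IsHermitian := by
    rw [Matrix.IsHermitian, Matrix.conjTranspose_eq_transpose_of_trivial, hS]
  set V : Matrix n n ℝ := (hH.eigenvectorUnitary : Matrix n n ℝ) with hV
  set e := hH.eigenvalues
  have hVV : Vᵀ * V = 1 := by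
    have := Matrix.mem_unitaryGroup_iff'.1 hH.eigenvectorUnitary.2
    rwa [Matrix.star_eq_conjTranspose, Matrix.conjTranspose_eq_transpose_of_trivial] at this
  have hVV' : V * Vᵀ = 1 := by
    have := Matrix.mem_unitaryGroup_iff.1 hH.eigenvectorUnitary.2
    rwa [Matrix.star_eq_conjTranspose, Matrix.conjTranspose_eq_transpose_of_trivial] at this
  have hsp : S = V * Matrix.diagonal e * Vᵀ := by
    have := hH.spectral_theorem
    rw [Unitary.conjStarAlgAut_apply] at this
    simpa [Matrix.star_eq_conjTranspose, Matrix.conjTranspose_eq_transpose_of_trivial,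
      Function.comp_def] using this
  have hquad : ∀ (f : n → ℝ) (v : n → ℝ), v ⬝ᵥ ((V * Matrix.diagonal f * Vᵀ) *ᵥ v) =
      ∑ i, f i * (Vᵀ *ᵥ v) i ^ 2 := by
    intro f v
    rw [← Matrix.mulVec_mulVec, ← Matrix.mulVec_mulVec, Matrix.dotProduct_mulVec,
      ← Matrix.mulVec_transpose]
    simp only [dotProduct, Matrix.mulVec_diagonal]
    exact Finset.sum_congr rfl fun i _ => by ring
  have hnorm : ∀ v : n → ℝ, v ⬝ᵥ v = ∑ i, (Vᵀ *ᵥ v) i ^ 2 := by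
    intro v
    have := mulVec_dotProduct_mulVec Vᵀ v v
    rw [Matrix.transpose_transpose, hVV', Matrix.one_mulVec] at this
    rw [← this]; simp [dotProduct, sq]
  have he : ∀ i, c ^ 2 ≤ e i := by
    intro i
    have := h (V *ᵥ Pi.single i 1)
    rw [hsp, hquad, hnorm, Matrix.mulVec_mulVec, hVV, Matrix.one_mulVec] at this
    simpa [Pi.single_apply, ite_pow, Finset.sum_ite_eq'] using this
  refine ⟨V * Matrix.diagonal (fun i => √(e i)) * Vᵀ, ?_, ?_, fun v => ?_⟩
  · simp [Matrix.transpose_mul, Matrix.mul_assoc]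
  · conv_rhs => rw [hsp]
    have : V * Matrix.diagonal (fun i => √(e i)) * Vᵀ * (V * Matrix.diagonal (fun i => √(e i)) * Vᵀ)
        = V * Matrix.diagonal (fun i => √(e i)) * (Vᵀ * V) * Matrix.diagonal (fun i => √(e i)) * Vᵀ
        := by simp only [Matrix.mul_assoc]
    rw [this, hVV, Matrix.mul_one, Matrix.mul_assoc V, Matrix.diagonal_mul_diagonal]
    congr 3
    ext i
    exact Real.mul_self_sqrt ((sq_nonneg c).trans (he i))
  · rw [hquad, hnorm, Finset.mul_sum]
    exact Finset.sum_le_sum fun i _ =>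
      mul_le_mul_of_nonneg_right (Real.le_sqrt_of_sq_le (he i)) (sq_nonneg _)

end QuadraticLowerBound

/-! ### Procrustes alignment and the first-order expansion. -/

section Procrustes

variable {n m : Type*} [Fintype n] [Fintype m]

/-- The Procrustes alignment of `Z` with `Y`. -/
theorem exists_orthogonal_symm [DecidableEq m] (Z Y : Matrix n m ℝ) {c : ℝ} (hc : 0 < c)
    (h : ∀ v : m → ℝ, c ^ 2 * (v ⬝ᵥ v) ≤ (Zᵀ *ᵥ (Y *ᵥ v)) ⬝ᵥ (Zᵀ *ᵥ (Y *ᵥ v))) :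
    ∃ W ∈ Matrix.orthogonalGroup m ℝ, ((Z * W)ᵀ * Y)ᵀ = (Z * W)ᵀ * Y ∧
      ∀ v : m → ℝ, c * (v ⬝ᵥ v) ≤ v ⬝ᵥ (((Z * W)ᵀ * Y) *ᵥ v) := by
  set H := Zᵀ * Y with hH
  -- Polar decomposition `H = W Q` with `Q = (HᵀH)^{1/2}` and `W = H Q⁻¹`. Then `(Z W)ᵀ Y = Wᵀ H =
  -- Q`, symmetric and bounded below.
  obtain ⟨Q, hQs, hQQ, hQc⟩ := exists_sqrt_of_quadratic (S := Hᵀ * H) (by simp)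
    (fun v => by
      rw [← mulVec_dotProduct_mulVec, hH, ← Matrix.mulVec_mulVec]
      exact h v)
  have hQu := isUnit_of_quadratic hc hQc
  have hWH : (H * Q⁻¹)ᵀ * H = Q := by
    rw [Matrix.transpose_mul, Matrix.mul_assoc, ← hQQ, Matrix.transpose_nonsing_inv, hQs,
      ← Matrix.mul_assoc, Matrix.nonsing_inv_mul _ hQu, Matrix.one_mul]
  have hZ : (Z * (H * Q⁻¹))ᵀ * Y = Q := by
    rw [Matrix.transpose_mul, Matrix.mul_assoc, ← hH, hWH]
  refine ⟨H * Q⁻¹, ?_, ?_, ?_⟩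
  · rw [Matrix.mem_orthogonalGroup_iff']
    change (H * Q⁻¹)ᵀ * (H * Q⁻¹) = 1
    rw [← Matrix.mul_assoc, hWH, Matrix.mul_nonsing_inv _ hQu]
  · rw [hZ, hQs]
  · rw [hZ]; exact hQc

variable {A E R : Matrix n n ℝ} {Y Z : Matrix n m ℝ} {g b : ℝ}

/-- Cauchy–Schwarz: `|Yv|² = v · YᵀYv ≤ |v| |YᵀYv|`, and `|v|² ≤ |Yv|² / g`. Thus `Y Yᵀ` is at least
`g` on the range of `Y`. -/
theorem gram_quadratic (hg : 0 < g)
    (hY : ∀ v : m → ℝ, g * (v ⬝ᵥ v) ≤ (Y *ᵥ v) ⬝ᵥ (Y *ᵥ v)) (v : m → ℝ) :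
    g * ((Y *ᵥ v) ⬝ᵥ (Y *ᵥ v)) ≤ (Yᵀ *ᵥ (Y *ᵥ v)) ⬝ᵥ (Yᵀ *ᵥ (Y *ᵥ v)) := by
  set q := (Y *ᵥ v) ⬝ᵥ (Y *ᵥ v) with hq
  have e : q = v ⬝ᵥ (Yᵀ *ᵥ (Y *ᵥ v)) := by
    rw [hq, mulVec_dotProduct_mulVec, Matrix.mulVec_mulVec]
  have h1 := dotProduct_sq_le v (Yᵀ *ᵥ (Y *ᵥ v))
  rw [← e] at h1
  have h2 := hY v
  have h3 := dotProduct_self_nonneg_real v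
  have h4 := dotProduct_self_nonneg_real (Yᵀ *ᵥ (Y *ᵥ v))
  set r := (Yᵀ *ᵥ (Y *ᵥ v)) ⬝ᵥ (Yᵀ *ᵥ (Y *ᵥ v))
  rcases (dotProduct_self_nonneg_real (Y *ᵥ v)).eq_or_lt with h0 | h0
  · rw [hq, ← h0]; simpa using h4
  · have h5 : g * q * q ≤ r * q := by nlinarith [mul_le_mul_of_nonneg_right h2 h4]
    exact le_of_mul_le_mul_right h5 (by rw [hq]; exact h0)

/-- First order expansion of a low rank factor `Z` of the leading part of `A = Y Yᵀ + E`, after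
Procrustes alignment. -/
theorem exists_orthogonal_expansion [DecidableEq m] (hg : 0 < g) (hb : b ≤ g / 8)
    (hAE : A = Y * Yᵀ + E) (hA : Aᵀ = A)
    (hAZ : A * Z = Z * (Zᵀ * Z)) (hR : OpBound (A - Z * Zᵀ) b) (hE : OpBound E b)
    (hY : ∀ v : m → ℝ, g * (v ⬝ᵥ v) ≤ (Y *ᵥ v) ⬝ᵥ (Y *ᵥ v)) :
    ∃ W ∈ Matrix.orthogonalGroup m ℝ, ∃ δ κ : ℝ, 0 ≤ δ ∧ 0 ≤ κ ∧ g * δ ≤ 3 * ‖E * Y‖ ∧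
      2 * g * κ ≤ ‖Yᵀ * E * Y‖ + (‖Y‖ * δ) ^ 2 + b * δ ^ 2 ∧
      g * ‖Z * W - Y - E * Y * (Yᵀ * Y)⁻¹‖ ≤ (‖Y‖ + δ) * κ + b * δ := by
  set R := A - Z * Zᵀ with hRdef
  have hb0 : 0 ≤ b := hE.1
  -- On the range of `Y` one has `Z Zᵀ = Y Yᵀ + E - R ≥ g - 2b ≥ 3g/4`, while `|Yv|² ≥ g |v|²`; so
  -- `g/2` is a safe lower bound for the polar factor.
  have hZY : ∀ v : m → ℝ, (g / 2) ^ 2 * (v ⬝ᵥ v) ≤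
      (Zᵀ *ᵥ (Y *ᵥ v)) ⬝ᵥ (Zᵀ *ᵥ (Y *ᵥ v)) := by
    intro v
    set z := Y *ᵥ v with hz
    have h1 : (Zᵀ *ᵥ z) ⬝ᵥ (Zᵀ *ᵥ z) = (Yᵀ *ᵥ z) ⬝ᵥ (Yᵀ *ᵥ z) + z ⬝ᵥ (E *ᵥ z) - z ⬝ᵥ (R *ᵥ z) := by
      rw [mulVec_dotProduct_mulVec, mulVec_dotProduct_mulVec, hRdef, hAE, Matrix.sub_mulVec,
        Matrix.add_mulVec, dotProduct_sub, dotProduct_add]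
      simp
    have h2 := gram_quadratic hg hY v
    have h3 := hE.neg_le_dotProduct z
    have h4 := hR.dotProduct_le z
    have h5 := hY v
    have h6 := dotProduct_self_nonneg_real v
    rw [← hz] at h2 h5
    have h7 := dotProduct_self_nonneg_real z
    rw [h1]
    nlinarith
  obtain ⟨W, hW, hsymm, hQ⟩ := exists_orthogonal_symm Z Y (half_pos hg) hZY
  have hWW : W * Wᵀ = 1 := by
    have := (Matrix.mem_orthogonalGroup_iff _ _).1 hW
    exact this
  set Z' := Z * W with hZ'
  have hZZ : Z' * Z'ᵀ = Z * Zᵀ := by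
    rw [hZ', Matrix.transpose_mul, Matrix.mul_assoc, ← Matrix.mul_assoc W, hWW, Matrix.one_mul]
  set G := Yᵀ * Y with hG
  set Δ := Z' - Y with hΔ
  set K := Yᵀ * Δ with hK
  set Q := Z'ᵀ * Y with hQdef
  clear_value Q K Δ G Z'
  have hQY : Yᵀ * Z' = Q := by
    rw [← hsymm, hQdef, Matrix.transpose_mul, Matrix.transpose_transpose]
  have hKQ : Q = G + K := by rw [hK, hΔ, Matrix.mul_sub, hQY, hG]; abel
  have hGs : Gᵀ = G := by simp [hG]
  have hKs : Kᵀ = K := by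
    have : K = Q - G := by rw [hKQ]; abel
    rw [this, Matrix.transpose_sub, hsymm, hGs]
  have hKs' : Δᵀ * Y = K := by
    rw [← hKs, hK, Matrix.transpose_mul, Matrix.transpose_transpose]
  have hRs : Rᵀ = R := by simp [hRdef, hA]
  have hRZ : R * Z' = 0 := by
    rw [hRdef, hZ', ← Matrix.mul_assoc, Matrix.sub_mul, hAZ, Matrix.mul_assoc Z, sub_self,
      Matrix.zero_mul]
  have hRY : R * Y = -(R * Δ) := by
    rw [hΔ, Matrix.mul_sub, hRZ]; simp
  -- The exact identity behind all three estimates. It uses `E = Z' Z'ᵀ + R - Y Yᵀ`, `Z'ᵀ Y = G +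
  -- K`, and `R Y = -R Δ`, which holds because `R Z' = 0`.
  have hEq : Δ * G + Z' * K - R * Δ = E * Y := by
    have h1 : E = Z' * Z'ᵀ + R - Y * Yᵀ := by
      rw [hZZ, hRdef, hAE]; abel
    have h2 : E * Y = Z' * Q + R * Y - Y * G := by
      rw [h1, Matrix.sub_mul, Matrix.add_mul, Matrix.mul_assoc, Matrix.mul_assoc,
        ← hQdef, ← hG]
    rw [h2, hRY, hKQ, Matrix.mul_add, hΔ, Matrix.sub_mul]
    abel
  have hGq : ∀ v : m → ℝ, g * (v ⬝ᵥ v) ≤ v ⬝ᵥ (G *ᵥ v) := fun v => by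
    rw [hG, ← mulVec_dotProduct_mulVec]; exact hY v
  have hYR : Yᵀ * R = -(Δᵀ * R) := by
    have := congrArg Matrix.transpose hRY
    rwa [Matrix.transpose_neg, Matrix.transpose_mul, Matrix.transpose_mul, hRs] at this
  refine ⟨W, hW, ‖Δ‖, ‖K‖, norm_nonneg _, norm_nonneg _, ?_, ?_, ?_⟩
  -- Pair the identity with `Δ`. The trace of `ΔᵀΔQ` is at least `(g/2)‖Δ‖²`, symmetry of `K` makes
  -- the trace of `K²` nonnegative, and `R` costs at most `(g/8)‖Δ‖²`. The resulting factor `8/3` is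
  -- rounded up to `3`.
  · have h1 : Δᵀ * (E * Y) = Δᵀ * Δ * Q + K * K - Δᵀ * (R * Δ) := by
      rw [← hEq, Matrix.mul_sub, Matrix.mul_add, ← Matrix.mul_assoc, ← Matrix.mul_assoc Δᵀ Z']
      have : Δᵀ * Z' = K + Δᵀ * Δ := by rw [← hKs', hΔ, Matrix.mul_sub]; abel
      rw [this, hKQ, Matrix.mul_add, Matrix.add_mul]
      abel
    have h2 := trace_transpose_mul_le Δ (E * Y)
    have h3 : g / 2 * ‖Δ‖ ^ 2 ≤ (Δᵀ * Δ * Q).trace := by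
      have := trace_mul_mul_ge hQ Δ
      rwa [Matrix.trace_mul_comm, ← Matrix.mul_assoc] at this
    have h4 : 0 ≤ (K * K).trace := by
      have := frobenius_sq_trace K
      rw [hKs] at this; rw [← this]; positivity
    have h5 := hR.trace_le Δ
    rw [h1, Matrix.trace_sub, Matrix.trace_add] at h2
    rcases (norm_nonneg Δ).eq_or_lt with h0 | h0
    · rw [← h0]; simp
    · have : g * ‖Δ‖ * ‖Δ‖ ≤ 3 * ‖E * Y‖ * ‖Δ‖ := by nlinarith
      exact le_of_mul_le_mul_right this h0
  -- Multiply the identity by `Yᵀ`: the linear part in `K` is the Lyapunov operator `K G + G K`,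
  -- bounded below by `2g` when paired with `K`.
  · have h1 : Yᵀ * E * Y - K * K - Δᵀ * (R * Δ) = K * G + G * K := by
      rw [Matrix.mul_assoc, ← hEq, Matrix.mul_sub, Matrix.mul_add, ← Matrix.mul_assoc Yᵀ Δ,
        ← hK, ← Matrix.mul_assoc Yᵀ Z', hQY, hKQ, ← Matrix.mul_assoc Yᵀ R, hYR, Matrix.add_mul,
        Matrix.neg_mul, Matrix.mul_assoc Δᵀ]
      abel
    have h2 : 2 * g * ‖K‖ ≤ ‖K * G + G * K‖ := by
      rcases (norm_nonneg K).eq_or_lt with h0 | h0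
      · rw [← h0]; simp
      have h3 := trace_transpose_mul_le K (K * G + G * K)
      have h4 := trace_mul_mul_ge hGq K
      rw [hKs] at h3 h4
      rw [Matrix.mul_add, Matrix.trace_add, ← Matrix.mul_assoc, ← Matrix.mul_assoc,
        Matrix.trace_mul_comm (K * K) G, ← Matrix.mul_assoc, Matrix.trace_mul_comm (G * K)] at h3
      rw [Matrix.mul_assoc K G K] at h4 h3
      have h5 : 2 * g * ‖K‖ * ‖K‖ ≤ ‖K * G + G * K‖ * ‖K‖ := by nlinarith
      exact le_of_mul_le_mul_right h5 h0
    have hKn : ‖K‖ ≤ ‖Y‖ * ‖Δ‖ := by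
      have := Matrix.frobenius_norm_mul Yᵀ Δ
      rwa [Matrix.frobenius_norm_transpose, ← hK] at this
    have hKK : ‖K * K‖ ≤ (‖Y‖ * ‖Δ‖) ^ 2 := by
      have := Matrix.frobenius_norm_mul K K
      nlinarith [norm_nonneg K]
    have hRΔ : ‖Δᵀ * (R * Δ)‖ ≤ b * ‖Δ‖ ^ 2 := by
      have h3 := Matrix.frobenius_norm_mul Δᵀ (R * Δ)
      rw [Matrix.frobenius_norm_transpose] at h3
      nlinarith [hR.norm_mul_le Δ, norm_nonneg Δ]
    have h6 := norm_sub_le (Yᵀ * E * Y - K * K) (Δᵀ * (R * Δ))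
    have h7 := norm_sub_le (Yᵀ * E * Y) (K * K)
    rw [h1] at h6
    linarith
  -- Solve the identity for `Δ`: what separates `Δ` from `E Y G⁻¹` is `(R Δ - Z' K) G⁻¹`.
  · have hGu := isUnit_of_quadratic hg hGq
    have h1 : (Δ - E * Y * G⁻¹) * G = R * Δ - Z' * K := by
      rw [Matrix.sub_mul, Matrix.mul_assoc (E * Y), Matrix.nonsing_inv_mul _ hGu, Matrix.mul_one,
        ← hEq]
      abel
    have h2 := norm_le_norm_mul_of_quadratic hGq (Δ - E * Y * G⁻¹)
    rw [h1] at h2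
    have h3 := norm_sub_le (R * Δ) (Z' * K)
    have h4 := hR.norm_mul_le Δ
    have h5 := Matrix.frobenius_norm_mul Z' K
    have h6 : ‖Z'‖ ≤ ‖Y‖ + ‖Δ‖ := by
      have : Z' = Y + Δ := by rw [hΔ]; abel
      rw [this]; exact norm_add_le _ _
    have h7 := mul_le_mul_of_nonneg_right h6 (norm_nonneg K)
    rw [← hZ', ← hΔ]
    linarith

end Procrustes

/-! ### Spectral splittings and variational bounds on eigenvalues. -/

/-- `M = U diag(s) Uᵀ + U' diag(s') U'ᵀ` with `[U | U']` orthogonal. -/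
structure EigenSplit {n m k : Type*} [Fintype n] [Fintype m] [Fintype k] [DecidableEq n]
    [DecidableEq m] [DecidableEq k]
    (M : Matrix n n ℝ) (U : Matrix n m ℝ) (U' : Matrix n k ℝ) (s : m → ℝ) (s' : k → ℝ) :
    Prop where
  left : Uᵀ * U = 1
  right : U'ᵀ * U' = 1
  cross : Uᵀ * U' = 0
  total : U * Uᵀ + U' * U'ᵀ = 1
  eq : M = U * Matrix.diagonal s * Uᵀ + U' * Matrix.diagonal s' * U'ᵀ

theorem IsLeadingEigen.exists_eigenSplit {n d : ℕ} {M : Matrix (Fin n) (Fin n) ℝ}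
    {U : Matrix (Fin n) (Fin d) ℝ} {s : Fin d → ℝ} (h : IsLeadingEigen M U s) :
    ∃ (m : ℕ) (U' : Matrix (Fin n) (Fin m) ℝ) (s' : Fin m → ℝ),
      EigenSplit M U U' s s' ∧ ∀ i j, s' j ≤ s i := by
  obtain ⟨-, m, U', s', h1, h2, h3, h4⟩ := h
  rw [Matrix.transpose_fromCols] at h1 h2 h3
  rw [Matrix.fromRows_mul_fromCols, ← Matrix.fromBlocks_one, Matrix.fromBlocks_inj] at h1
  rw [Matrix.fromCols_mul_fromRows] at h2
  rw [← Matrix.fromBlocks_diagonal, Matrix.fromCols_mul_fromBlocks,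
    Matrix.fromCols_mul_fromRows] at h3
  refine ⟨m, U', s', ⟨h1.1, h1.2.2.2, h1.2.1, h2, ?_⟩, h4⟩
  simpa using h3

namespace EigenSplit

variable {n m k : Type*} [Fintype n] [Fintype m] [Fintype k] [DecidableEq n]
    [DecidableEq m] [DecidableEq k] {M : Matrix n n ℝ} {U : Matrix n m ℝ} {U' : Matrix n k ℝ}
    {s : m → ℝ} {s' : k → ℝ} (h : EigenSplit M U U' s s')
include h

theorem cross' : U'ᵀ * U = 0 := by
  have := congrArg Matrix.transpose h.cross
  simpa using this

theorem mul_left : M * U = U * Matrix.diagonal s := by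
  rw [h.eq, Matrix.add_mul, Matrix.mul_assoc, h.left, Matrix.mul_assoc _ _ U, h.cross']
  simp

theorem mul_right : M * U' = U' * Matrix.diagonal s' := by
  rw [h.eq, Matrix.add_mul, Matrix.mul_assoc, h.cross, Matrix.mul_assoc _ _ U', h.right]
  simp

theorem mul_self : EigenSplit (M * M) U U' (fun i => s i ^ 2) (fun j => s' j ^ 2) where
  left := h.left
  right := h.right
  cross := h.cross
  total := h.total
  eq := by
    conv_lhs => rw [← Matrix.mul_one (M * M), ← h.total]
    rw [Matrix.mul_add, ← Matrix.mul_assoc (M * M), ← Matrix.mul_assoc (M * M), Matrix.mul_assoc M M U,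
      Matrix.mul_assoc M M U', h.mul_left, h.mul_right, ← Matrix.mul_assoc, ← Matrix.mul_assoc,
      h.mul_left, h.mul_right, Matrix.mul_assoc U, Matrix.mul_assoc U',
      Matrix.diagonal_mul_diagonal, Matrix.diagonal_mul_diagonal]
    simp [sq]

theorem dotProduct_self_eq (v : n → ℝ) :
    v ⬝ᵥ v = ∑ i, (Uᵀ *ᵥ v) i ^ 2 + ∑ j, (U'ᵀ *ᵥ v) j ^ 2 := by
  have e : v = (U * Uᵀ + U' * U'ᵀ) *ᵥ v := by rw [h.total, Matrix.one_mulVec]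
  conv_lhs => rhs; rw [e, Matrix.add_mulVec]
  rw [dotProduct_add]
  have h1 := mulVec_dotProduct_mulVec Uᵀ v v
  have h2 := mulVec_dotProduct_mulVec U'ᵀ v v
  rw [Matrix.transpose_transpose] at h1 h2
  rw [← h1, ← h2]
  simp [dotProduct, sq]

theorem quadratic_eq (v : n → ℝ) :
    v ⬝ᵥ (M *ᵥ v) = ∑ i, s i * (Uᵀ *ᵥ v) i ^ 2 + ∑ j, s' j * (U'ᵀ *ᵥ v) j ^ 2 := by
  have aux : ∀ {l : Type _} [Fintype l] [DecidableEq l] (V : Matrix n l ℝ) (f : l → ℝ),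
      v ⬝ᵥ ((V * Matrix.diagonal f * Vᵀ) *ᵥ v) = ∑ i, f i * (Vᵀ *ᵥ v) i ^ 2 := by
    intro l _ _ V f
    rw [← Matrix.mulVec_mulVec, ← Matrix.mulVec_mulVec, Matrix.dotProduct_mulVec,
      ← Matrix.mulVec_transpose]
    simp only [dotProduct, Matrix.mulVec_diagonal]
    exact Finset.sum_congr rfl fun i _ => by ring
  conv_lhs => rw [h.eq, Matrix.add_mulVec, dotProduct_add, aux]
  congr 1
  rw [← Matrix.mulVec_mulVec, ← Matrix.mulVec_mulVec, Matrix.dotProduct_mulVec,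
      ← Matrix.mulVec_transpose]
  simp only [dotProduct, Matrix.mulVec_diagonal]
  exact Finset.sum_congr rfl fun i _ => by ring

theorem left_eq_quadratic (i : m) :
    s i = (U *ᵥ Pi.single i 1) ⬝ᵥ (M *ᵥ (U *ᵥ Pi.single i 1)) := by
  rw [h.quadratic_eq, Matrix.mulVec_mulVec, Matrix.mulVec_mulVec, h.left, h.cross']
  simp [Matrix.one_apply, ite_pow]

theorem left_unit (i : m) : (U *ᵥ Pi.single i 1) ⬝ᵥ (U *ᵥ Pi.single i 1) = 1 := by
  rw [mulVec_dotProduct_mulVec, h.left]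
  simp

theorem right_eq_quadratic (j : k) :
    s' j = (U' *ᵥ Pi.single j 1) ⬝ᵥ (M *ᵥ (U' *ᵥ Pi.single j 1)) := by
  rw [h.quadratic_eq, Matrix.mulVec_mulVec, Matrix.mulVec_mulVec, h.right, h.cross]
  simp [Matrix.one_apply, ite_pow]

/-- A lower bound for the leading eigenvalues, from a subspace of the right dimension. -/
theorem le_left (hs : ∀ i j, s' j ≤ s i) {Y : Matrix n m ℝ} {g c : ℝ} (hg : 0 < g)
    (hY : ∀ v : m → ℝ, g * (v ⬝ᵥ v) ≤ (Y *ᵥ v) ⬝ᵥ (Y *ᵥ v))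
    (hM : ∀ v : m → ℝ, c * ((Y *ᵥ v) ⬝ᵥ (Y *ᵥ v)) ≤ (Y *ᵥ v) ⬝ᵥ (M *ᵥ (Y *ᵥ v))) (i : m) :
    c ≤ s i := by
  -- Dimension count: deleting one of the `m` conditions leaves a nonzero `w` for which `Y w` is
  -- orthogonal to every column of `U` except the `i`-th. On such a vector the form of `M` is at
  -- most `s i` times the squared norm.
  have hdet : ((Uᵀ * Y).updateRow i 0).det = 0 :=
    Matrix.det_eq_zero_of_row_eq_zero i (fun j => by simp)
  obtain ⟨w, hw, hw0⟩ := Matrix.exists_mulVec_eq_zero_iff.2 hdet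
  have hz : ∀ l, l ≠ i → (Uᵀ *ᵥ (Y *ᵥ w)) l = 0 := by
    intro l hl
    have := congrFun hw0 l
    rw [Matrix.mulVec_mulVec]
    simpa [Matrix.mulVec, Matrix.updateRow_ne hl] using this
  have hpos : 0 < (Y *ᵥ w) ⬝ᵥ (Y *ᵥ w) := by
    have h0 : 0 < w ⬝ᵥ w := (dotProduct_self_nonneg_real w).lt_of_ne fun h0 =>
      hw (dotProduct_self_eq_zero.1 h0.symm)
    exact (mul_pos hg h0).trans_le (hY w)
  set x := Y *ᵥ w with hx
  have h1 : x ⬝ᵥ (M *ᵥ x) ≤ s i * (x ⬝ᵥ x) := by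
    rw [h.quadratic_eq, h.dotProduct_self_eq x, mul_add, Finset.mul_sum, Finset.mul_sum]
    refine add_le_add (Finset.sum_le_sum fun l _ => ?_) (Finset.sum_le_sum fun j _ => ?_)
    · by_cases hl : l = i
      · rw [hl]
      · rw [hz l hl]; simp
    · exact mul_le_mul_of_nonneg_right (hs i j) (sq_nonneg _)
  have h2 := (hM w).trans h1
  exact le_of_mul_le_mul_right h2 hpos

/-- An upper bound for the remaining eigenvalues, from a subspace of the right codimension. -/
theorem right_le (hs : ∀ i j, s' j ≤ s i) {Y : Matrix n m ℝ} {c : ℝ}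
    (hM : ∀ v : n → ℝ, Yᵀ *ᵥ v = 0 → v ⬝ᵥ (M *ᵥ v) ≤ c * (v ⬝ᵥ v)) (j : k) :
    s' j ≤ c := by
  -- The columns of `U` and the `j`-th column of `U'` span `m + 1` dimensions, and `Yᵀ` imposes only
  -- `m` conditions. Padding with a zero row makes the system square and singular, so its kernel
  -- contains a nonzero vector.
  set C : Matrix n (m ⊕ Unit) ℝ := Matrix.fromCols U (U'.submatrix id fun _ => j) with hC
  set B : Matrix (m ⊕ Unit) (m ⊕ Unit) ℝ := Matrix.fromRows (Yᵀ * C) 0 with hB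
  have hdet : B.det = 0 := Matrix.det_eq_zero_of_row_eq_zero (Sum.inr ()) (fun j => by simp [hB])
  obtain ⟨z, hz, hz0⟩ := Matrix.exists_mulVec_eq_zero_iff.2 hdet
  set x := C *ᵥ z with hx
  have hYx : Yᵀ *ᵥ x = 0 := by
    ext i
    have := congrFun hz0 (Sum.inl i)
    rw [hx, Matrix.mulVec_mulVec]
    simpa [hB, Matrix.mulVec] using this
  have hUx : Uᵀ *ᵥ x = fun i => z (Sum.inl i) := by
    have : Uᵀ * C = Matrix.fromCols 1 0 := by
      rw [hC, Matrix.mul_fromCols, h.left]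
      congr 1
      ext i u
      exact congrFun (congrFun h.cross i) j
    rw [hx, Matrix.mulVec_mulVec, this]
    ext i
    simp [Matrix.mulVec, dotProduct, Fintype.sum_sum_type, Matrix.one_apply]
  have hUx' : U'ᵀ *ᵥ x = Pi.single j (z (Sum.inr ())) := by
    have : U'ᵀ * C = Matrix.fromCols 0 ((1 : Matrix k k ℝ).submatrix id fun _ => j) := by
      rw [hC, Matrix.mul_fromCols, h.cross']
      congr 1
      ext i u
      exact congrFun (congrFun h.right i) j
    rw [hx, Matrix.mulVec_mulVec, this]
    ext i
    simp [Matrix.mulVec, dotProduct, Fintype.sum_sum_type, Matrix.one_apply, Pi.single_apply]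
  have hpos : 0 < x ⬝ᵥ x := by
    rw [h.dotProduct_self_eq, hUx, hUx']
    by_contra hcon
    have h1 : ∀ i, z (Sum.inl i) = 0 ∧ z (Sum.inr ()) = 0 := by
      intro i
      have ha : z (Sum.inl i) ^ 2 ≤ ∑ i, z (Sum.inl i) ^ 2 :=
        Finset.single_le_sum (f := fun i => z (Sum.inl i) ^ 2) (fun _ _ => sq_nonneg _)
          (Finset.mem_univ i)
      simp [Pi.single_apply, ite_pow] at hcon
      constructor <;> nlinarith [sq_nonneg (z (Sum.inl i)), sq_nonneg (z (Sum.inr ()))]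
    have h2 : z (Sum.inr ()) = 0 := by
      have ha : 0 ≤ ∑ i, z (Sum.inl i) ^ 2 := Finset.sum_nonneg fun _ _ => sq_nonneg _
      simp [Pi.single_apply, ite_pow] at hcon
      nlinarith [sq_nonneg (z (Sum.inr ()))]
    apply hz
    ext i
    rcases i with i | i
    · exact (h1 i).1
    · exact h2
  have h1 : s' j * (x ⬝ᵥ x) ≤ x ⬝ᵥ (M *ᵥ x) := by
    rw [h.quadratic_eq, h.dotProduct_self_eq x, mul_add, Finset.mul_sum, Finset.mul_sum]
    refine add_le_add (Finset.sum_le_sum fun l _ => ?_) (Finset.sum_le_sum fun l _ => ?_)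
    · exact mul_le_mul_of_nonneg_right (hs l j) (sq_nonneg _)
    · by_cases hl : l = j
      · rw [hl]
      · rw [hUx']; simp [Pi.single_eq_of_ne hl]
  exact le_of_mul_le_mul_right (h1.trans (hM x hYx)) hpos

end EigenSplit

/-! ### Leading eigenpairs of `P` and of `|A|`. -/

theorem absMatrix_mul_self {n : ℕ} (a : Matrix (Fin n) (Fin n) ℝ) :
    absMatrix a * absMatrix a = aᵀ * a := by
  have h : 0 ≤ aᵀ * a := by
    rw [Matrix.nonneg_iff_posSemidef]
    simpa [Matrix.conjTranspose_eq_transpose_of_trivial] using Matrix.posSemidef_conjTranspose_mul_self a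
  exact CFC.sqrt_mul_sqrt_self _ h

theorem absMatrix_quadratic_nonneg {n : ℕ} (a : Matrix (Fin n) (Fin n) ℝ) (v : Fin n → ℝ) :
    0 ≤ v ⬝ᵥ (absMatrix a *ᵥ v) := by
  have h : 0 ≤ absMatrix a := CFC.sqrt_nonneg _
  rw [Matrix.nonneg_iff_posSemidef] at h
  simpa using h.dotProduct_mulVec_nonneg v

section Factor

variable {n d : ℕ} {P : Matrix (Fin n) (Fin n) ℝ} {Y U : Matrix (Fin n) (Fin d) ℝ}
  {s : Fin d → ℝ} {g : ℝ}

/-- The leading eigenpairs of `P = Y Yᵀ` give the polar type factorization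
`Y = U diag(√s) O`. -/
theorem exists_orthogonal_factor (hg : 0 < g)
    (hY : ∀ v : Fin d → ℝ, g * (v ⬝ᵥ v) ≤ (Y *ᵥ v) ⬝ᵥ (Y *ᵥ v)) (hP : P = Y * Yᵀ)
    (h : IsLeadingEigen P U s) :
    Uᵀ * U = 1 ∧ (∀ i, g ≤ s i) ∧ ∃ O : Matrix (Fin d) (Fin d) ℝ, Oᵀ * O = 1 ∧ O * Oᵀ = 1 ∧
      Y = U * Matrix.diagonal (fun k => √(s k)) * O ∧
      Yᵀ * U * Matrix.diagonal (fun k => (√(s k))⁻¹) = Oᵀ := by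
  obtain ⟨m, U', s', hs, hle⟩ := h.exists_eigenSplit
  have hPq : ∀ v : Fin n → ℝ, v ⬝ᵥ (P *ᵥ v) = (Yᵀ *ᵥ v) ⬝ᵥ (Yᵀ *ᵥ v) := fun v => by
    rw [mulVec_dotProduct_mulVec, hP, Matrix.transpose_transpose]
  have hsg : ∀ i, g ≤ s i := hs.le_left hle hg hY fun v => by
    rw [hPq]; exact gram_quadratic hg hY v
  -- `P` vanishes on the kernel of `Yᵀ`, so the non-leading eigenvalues are at most `0`, and `P` is
  -- positive semidefinite. Hence `U'` is orthogonal to the columns of `Y`.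
  have hs'0 : ∀ j, s' j = 0 := fun j => le_antisymm
    (hs.right_le hle (Y := Y) (c := 0) (fun v hv => by rw [hPq, hv]; simp) j)
    (by rw [hs.right_eq_quadratic j, hPq]; exact dotProduct_self_nonneg_real _)
  have hU'Y : U'ᵀ * Y = 0 := by
    have h1 : ‖U'ᵀ * Y‖ ^ 2 = 0 := by
      rw [← Matrix.frobenius_norm_transpose, frobenius_sq_trace, Matrix.transpose_transpose,
        Matrix.transpose_mul, Matrix.transpose_transpose, Matrix.mul_assoc, ← Matrix.mul_assoc Y,
        ← hP, hs.mul_right]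
      have : s' = 0 := funext hs'0
      simp [this]
    exact norm_eq_zero.1 (pow_eq_zero_iff two_ne_zero |>.1 h1)
  have hUY : U * (Uᵀ * Y) = Y := by
    have := congrArg (· * Y) hs.total
    simpa [Matrix.add_mul, Matrix.mul_assoc, hU'Y] using this
  have hspos : ∀ i, 0 < √(s i) := fun i => Real.sqrt_pos.2 (hg.trans_le (hsg i))
  set Si := Matrix.diagonal (fun k => (√(s k))⁻¹) with hSi
  set Sh := Matrix.diagonal (fun k => √(s k)) with hSh
  have h1 : Sh * Si = 1 := by
    rw [hSi, hSh, Matrix.diagonal_mul_diagonal, ← Matrix.diagonal_one]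
    congr 1; ext i; exact mul_inv_cancel₀ (hspos i).ne'
  have h2 : Si * Matrix.diagonal s * Si = 1 := by
    rw [hSi, Matrix.diagonal_mul_diagonal, Matrix.diagonal_mul_diagonal, ← Matrix.diagonal_one]
    congr 1; ext i
    have := Real.mul_self_sqrt (hg.le.trans (hsg i))
    have := (hspos i).ne'
    field_simp
    nlinarith
  have hSit : Siᵀ = Si := by simp [hSi]
  have hOO : (Si * Uᵀ * Y) * (Si * Uᵀ * Y)ᵀ = 1 := by
    rw [Matrix.transpose_mul, Matrix.transpose_mul, Matrix.transpose_transpose, hSit,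
      Matrix.mul_assoc _ Y, ← Matrix.mul_assoc Y, ← hP, ← Matrix.mul_assoc P, hs.mul_left,
      Matrix.mul_assoc Si, Matrix.mul_assoc U, ← Matrix.mul_assoc Uᵀ, hs.left, Matrix.one_mul,
      ← Matrix.mul_assoc, h2]
  refine ⟨hs.left, hsg, Si * Uᵀ * Y, mul_eq_one_comm.1 hOO, hOO, ?_, ?_⟩
  · rw [Matrix.mul_assoc Si, ← Matrix.mul_assoc, Matrix.mul_assoc U, h1, Matrix.mul_one, hUY]
  · rw [Matrix.transpose_mul, Matrix.transpose_mul, hSit, Matrix.transpose_transpose,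
      Matrix.mul_assoc]

end Factor

section LeadingAbs

variable {n d : ℕ} {a E : Matrix (Fin n) (Fin n) ℝ} {Y U : Matrix (Fin n) (Fin d) ℝ}
  {s : Fin d → ℝ} {g b : ℝ}

/-- The leading singular values of `a = Y Yᵀ + E` are eigenvalues of `a`, and what remains of `a`
is small. -/
theorem leading_abs (hg : 0 < g) (hb : b ≤ g / 8) (ha : aᵀ = a) (hE : OpBound E b)
    (haE : a = Y * Yᵀ + E) (hY : ∀ v : Fin d → ℝ, g * (v ⬝ᵥ v) ≤ (Y *ᵥ v) ⬝ᵥ (Y *ᵥ v))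
    (h : IsLeadingEigen (absMatrix a) U s) :
    Uᵀ * U = 1 ∧ (∀ i, 0 ≤ s i) ∧ a * U = U * Matrix.diagonal s ∧
      OpBound (a - U * Matrix.diagonal s * Uᵀ) b := by
  obtain ⟨m, U', s', hs, hle⟩ := h.exists_eigenSplit
  have hb0 := hE.1
  have hs0 : ∀ i, 0 ≤ s i := fun i => by
    rw [hs.left_eq_quadratic i]; exact absMatrix_quadratic_nonneg _ _
  have hs0' : ∀ j, 0 ≤ s' j := fun j => by
    rw [hs.right_eq_quadratic j]; exact absMatrix_quadratic_nonneg _ _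
  have hsq := hs.mul_self
  rw [absMatrix_mul_self, ha] at hsq
  have hle2 : ∀ i j, s' j ^ 2 ≤ s i ^ 2 := fun i j => pow_le_pow_left₀ (hs0' j) (hle i j) 2
  have hquad : ∀ v : Fin n → ℝ, v ⬝ᵥ ((a * a) *ᵥ v) = (a *ᵥ v) ⬝ᵥ (a *ᵥ v) := fun v => by
    rw [mulVec_dotProduct_mulVec, ha]
  have haq : ∀ v : Fin n → ℝ, v ⬝ᵥ (a *ᵥ v) = (Yᵀ *ᵥ v) ⬝ᵥ (Yᵀ *ᵥ v) + v ⬝ᵥ (E *ᵥ v) :=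
    fun v => by
      rw [haE, Matrix.add_mulVec, dotProduct_add, mulVec_dotProduct_mulVec,
        Matrix.transpose_transpose]
  -- On the range of `Y` the form of `a` is at least `g - b`, hence `|a z| ≥ (g/2)|z|`. The
  -- variational bound is applied to `a²`, whose eigenvectors are those of `|a|`.
  have hsg : ∀ i, g / 2 ≤ s i := by
    intro i
    refine abs_le_of_sq_le_sq' ?_ (hs0 i) |>.2
    refine hsq.le_left hle2 hg hY (fun v => ?_) i
    rw [hquad]
    set z := Y *ᵥ v with hz
    have hzz := dotProduct_self_nonneg_real z
    have h1 := gram_quadratic hg hY v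
    rw [← hz] at h1
    have h2 := hE.neg_le_dotProduct z
    have h3 := haq z
    have h4 := dotProduct_sq_le z (a *ᵥ z)
    have h5 : g / 2 * (z ⬝ᵥ z) ≤ z ⬝ᵥ (a *ᵥ z) := by rw [h3]; nlinarith
    rcases hzz.eq_or_lt with h0 | h0
    · rw [← h0]; simpa using dotProduct_self_nonneg_real (a *ᵥ z)
    · have h6 : ((g / 2) ^ 2 * (z ⬝ᵥ z)) * (z ⬝ᵥ z) ≤ ((a *ᵥ z) ⬝ᵥ (a *ᵥ z)) * (z ⬝ᵥ z) := by
        have := pow_le_pow_left₀ (by positivity) h5 2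
        nlinarith
      exact le_of_mul_le_mul_right h6 h0
  -- On the kernel of `Yᵀ` the matrix `a` acts as `E`.
  have hsb' : ∀ j, s' j ^ 2 ≤ b ^ 2 := by
    refine hsq.right_le hle2 (Y := Y) fun v hv => ?_
    rw [hquad, haE, Matrix.add_mulVec, ← Matrix.mulVec_mulVec, hv, Matrix.mulVec_zero, zero_add]
    exact hE.2 v
  -- Since `a² U = U S²`, each column of `T = a U - U S` that is nonzero would be an eigenvector of
  -- `a` with eigenvalue `-s l ≤ -g/2`. This contradicts `a ≥ -b ≥ -g/8`.
  have haU : a * U = U * Matrix.diagonal s := by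
    rw [← sub_eq_zero]
    set T := a * U - U * Matrix.diagonal s with hT
    have hT1 : a * T = -(T * Matrix.diagonal s) := by
      have h1 := hsq.mul_left
      rw [hT, Matrix.mul_sub, Matrix.sub_mul, ← Matrix.mul_assoc, h1, Matrix.mul_assoc U,
        Matrix.diagonal_mul_diagonal, ← Matrix.mul_assoc]
      simp [sq]
    ext i l
    have hcol : a *ᵥ (Tᵀ l) = -(s l • Tᵀ l) := by
      ext i
      have := congrFun (congrFun hT1 i) l
      rw [Matrix.neg_apply, Matrix.mul_diagonal] at this
      rw [Pi.neg_apply, Pi.smul_apply, smul_eq_mul, mul_comm]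
      exact this
    set t := Tᵀ l with ht
    have h1 : t ⬝ᵥ (a *ᵥ t) = -(s l * (t ⬝ᵥ t)) := by rw [hcol]; simp
    have h2 := haq t
    have h3 := hE.neg_le_dotProduct t
    have h4 := dotProduct_self_nonneg_real (Yᵀ *ᵥ t)
    have h5 := hsg l
    have h6 := dotProduct_self_nonneg_real t
    have h7 : t ⬝ᵥ t = 0 := le_antisymm (by nlinarith) h6
    exact congrFun (dotProduct_self_eq_zero.1 h7) i
  refine ⟨hs.left, hs0, haU, hb0, fun v => ?_⟩
  have h1 : (a - U * Matrix.diagonal s * Uᵀ) *ᵥ v = a *ᵥ ((U' * U'ᵀ) *ᵥ v) := by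
    rw [← haU, Matrix.mulVec_mulVec]
    have : U' * U'ᵀ = 1 - U * Uᵀ := by rw [← hs.total]; abel
    rw [this, Matrix.mul_sub, Matrix.mul_one, Matrix.mul_assoc]
  rw [h1, ← hquad, hsq.quadratic_eq, hs.dotProduct_self_eq v, Matrix.mulVec_mulVec,
    Matrix.mulVec_mulVec, ← Matrix.mul_assoc, ← Matrix.mul_assoc, hs.cross, hs.right,
    Matrix.zero_mul, Matrix.one_mul, Matrix.zero_mulVec, mul_add]
  have h2 : 0 ≤ b ^ 2 * ∑ i, (Uᵀ *ᵥ v) i ^ 2 :=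
    mul_nonneg (sq_nonneg _) (Finset.sum_nonneg fun _ _ => sq_nonneg _)
  have h3 : ∑ j, s' j ^ 2 * (U'ᵀ *ᵥ v) j ^ 2 ≤ b ^ 2 * ∑ j, (U'ᵀ *ᵥ v) j ^ 2 := by
    rw [Finset.mul_sum]
    exact Finset.sum_le_sum fun j _ => mul_le_mul_of_nonneg_right (hsb' j) (sq_nonneg _)
  simpa using h3.trans (le_add_of_nonneg_left h2)

theorem leading_abs_le (hab : OpBound a b)
    (h : IsLeadingEigen (absMatrix a) U s) :
    Uᵀ * U = 1 ∧ ∀ i, 0 ≤ s i ∧ s i ≤ b := by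
  obtain ⟨m, U', s', hs, -⟩ := h.exists_eigenSplit
  have hs0 : ∀ i, 0 ≤ s i := fun i => by
    rw [hs.left_eq_quadratic i]; exact absMatrix_quadratic_nonneg _ _
  refine ⟨hs.left, fun i => ⟨hs0 i, abs_le_of_sq_le_sq' ?_ hab.1 |>.2⟩⟩
  have h1 := hs.mul_self.left_eq_quadratic i
  have h2 := hab.2 (U *ᵥ Pi.single i 1)
  rw [hs.left_unit, mulVec_dotProduct_mulVec] at h2
  rw [absMatrix_mul_self] at h1
  linarith

end LeadingAbs

/-! ### Deterministic forms of the expansion. -/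

section Deterministic

variable {n d : ℕ} {r g b D l : ℝ} {x : Fin n → EuclideanSpace ℝ (Fin d)}
  {a : Matrix (Fin n) (Fin n) ℝ}

theorem edgeProb_eq_mul_transpose (hr : 0 ≤ r) (x : Fin n → EuclideanSpace ℝ (Fin d)) :
    edgeProb r x = (√r • latentMatrix x) * (√r • latentMatrix x)ᵀ := by
  rw [edgeProb, Matrix.transpose_smul, Matrix.smul_mul, Matrix.mul_smul, smul_smul,
    Real.mul_self_sqrt hr]

theorem rank_edgeProb (hr : 0 ≤ r) (hg : 0 < g)
    (hY : ∀ v : Fin d → ℝ, g * (v ⬝ᵥ v) ≤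
      ((√r • latentMatrix x) *ᵥ v) ⬝ᵥ ((√r • latentMatrix x) *ᵥ v)) :
    (edgeProb r x).rank = d := by
  rw [edgeProb_eq_mul_transpose hr, Matrix.rank_self_mul_transpose]
  rw [← Matrix.rank_transpose_mul_self]
  have h := isUnit_of_quadratic (Q := (√r • latentMatrix x)ᵀ * (√r • latentMatrix x)) hg
    fun v => by rw [← mulVec_dotProduct_mulVec]; exact hY v
  rw [Matrix.rank_of_isUnit _ ((Matrix.isUnit_iff_isUnit_det _).2 h), Fintype.card_fin]

theorem norm_embedding_sq {U : Matrix (Fin n) (Fin d) ℝ} {s : Fin d → ℝ} (hU : Uᵀ * U = 1)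
    (hs : ∀ i, 0 ≤ s i) : ‖embedding U s‖ ^ 2 = ∑ i, s i := by
  rw [embedding, frobenius_mul_of_orthonormal U hU, frobenius_sq]
  refine Finset.sum_congr rfl fun i _ => ?_
  rw [Finset.sum_eq_single i (fun j _ hj => by simp [Matrix.diagonal_apply_ne _ hj.symm])
    (by simp)]
  simp [Real.sq_sqrt (hs i)]

/-- The crude form of the expansion, for graphs with small degrees. -/
theorem frobeniusExpansion_of_opBound (hr : 0 ≤ r) (hg : 0 < g)
    (hY : ∀ v : Fin d → ℝ, g * (v ⬝ᵥ v) ≤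
      ((√r • latentMatrix x) *ᵥ v) ⬝ᵥ ((√r • latentMatrix x) *ᵥ v))
    (hYD : ‖√r • latentMatrix x‖ ≤ √D) (hab : OpBound a b) :
    FrobeniusExpansion r x a (√(d * b) + 2 * √D + b * √(d / g)) := by
  -- No alignment is needed: each of `X̂`, `Y`, `A U_P S_P^{-1/2}` and `P U_P S_P^{-1/2}` is bounded
  -- separately, the last being `Y Oᵀ`.
  refine ⟨rank_edgeProb hr hg hY, fun UA sA hA UP sP hP => ⟨1, one_mem _, ?_⟩⟩
  obtain ⟨hUA, hsA⟩ := leading_abs_le hab hA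
  obtain ⟨hUP, hsP, O, hO, hO', hYO, hYU⟩ := exists_orthogonal_factor hg hY
    (edgeProb_eq_mul_transpose hr x) hP
  rw [Matrix.mul_one]
  set Y := √r • latentMatrix x with hYdef
  have h1 : ‖embedding UA sA‖ ≤ √(d * b) := by
    refine Real.le_sqrt_of_sq_le ?_
    rw [norm_embedding_sq hUA fun i => (hsA i).1]
    refine (Finset.sum_le_sum fun i _ => (hsA i).2).trans ?_
    simp
  have h2 : ‖edgeProb r x * UP * Matrix.diagonal fun k => (√(sP k))⁻¹‖ ≤ √D := by
    rw [edgeProb_eq_mul_transpose hr, ← hYdef, Matrix.mul_assoc Y, Matrix.mul_assoc Y, hYU,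
      frobenius_mul_transpose_of_orthonormal O hO]
    exact hYD
  have h3 : ‖a * UP * Matrix.diagonal fun k => (√(sP k))⁻¹‖ ≤ b * √(d / g) := by
    rw [Matrix.mul_assoc]
    refine (hab.norm_mul_le _).trans (mul_le_mul_of_nonneg_left ?_ hab.1)
    rw [frobenius_mul_of_orthonormal UP hUP]
    refine Real.le_sqrt_of_sq_le ?_
    rw [frobenius_sq]
    have : ∀ i, ∑ j, (Matrix.diagonal fun k => (√(sP k))⁻¹) i j ^ 2 ≤ 1 / g := by
      intro i
      rw [Finset.sum_eq_single i (fun j _ hj => by simp [Matrix.diagonal_apply_ne _ hj.symm])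
        (by simp)]
      rw [Matrix.diagonal_apply_eq, inv_pow, Real.sq_sqrt (hg.le.trans (hsP i)), ← one_div]
      exact one_div_le_one_div_of_le hg (hsP i)
    refine (Finset.sum_le_sum fun i _ => this i).trans ?_
    simp [div_eq_mul_inv]
  have h4 : ‖(a - edgeProb r x) * UP * Matrix.diagonal fun k => (√(sP k))⁻¹‖ ≤
      b * √(d / g) + √D := by
    rw [Matrix.sub_mul, Matrix.sub_mul]
    exact (norm_sub_le _ _).trans (add_le_add h3 h2)
  have h5 : ‖embedding UA sA - Y‖ ≤ √(d * b) + √D :=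
    (norm_sub_le _ _).trans (add_le_add h1 hYD)
  rw [hYdef] at h5
  rw [abs_le]
  have := norm_nonneg (embedding UA sA - √r • latentMatrix x)
  have := norm_nonneg ((a - edgeProb r x) * UP * Matrix.diagonal fun k => (√(sP k))⁻¹)
  have := Real.sqrt_nonneg D
  have := Real.sqrt_nonneg (d * b)
  have := mul_nonneg hab.1 (Real.sqrt_nonneg (d / g))
  constructor <;> linarith

/-- The constant in `frobeniusExpansion_of_bounds`. -/
noncomputable def expansionConst (c C : ℝ) : ℝ :=
  (11 / 8 * ((C + 9 * C / c ^ 2 + 9 * C / (8 * c)) / (2 * c)) + 3 * C / c) / c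

/-- Here `D` is the mean degree scale and `l` plays the role of `log n`. The noise enters only
through `b ‖E Y‖` and `‖YᵀEY‖`, so a logarithmic loss in `b` is allowed as long as the product stays
below `D^{3/2} l`. -/
theorem frobeniusExpansion_of_bounds {c C : ℝ} (hr : 0 ≤ r) (hc : 0 < c) (hD : 0 < D)
    (hC : 0 ≤ C) (ha : aᵀ = a)
    (hY : ∀ v : Fin d → ℝ, c * D * (v ⬝ᵥ v) ≤
      ((√r • latentMatrix x) *ᵥ v) ⬝ᵥ ((√r • latentMatrix x) *ᵥ v))
    (hYD : ‖√r • latentMatrix x‖ ≤ √D) (hb : b ≤ c * D / 8)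
    (hE : OpBound (a - edgeProb r x) b)
    (hEY : b * ‖(a - edgeProb r x) * (√r • latentMatrix x)‖ ≤ C * (D * √D * l))
    (hYEY : ‖(√r • latentMatrix x)ᵀ * (a - edgeProb r x) * (√r • latentMatrix x)‖ ≤
      C * (D * l)) :
    FrobeniusExpansion r x a (expansionConst c C * (l / √D)) := by
  have hg : 0 < c * D := mul_pos hc hD
  refine ⟨rank_edgeProb hr hg hY, fun UA sA hA UP sP hP => ?_⟩
  set E := a - edgeProb r x with hEdef
  obtain ⟨hUP, hsP, O, hO, hO', hYO, hYU⟩ := exists_orthogonal_factor hg hY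
    (edgeProb_eq_mul_transpose hr x) hP
  have haE : a = (√r • latentMatrix x) * (√r • latentMatrix x)ᵀ + E := by
    rw [← edgeProb_eq_mul_transpose hr, hEdef]; abel
  set Y := √r • latentMatrix x with hYdef
  obtain ⟨hUA, hsA, haU, hR⟩ := leading_abs hg hb ha hE haE hY hA
  set Z := embedding UA sA with hZ
  have hZZ : Z * Zᵀ = UA * Matrix.diagonal sA * UAᵀ := by
    rw [hZ, embedding, Matrix.transpose_mul, Matrix.mul_assoc, ← Matrix.mul_assoc _ _ UAᵀ,
      Matrix.diagonal_transpose, Matrix.diagonal_mul_diagonal, Matrix.mul_assoc]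
    congr 4
    ext i; exact Real.mul_self_sqrt (hsA i)
  have hZZ' : Zᵀ * Z = Matrix.diagonal sA := by
    rw [hZ, embedding, Matrix.transpose_mul, Matrix.mul_assoc, ← Matrix.mul_assoc UAᵀ, hUA,
      Matrix.one_mul, Matrix.diagonal_transpose, Matrix.diagonal_mul_diagonal]
    congr 1
    ext i; exact Real.mul_self_sqrt (hsA i)
  have haZ : a * Z = Z * (Zᵀ * Z) := by
    rw [hZZ', hZ, embedding, ← Matrix.mul_assoc, haU, Matrix.mul_assoc, Matrix.mul_assoc,
      Matrix.diagonal_mul_diagonal, Matrix.diagonal_mul_diagonal]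
    congr 2
    ext i; exact mul_comm _ _
  rw [← hZZ] at hR
  obtain ⟨W, hW, δ, κ, hδ, hκ, h1, h2, h3⟩ :=
    exists_orthogonal_expansion hg hb haE ha haZ hR hE hY
  have hWW : W * Wᵀ = 1 := (Matrix.mem_orthogonalGroup_iff _ _).1 hW
  have hWW' : Wᵀ * W = 1 := (Matrix.mem_orthogonalGroup_iff' _ _).1 hW
  have hWt : Wᵀ ∈ Matrix.orthogonalGroup (Fin d) ℝ :=
    (Matrix.mem_orthogonalGroup_iff _ _).2 (by rw [Matrix.transpose_transpose, hWW'])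
  refine ⟨Wᵀ, hWt, ?_⟩
  have e1 : ‖Z - √r • (latentMatrix x * Wᵀ)‖ = ‖Z * W - Y‖ := by
    rw [← frobenius_mul_transpose_of_orthonormal W hWW' (Z * W - Y), Matrix.sub_mul,
      Matrix.mul_assoc, hWW, Matrix.mul_one, hYdef, Matrix.smul_mul]
  have hspos : ∀ i, 0 < √(sP i) := fun i => Real.sqrt_pos.2 (hg.trans_le (hsP i))
  set Si := Matrix.diagonal (fun k => (√(sP k))⁻¹) with hSi
  -- `Y (YᵀY)⁻¹ = U_P S_P^{-1/2} O` with `O` orthogonal, and `O` does not change the Frobenius norm.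
  have e2 : ‖E * UP * Si‖ = ‖E * Y * (Yᵀ * Y)⁻¹‖ := by
    have hdet := isUnit_of_quadratic (Q := Yᵀ * Y) hg
      fun v => by rw [← mulVec_dotProduct_mulVec]; exact hY v
    have h4 : UP * Si * O * (Yᵀ * Y) = Y := by
      have h5 : O * Yᵀ = (Matrix.diagonal fun k => √(sP k)) * UPᵀ := by
        have := congrArg Matrix.transpose hYO
        rw [this, Matrix.transpose_mul, Matrix.transpose_mul, ← Matrix.mul_assoc, hO',
          Matrix.one_mul, Matrix.diagonal_transpose]
      have h6 : Si * (Matrix.diagonal fun k => √(sP k)) = 1 := by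
        rw [hSi, Matrix.diagonal_mul_diagonal, ← Matrix.diagonal_one]
        congr 1; ext i; exact inv_mul_cancel₀ (hspos i).ne'
      have h7 : UP * UPᵀ * Y = Y := by
        conv_lhs => rw [hYO]
        conv_rhs => rw [hYO]
        rw [← Matrix.mul_assoc, ← Matrix.mul_assoc, Matrix.mul_assoc UP, hUP, Matrix.mul_one]
      calc UP * Si * O * (Yᵀ * Y) = UP * (Si * ((O * Yᵀ) * Y)) := by
            simp only [Matrix.mul_assoc]
        _ = UP * UPᵀ * Y := by
            rw [h5, Matrix.mul_assoc _ UPᵀ, ← Matrix.mul_assoc Si, h6, Matrix.one_mul,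
              Matrix.mul_assoc]
        _ = Y := h7
    have h8 : Y * (Yᵀ * Y)⁻¹ = UP * Si * O := by
      have := congrArg (· * (Yᵀ * Y)⁻¹) h4
      simp only [Matrix.mul_assoc _ (Yᵀ * Y), Matrix.mul_nonsing_inv _ hdet, Matrix.mul_one] at this
      exact this.symm
    rw [Matrix.mul_assoc E Y, h8, ← Matrix.mul_assoc, ← Matrix.mul_assoc]
    have := frobenius_mul_transpose_of_orthonormal (Oᵀ) (by rw [Matrix.transpose_transpose, hO'])
      (E * UP * Si)
    rw [Matrix.transpose_transpose] at this
    exact this.symm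
  rw [e1, e2]
  refine (abs_norm_sub_norm_le _ _).trans ?_
  set q := √D with hq
  have hq0 : 0 < q := Real.sqrt_pos.2 hD
  have hqq : q * q = D := Real.mul_self_sqrt hD.le
  have hb0 := hE.1
  set e := ‖E * Y‖ with he
  have he0 : 0 ≤ e := norm_nonneg _
  have hY0 : 0 ≤ ‖Y‖ := norm_nonneg _
  have heb : e ≤ b * q := (hE.norm_mul_le Y).trans (mul_le_mul_of_nonneg_left hYD hb0)
  have he2 : e ^ 2 ≤ C * (D ^ 2 * l) := by
    calc e ^ 2 ≤ (b * q) * e := by rw [sq]; exact mul_le_mul_of_nonneg_right heb he0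
      _ = q * (b * e) := by ring
      _ ≤ q * (C * (D * q * l)) := mul_le_mul_of_nonneg_left hEY hq0.le
      _ = C * (D * (q * q) * l) := by ring
      _ = C * (D ^ 2 * l) := by rw [hqq]; ring
  have hδ' : δ ≤ 3 * e / (c * D) := by rw [le_div_iff₀ hg]; linarith
  -- From `‖E Y‖ ≤ b √D` and `b ≤ c D / 8`. This is the source of the factor `11/8` in
  -- `expansionConst`, as `‖Y‖ + δ ≤ (11/8) √D`.
  have hδq : δ ≤ 3 / 8 * q := by
    refine hδ'.trans ?_
    rw [div_le_iff₀ hg]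
    nlinarith [mul_le_mul_of_nonneg_right hb hq0.le]
  have hδ2 : δ ^ 2 ≤ 9 * C / c ^ 2 * l := by
    calc δ ^ 2 ≤ (3 * e / (c * D)) ^ 2 := pow_le_pow_left₀ hδ hδ' 2
      _ = 9 * e ^ 2 / (c ^ 2 * D ^ 2) := by rw [div_pow]; ring
      _ ≤ 9 * (C * (D ^ 2 * l)) / (c ^ 2 * D ^ 2) := by gcongr
      _ = 9 * C / c ^ 2 * l := by field_simp
  have hbδ : b * δ ≤ 3 * C / c * (q * l) := by
    calc b * δ ≤ b * (3 * e / (c * D)) := mul_le_mul_of_nonneg_left hδ' hb0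
      _ = 3 * (b * e) / (c * D) := by ring
      _ ≤ 3 * (C * (D * q * l)) / (c * D) := by gcongr
      _ = 3 * C / c * (q * l) := by field_simp
  set k := (C + 9 * C / c ^ 2 + 9 * C / (8 * c)) / (2 * c) with hk
  have hκ' : κ ≤ k * l := by
    have h5 : (‖Y‖ * δ) ^ 2 ≤ D * (9 * C / c ^ 2 * l) := by
      rw [mul_pow]
      have : ‖Y‖ ^ 2 ≤ D := by
        rw [← hqq, ← sq]; exact pow_le_pow_left₀ hY0 hYD 2
      exact mul_le_mul this hδ2 (sq_nonneg _) hD.le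
    have h6 : b * δ ^ 2 ≤ c * D / 8 * (9 * C / c ^ 2 * l) :=
      mul_le_mul hb hδ2 (sq_nonneg _) (by positivity)
    have h7 : 2 * (c * D) * κ ≤ 2 * (c * D) * (k * l) := by
      refine (h2.trans (add_le_add (add_le_add hYEY h5) h6)).trans (le_of_eq ?_)
      rw [hk]; field_simp
    exact le_of_mul_le_mul_left h7 (by positivity)
  have hk0 : 0 ≤ k := by rw [hk]; positivity
  have h8 : c * D * ‖Z * W - Y - E * Y * (Yᵀ * Y)⁻¹‖ ≤
      c * D * (expansionConst c C * (l / q)) := by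
    have h9 : (‖Y‖ + δ) * κ ≤ (q + 3 / 8 * q) * (k * l) :=
      mul_le_mul (add_le_add hYD hδq) hκ' hκ (by positivity)
    refine (h3.trans (add_le_add h9 hbδ)).trans (le_of_eq ?_)
    rw [expansionConst, ← hk, ← hqq]
    field_simp
    ring
  exact le_of_mul_le_mul_left h8 hg

end Deterministic

/-! ### Operator norm from block sums and row sums. -/

section Discrepancy

variable {ι : Type*} {M : Matrix ι ι ℝ} {α L : ℝ}

/-- A linear form on a box is largest at the vertex that keeps exactly the positive coefficients.
Applied once in each variable, this reduces a bilinear form on boxes to sums over sub-blocks. -/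
theorem sum_mul_le_of_box {s : Finset ι} {c z : ι → ℝ} {p : ℝ} (hz : ∀ i ∈ s, 0 ≤ z i ∧ z i ≤ p) :
    ∑ i ∈ s, c i * z i ≤ p * ∑ i ∈ s with 0 < c i, c i := by
  rw [Finset.mul_sum, Finset.sum_filter]
  refine Finset.sum_le_sum fun i hi => ?_
  obtain ⟨h0, h1⟩ := hz i hi
  split_ifs with h
  · nlinarith
  · nlinarith

/-- A bound on all block sums of `M` bounds the bilinear form on boxes. -/
theorem block_sum_le_of_box (hα : 0 ≤ α)
    (hM : ∀ S T : Finset ι, ∑ i ∈ S, ∑ j ∈ T, M i j ≤ α * √(S.card * T.card))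
    {S T : Finset ι} {z w : ι → ℝ} {p q : ℝ} (hp : 0 ≤ p) (hq : 0 ≤ q)
    (hz : ∀ i ∈ S, 0 ≤ z i ∧ z i ≤ p) (hw : ∀ j ∈ T, 0 ≤ w j ∧ w j ≤ q) :
    ∑ i ∈ S, ∑ j ∈ T, M i j * (z i * w j) ≤ p * q * (α * √(S.card * T.card)) := by
  have e1 : ∑ i ∈ S, ∑ j ∈ T, M i j * (z i * w j) = ∑ i ∈ S, (∑ j ∈ T, M i j * w j) * z i :=
    Finset.sum_congr rfl fun i _ => by
      rw [Finset.sum_mul]; exact Finset.sum_congr rfl fun j _ => by ring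
  rw [e1]
  refine (sum_mul_le_of_box hz).trans ?_
  rw [mul_assoc]
  refine mul_le_mul_of_nonneg_left ?_ hp
  set S' := S.filter fun i => 0 < ∑ j ∈ T, M i j * w j
  rw [Finset.sum_comm]
  have e2 : ∑ j ∈ T, ∑ i ∈ S', M i j * w j = ∑ j ∈ T, (∑ i ∈ S', M i j) * w j :=
    Finset.sum_congr rfl fun j _ => by rw [Finset.sum_mul]
  rw [e2]
  refine (sum_mul_le_of_box hw).trans (mul_le_mul_of_nonneg_left ?_ hq)
  set T' := T.filter fun j => 0 < ∑ i ∈ S', M i j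
  rw [Finset.sum_comm]
  refine (hM S' T').trans (mul_le_mul_of_nonneg_left (Real.sqrt_le_sqrt ?_) hα)
  have h1 : (S'.card : ℝ) ≤ S.card := by exact_mod_cast Finset.card_filter_le _ _
  have h2 : (T'.card : ℝ) ≤ T.card := by exact_mod_cast Finset.card_filter_le _ _
  exact mul_le_mul h1 h2 (by positivity) (by positivity)

/-- Dyadic levels that differ by more than `g` make a product negligible. -/
theorem mul_le_of_log_add_lt {x y : ℝ} (hx : 0 < x) {g : ℕ}
    (h : Int.log 2 y + g < Int.log 2 x) : x * y ≤ (2⁻¹ : ℝ) ^ g * x ^ 2 := by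
  have h1 : y < (2 : ℝ) ^ (Int.log 2 y + 1) := by
    exact_mod_cast Int.lt_zpow_succ_log_self (b := 2) one_lt_two y
  have h2 : (2 : ℝ) ^ Int.log 2 x ≤ x := by
    exact_mod_cast Int.zpow_log_le_self (b := 2) one_lt_two hx
  have h3 : (2 : ℝ) ^ (Int.log 2 y + 1) ≤ (2 : ℝ) ^ (Int.log 2 x - g) :=
    zpow_le_zpow_right₀ one_le_two (by omega)
  have h4 : (2 : ℝ) ^ (Int.log 2 x - g) = (2⁻¹ : ℝ) ^ g * (2 : ℝ) ^ Int.log 2 x := by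
    rw [zpow_sub₀ two_ne_zero, zpow_natCast, inv_pow, div_eq_inv_mul]
  have h5 : y ≤ (2⁻¹ : ℝ) ^ g * x := by
    refine h1.le.trans (h3.trans (h4.le.trans ?_))
    exact mul_le_mul_of_nonneg_left h2 (by positivity)
  nlinarith

/-- Each `x i` lies in one dyadic level, where `4 ^ level ≤ x i ^ 2`. The shift `h` allows the
levels of a second vector to be indexed by those of the first. -/
theorem sum_level_sq_le {s : Finset ι} {x : ι → ℝ} (hx : ∀ i ∈ s, 0 < x i) (I : Finset ℤ)
    (h : ℤ) :
    ∑ k ∈ I, (4 : ℝ) ^ (k + h) * (s.filter fun i => Int.log 2 (x i) = k + h).card ≤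
      ∑ i ∈ s, x i ^ 2 := by
  have e : ∀ k, (4 : ℝ) ^ (k + h) * (s.filter fun i => Int.log 2 (x i) = k + h).card ≤
      ∑ i ∈ s, if k = Int.log 2 (x i) - h then x i ^ 2 else 0 := by
    intro k
    rw [Finset.card_filter, Nat.cast_sum, Finset.mul_sum]
    refine Finset.sum_le_sum fun i hi => ?_
    by_cases hk : Int.log 2 (x i) = k + h
    · rw [if_pos hk, if_pos (by omega), ← hk]
      have h2 : (2 : ℝ) ^ Int.log 2 (x i) ≤ x i := by
        exact_mod_cast Int.zpow_log_le_self (b := 2) one_lt_two (hx i hi)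
      have h4 : (4 : ℝ) ^ Int.log 2 (x i) = ((2 : ℝ) ^ Int.log 2 (x i)) ^ 2 := by
        rw [← zpow_natCast, ← zpow_mul, mul_comm, zpow_mul]; norm_num
      rw [h4]
      simpa using pow_le_pow_left₀ (by positivity) h2 2
    · rw [if_neg hk, if_neg (by omega)]; simp
  refine (Finset.sum_le_sum fun k _ => e k).trans ?_
  rw [Finset.sum_comm]
  refine Finset.sum_le_sum fun i _ => ?_
  rw [Finset.sum_ite_eq']
  split_ifs
  · exact le_rfl
  · positivity

variable [Fintype ι]

/-- Block sums and absolute row sums control the bilinear form on nonnegative vectors. -/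
theorem bilinear_le_of_discrepancy_nonneg (hα : 0 ≤ α)
    (hM : ∀ S T : Finset ι, ∑ i ∈ S, ∑ j ∈ T, M i j ≤ α * √(S.card * T.card))
    (hrow : ∀ i, ∑ j, |M i j| ≤ L) (hcol : ∀ j, ∑ i, |M i j| ≤ L) (g : ℕ)
    {x y : ι → ℝ} (hx : ∀ i, 0 ≤ x i) (hy : ∀ i, 0 ≤ y i) :
    ∑ i, ∑ j, M i j * (x i * y j) ≤
      (2 * (2 * g + 1) * α + L * 2⁻¹ ^ g) * (∑ i, x i ^ 2 + ∑ j, y j ^ 2) := by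
  classical
  set Sx := Finset.univ.filter fun i => 0 < x i with hSx
  set Sy := Finset.univ.filter fun j => 0 < y j with hSy
  have hSx' : ∀ i ∈ Sx, 0 < x i := fun i hi => (Finset.mem_filter.1 hi).2
  have hSy' : ∀ i ∈ Sy, 0 < y i := fun i hi => (Finset.mem_filter.1 hi).2
  have hxS : ∑ i ∈ Sx, x i ^ 2 ≤ ∑ i, x i ^ 2 :=
    Finset.sum_le_sum_of_subset_of_nonneg (Finset.subset_univ _) fun _ _ _ => sq_nonneg _
  have hyS : ∑ i ∈ Sy, y i ^ 2 ≤ ∑ i, y i ^ 2 :=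
    Finset.sum_le_sum_of_subset_of_nonneg (Finset.subset_univ _) fun _ _ _ => sq_nonneg _
  set I := Sx.image fun i => Int.log 2 (x i) with hI
  set H := Finset.Icc (-(g : ℤ)) g with hH
  -- Pairs of levels at a fixed offset `h` with `|h| ≤ g`: the block bound on each pair, then `2uv ≤
  -- u² + v²`, then summation over levels. There are `2g + 1` offsets.
  have hnear : ∀ h ∈ H, ∑ k ∈ I, ∑ i ∈ Sx.filter (fun i => Int.log 2 (x i) = k),
      ∑ j ∈ Sy.filter (fun j => Int.log 2 (y j) = k + h), M i j * (x i * y j) ≤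
      2 * α * (∑ i, x i ^ 2 + ∑ j, y j ^ 2) := by
    intro h _
    have h1 : ∀ k ∈ I, ∑ i ∈ Sx.filter (fun i => Int.log 2 (x i) = k),
        ∑ j ∈ Sy.filter (fun j => Int.log 2 (y j) = k + h), M i j * (x i * y j) ≤
        2 * α * ((4 : ℝ) ^ (k + 0) * (Sx.filter fun i => Int.log 2 (x i) = k + 0).card +
          (4 : ℝ) ^ (k + h) * (Sy.filter fun j => Int.log 2 (y j) = k + h).card) := by
      intro k _
      rw [add_zero]
      set S := Sx.filter (fun i => Int.log 2 (x i) = k)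
      set T := Sy.filter (fun j => Int.log 2 (y j) = k + h)
      have hb : ∀ i ∈ S, 0 ≤ x i ∧ x i ≤ (2 : ℝ) ^ (k + 1) := by
        intro i hi
        refine ⟨hx i, ?_⟩
        have : x i < (2 : ℝ) ^ (Int.log 2 (x i) + 1) := by
          exact_mod_cast Int.lt_zpow_succ_log_self (b := 2) one_lt_two (x i)
        rw [(Finset.mem_filter.1 hi).2] at this
        exact this.le
      have hb' : ∀ i ∈ T, 0 ≤ y i ∧ y i ≤ (2 : ℝ) ^ (k + h + 1) := by
        intro i hi
        refine ⟨hy i, ?_⟩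
        have : y i < (2 : ℝ) ^ (Int.log 2 (y i) + 1) := by
          exact_mod_cast Int.lt_zpow_succ_log_self (b := 2) one_lt_two (y i)
        rw [(Finset.mem_filter.1 hi).2] at this
        exact this.le
      refine (block_sum_le_of_box hα hM (by positivity) (by positivity) hb hb').trans ?_
      rw [Real.sqrt_mul (by positivity)]
      have hs := Real.mul_self_sqrt (Nat.cast_nonneg (α := ℝ) S.card)
      have ht := Real.mul_self_sqrt (Nat.cast_nonneg (α := ℝ) T.card)
      set σ := √(S.card : ℝ)
      set τ := √(T.card : ℝ)
      have h4 : ∀ m : ℤ, (4 : ℝ) ^ m = (2 : ℝ) ^ m * (2 : ℝ) ^ m := fun m => by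
        rw [← mul_zpow]; norm_num
      rw [← hs, ← ht, h4, h4, zpow_add_one₀ two_ne_zero, zpow_add_one₀ two_ne_zero]
      set u := (2 : ℝ) ^ k
      set v := (2 : ℝ) ^ (k + h)
      have := mul_nonneg hα (sq_nonneg (u * σ - v * τ))
      nlinarith
    refine (Finset.sum_le_sum h1).trans ?_
    rw [← Finset.mul_sum, Finset.sum_add_distrib]
    refine mul_le_mul_of_nonneg_left (add_le_add ?_ ?_) (by positivity)
    · exact (sum_level_sq_le hSx' I 0).trans hxS
    · exact (sum_level_sq_le hSy' I h).trans hyS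
  have hnear' : ∑ h ∈ H, ∑ k ∈ I, ∑ i ∈ Sx.filter (fun i => Int.log 2 (x i) = k),
      ∑ j ∈ Sy.filter (fun j => Int.log 2 (y j) = k + h), M i j * (x i * y j) =
      ∑ i ∈ Sx, ∑ j ∈ Sy, if |Int.log 2 (y j) - Int.log 2 (x i)| ≤ g then
        M i j * (x i * y j) else 0 := by
    simp only [Finset.sum_filter]
    have : ∀ h ∈ H, ∑ k ∈ I, ∑ i ∈ Sx, (if Int.log 2 (x i) = k then
        ∑ j ∈ Sy, (if Int.log 2 (y j) = k + h then M i j * (x i * y j) else 0) else 0) =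
        ∑ i ∈ Sx, ∑ j ∈ Sy, if h = Int.log 2 (y j) - Int.log 2 (x i) then
          M i j * (x i * y j) else 0 := by
      intro h _
      rw [Finset.sum_comm]
      refine Finset.sum_congr rfl fun i hi => ?_
      rw [Finset.sum_ite_eq, if_pos (Finset.mem_image_of_mem _ hi)]
      refine Finset.sum_congr rfl fun j _ => ?_
      exact if_congr (by omega) rfl rfl
    rw [Finset.sum_congr rfl this, Finset.sum_comm]
    refine Finset.sum_congr rfl fun i _ => ?_
    rw [Finset.sum_comm]
    refine Finset.sum_congr rfl fun j _ => ?_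
    rw [Finset.sum_ite_eq']
    exact if_congr (by rw [hH, Finset.mem_Icc, abs_le]) rfl rfl
  -- Pairs at distance more than `g`: the product is at most `2⁻ᵍ` times the larger square, and row
  -- sums of `|M|` suffice.
  have hfar : ∀ i ∈ Sx, ∀ j ∈ Sy, M i j * (x i * y j) ≤
      (if |Int.log 2 (y j) - Int.log 2 (x i)| ≤ g then M i j * (x i * y j) else 0) +
        2⁻¹ ^ g * (|M i j| * x i ^ 2 + |M i j| * y j ^ 2) := by
    intro i hi j hj
    have hM0 := abs_nonneg (M i j)
    split_ifs with h
    · refine le_add_of_nonneg_right ?_; positivity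
    · have hxy : x i * y j ≤ 2⁻¹ ^ g * (x i ^ 2 + y j ^ 2) := by
        rw [not_le, lt_abs] at h
        have h2 : (0 : ℝ) ≤ 2⁻¹ ^ g := by positivity
        rcases h with h | h
        · have := mul_le_of_log_add_lt (y := x i) (hSy' j hj) (g := g) (by omega)
          nlinarith [sq_nonneg (x i)]
        · have := mul_le_of_log_add_lt (y := y j) (hSx' i hi) (g := g) (by omega)
          nlinarith [sq_nonneg (y j)]
      have h3 : M i j * (x i * y j) ≤ |M i j| * (x i * y j) :=
        mul_le_mul_of_nonneg_right (le_abs_self _) (mul_nonneg (hx i) (hy j))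
      have := mul_le_mul_of_nonneg_left hxy hM0
      linarith
  have hres : ∑ i, ∑ j, M i j * (x i * y j) = ∑ i ∈ Sx, ∑ j ∈ Sy, M i j * (x i * y j) := by
    rw [hSx, hSy, Finset.sum_filter]
    refine Finset.sum_congr rfl fun i _ => ?_
    split_ifs with h
    · rw [Finset.sum_filter]
      refine Finset.sum_congr rfl fun j _ => ?_
      split_ifs with h'
      · rfl
      · rw [le_antisymm (not_lt.1 h') (hy j)]; simp
    · rw [le_antisymm (not_lt.1 h) (hx i)]; simp
  rw [hres]
  refine (Finset.sum_le_sum fun i hi => Finset.sum_le_sum fun j hj => hfar i hi j hj).trans ?_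
  simp only [Finset.sum_add_distrib, ← Finset.mul_sum]
  rw [← hnear']
  have hcardH : (H.card : ℝ) = 2 * g + 1 := by
    rw [hH, Int.card_Icc]
    have : ((g : ℤ) + 1 - -(g : ℤ)).toNat = 2 * g + 1 := by omega
    rw [this]; push_cast; ring
  have h1 := Finset.sum_le_card_nsmul H _ _ hnear
  rw [nsmul_eq_mul, hcardH] at h1
  have h2 : ∑ i ∈ Sx, ∑ j ∈ Sy, |M i j| * x i ^ 2 ≤ L * ∑ i, x i ^ 2 := by
    calc ∑ i ∈ Sx, ∑ j ∈ Sy, |M i j| * x i ^ 2 ≤ ∑ i ∈ Sx, L * x i ^ 2 := by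
          refine Finset.sum_le_sum fun i _ => ?_
          rw [← Finset.sum_mul]
          refine mul_le_mul_of_nonneg_right (le_trans ?_ (hrow i)) (sq_nonneg _)
          exact Finset.sum_le_sum_of_subset_of_nonneg (Finset.subset_univ _)
            fun _ _ _ => abs_nonneg _
      _ ≤ ∑ i, L * x i ^ 2 :=
          Finset.sum_le_sum_of_subset_of_nonneg (Finset.subset_univ _) fun i _ _ =>
            mul_nonneg ((Finset.sum_nonneg fun _ _ => abs_nonneg _).trans (hrow i)) (sq_nonneg _)
      _ = L * ∑ i, x i ^ 2 := by rw [Finset.mul_sum]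
  have h3 : ∑ i ∈ Sx, ∑ j ∈ Sy, |M i j| * y j ^ 2 ≤ L * ∑ i, y i ^ 2 := by
    rw [Finset.sum_comm]
    calc ∑ j ∈ Sy, ∑ i ∈ Sx, |M i j| * y j ^ 2 ≤ ∑ j ∈ Sy, L * y j ^ 2 := by
          refine Finset.sum_le_sum fun j _ => ?_
          rw [← Finset.sum_mul]
          refine mul_le_mul_of_nonneg_right (le_trans ?_ (hcol j)) (sq_nonneg _)
          exact Finset.sum_le_sum_of_subset_of_nonneg (Finset.subset_univ _)
            fun _ _ _ => abs_nonneg _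
      _ ≤ ∑ j, L * y j ^ 2 :=
          Finset.sum_le_sum_of_subset_of_nonneg (Finset.subset_univ _) fun i _ _ =>
            mul_nonneg ((Finset.sum_nonneg fun _ _ => abs_nonneg _).trans (hcol i)) (sq_nonneg _)
      _ = L * ∑ i, y i ^ 2 := by rw [Finset.mul_sum]
  have h4 := mul_le_mul_of_nonneg_left (add_le_add h2 h3) (show (0 : ℝ) ≤ 2⁻¹ ^ g by positivity)
  linarith

/-- Block sums and absolute row sums of a symmetric matrix control its operator norm. -/
theorem opBound_of_discrepancy (hα : 0 ≤ α) (hL : 0 ≤ L) (hsymm : Mᵀ = M)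
    (hM : ∀ S T : Finset ι, |∑ i ∈ S, ∑ j ∈ T, M i j| ≤ α * √(S.card * T.card))
    (hrow : ∀ i, ∑ j, |M i j| ≤ L) (g : ℕ) :
    OpBound M (4 * (2 * (2 * g + 1) * α + L * 2⁻¹ ^ g)) := by
  set B := 2 * (2 * g + 1) * α + L * 2⁻¹ ^ g with hB
  have hB0 : 0 ≤ B := by positivity
  have hcol : ∀ j, ∑ i, |M i j| ≤ L := fun j => by
    have := hrow j
    rw [← hsymm] at this
    exact this
  have hpos := fun {x y : ι → ℝ} (hx : ∀ i, 0 ≤ x i) (hy : ∀ i, 0 ≤ y i) =>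
    bilinear_le_of_discrepancy_nonneg hα (fun S T => (abs_le.1 (hM S T)).2) hrow hcol g hx hy
  have hneg := fun {x y : ι → ℝ} (hx : ∀ i, 0 ≤ x i) (hy : ∀ i, 0 ≤ y i) =>
    bilinear_le_of_discrepancy_nonneg (M := -M) hα
      (fun S T => by
        have := (abs_le.1 (hM S T)).1
        simp only [Matrix.neg_apply, Finset.sum_neg_distrib]
        linarith) (by simpa using hrow) (by simpa using hcol) g hx hy
  have hbil : ∀ x y : ι → ℝ, ∑ i, ∑ j, M i j * (x i * y j) ≤
      2 * B * (∑ i, x i ^ 2 + ∑ j, y j ^ 2) := by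
    intro x y
    have hp : ∀ z : ι → ℝ, ∀ i, 0 ≤ max (z i) 0 := fun z i => le_max_right _ _
    have hn : ∀ z : ι → ℝ, ∀ i, 0 ≤ max (-z i) 0 := fun z i => le_max_right _ _
    have e : ∀ t : ℝ, t = max t 0 - max (-t) 0 := fun t => by
      rcases le_total t 0 with h | h
      · rw [max_eq_right h, max_eq_left (by linarith)]; ring
      · rw [max_eq_left h, max_eq_right (by linarith)]; ring
    have e2 : ∀ t : ℝ, t ^ 2 = max t 0 ^ 2 + max (-t) 0 ^ 2 := fun t => by
      rcases le_total t 0 with h | h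
      · rw [max_eq_right h, max_eq_left (by linarith)]; ring
      · rw [max_eq_left h, max_eq_right (by linarith)]; ring
    have h1 := hpos (hp x) (hp y)
    have h2 := hpos (hn x) (hn y)
    have h3 := hneg (hp x) (hn y)
    have h4 := hneg (hn x) (hp y)
    have hs : ∀ z : ι → ℝ, ∑ i, z i ^ 2 = ∑ i, max (z i) 0 ^ 2 + ∑ i, max (-z i) 0 ^ 2 :=
      fun z => by rw [← Finset.sum_add_distrib]; exact Finset.sum_congr rfl fun i _ => e2 _
    have hsum : ∑ i, ∑ j, M i j * (x i * y j) =
        ∑ i, ∑ j, M i j * (max (x i) 0 * max (y j) 0) +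
        ∑ i, ∑ j, M i j * (max (-x i) 0 * max (-y j) 0) +
        ∑ i, ∑ j, (-M) i j * (max (x i) 0 * max (-y j) 0) +
        ∑ i, ∑ j, (-M) i j * (max (-x i) 0 * max (y j) 0) := by
      simp only [← Finset.sum_add_distrib]
      refine Finset.sum_congr rfl fun i _ => Finset.sum_congr rfl fun j _ => ?_
      conv_lhs => rw [e (x i), e (y j)]
      rw [Matrix.neg_apply]
      ring
    rw [← hB] at h1 h2 h3 h4
    rw [hsum, hs x, hs y]
    linarith
  refine ⟨by positivity, fun v => ?_⟩
  set w := M *ᵥ v with hw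
  have hvv : ∀ z : ι → ℝ, ∑ i, z i ^ 2 = z ⬝ᵥ z := fun z => by simp [dotProduct, sq]
  have hwv : ∀ c d : ℝ, ∑ i, ∑ j, M i j * ((c * w i) * (d * v j)) = c * d * (w ⬝ᵥ w) := by
    intro c d
    conv_rhs => rhs; rhs; rw [hw]
    simp only [dotProduct, Matrix.mulVec, Finset.mul_sum]
    exact Finset.sum_congr rfl fun i _ => Finset.sum_congr rfl fun j _ => by ring
  -- Test with `w = M v` against `4 B v`; this scaling balances the two squares and yields `|w|² ≤
  -- (4B)² |v|²`.
  have h1 := hbil (fun i => 1 * w i) fun j => 4 * B * v j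
  rw [hwv] at h1
  simp only [mul_pow, ← Finset.mul_sum, hvv] at h1
  have hw0 := dotProduct_self_nonneg_real w
  have hv0 := dotProduct_self_nonneg_real v
  rcases hB0.eq_or_lt with h0 | h0
  · have h2 := hbil (fun i => 1 * w i) fun j => 1 * v j
    rw [hwv, ← h0] at h2
    rw [← h0]
    linarith
  · have h2 : (4 * B) * (w ⬝ᵥ w) ≤ (4 * B) * ((4 * B) ^ 2 * (v ⬝ᵥ v)) := by nlinarith
    exact le_of_mul_le_mul_left h2 (by positivity)

/-- Schur's test. -/
theorem opBound_of_row_sums (hL : 0 ≤ L) (hsymm : Mᵀ = M) (hrow : ∀ i, ∑ j, |M i j| ≤ L) :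
    OpBound M L := by
  have hcol : ∀ j, ∑ i, |M i j| ≤ L := fun j => by
    have := hrow j
    rw [← hsymm] at this
    exact this
  refine ⟨hL, fun v => ?_⟩
  have h1 : ∀ i, (M *ᵥ v) i * (M *ᵥ v) i ≤ L * ∑ j, |M i j| * v j ^ 2 := by
    intro i
    have h2 : (M *ᵥ v) i * (M *ᵥ v) i ≤ (∑ j, |M i j|) * ∑ j, |M i j| * v j ^ 2 := by
      have := Finset.sum_sq_le_sum_mul_sum_of_sq_le_mul Finset.univ (r := fun j => M i j * v j)
        (f := fun j => |M i j|) (g := fun j => |M i j| * v j ^ 2) (fun _ _ => abs_nonneg _)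
        (fun _ _ => by positivity)
        (fun j _ => by rw [mul_pow, ← mul_assoc, abs_mul_abs_self, sq (M i j)])
      simpa [Matrix.mulVec, dotProduct, sq] using this
    exact h2.trans (mul_le_mul_of_nonneg_right (hrow i)
      (Finset.sum_nonneg fun _ _ => by positivity))
  calc (M *ᵥ v) ⬝ᵥ (M *ᵥ v) ≤ ∑ i, L * ∑ j, |M i j| * v j ^ 2 := Finset.sum_le_sum fun i _ => h1 i
    _ = L * ∑ j, (∑ i, |M i j|) * v j ^ 2 := by
        rw [← Finset.mul_sum, Finset.sum_comm]
        simp only [Finset.sum_mul]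
    _ ≤ L * ∑ j, L * v j ^ 2 :=
        mul_le_mul_of_nonneg_left (Finset.sum_le_sum fun j _ =>
          mul_le_mul_of_nonneg_right (hcol j) (sq_nonneg _)) hL
    _ = L ^ 2 * (v ⬝ᵥ v) := by
        rw [← Finset.mul_sum]; simp [dotProduct, sq]; ring

end Discrepancy

/-! ### Chernoff bound for bilinear forms in the noise. -/

theorem exp_sub_one_sub_le (s : ℝ) : Real.exp s - 1 - s ≤ s ^ 2 * Real.exp |s| := by
  have h1 : Real.exp s - 1 ≤ s * Real.exp s := by
    have := Real.add_one_le_exp (-s)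
    have h2 := mul_le_mul_of_nonneg_right this (Real.exp_pos s).le
    rw [← Real.exp_add] at h2
    simp at h2
    linarith
  have h2 := Real.add_one_le_exp s
  rcases le_total 0 s with h | h
  · rw [abs_of_nonneg h]
    have h3 : s ≤ s * Real.exp s := le_mul_of_one_le_right h (Real.one_le_exp h)
    nlinarith [mul_le_mul_of_nonneg_left h1 h]
  · have h3 : 1 ≤ Real.exp |s| := Real.one_le_exp (abs_nonneg s)
    have h4 : Real.exp s ≤ 1 := Real.exp_le_one_iff.2 h
    have h5 : s * (Real.exp s - 1) ≤ s * s := mul_le_mul_of_nonpos_left (by linarith) h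
    nlinarith [sq_nonneg s]

/-- Bennett-type bound with exponent linear in `p`: the smallness of edge probabilities must survive
in the variance term, since blocks and degrees are measured on the scale `nρ`. -/
theorem bernoulli_mgf_le {p : ℝ} (hp : 0 ≤ p) (s : ℝ) :
    p * Real.exp (s * (1 - p)) + (1 - p) * Real.exp (s * (0 - p)) ≤
      Real.exp (p * (s ^ 2 * Real.exp |s|)) := by
  have e1 : Real.exp (s * (1 - p)) = Real.exp s * Real.exp (s * (0 - p)) := by
    rw [← Real.exp_add]; ring_nf
  have e2 : p * Real.exp (s * (1 - p)) + (1 - p) * Real.exp (s * (0 - p)) =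
      (p * (Real.exp s - 1) + 1) * Real.exp (s * (0 - p)) := by rw [e1]; ring
  rw [e2]
  calc (p * (Real.exp s - 1) + 1) * Real.exp (s * (0 - p))
      ≤ Real.exp (p * (Real.exp s - 1)) * Real.exp (s * (0 - p)) :=
        mul_le_mul_of_nonneg_right (Real.add_one_le_exp _) (Real.exp_pos _).le
    _ = Real.exp (p * (Real.exp s - 1 - s)) := by rw [← Real.exp_add]; ring_nf
    _ ≤ _ := Real.exp_le_exp.2 (mul_le_mul_of_nonneg_left (exp_sub_one_sub_le s) hp)

section Adjacency

variable {n d : ℕ}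

/-- The possible edges `i < j`. -/
def edges (n : ℕ) : Finset (Σ _ : Fin n, Fin n) := Finset.univ.sigma fun i => Finset.Ioi i

theorem mem_edges {e : Σ _ : Fin n, Fin n} : e ∈ edges n ↔ e.1 < e.2 := by
  simp [edges]

open scoped Classical in
/-- The adjacency matrix of a set of edges. -/
noncomputable def adjMatrix (t : Finset (Σ _ : Fin n, Fin n)) : Matrix (Fin n) (Fin n) ℝ :=
  Matrix.of fun i j => if (i < j ∧ ⟨i, j⟩ ∈ t) ∨ (j < i ∧ ⟨j, i⟩ ∈ t) then 1 else 0

open scoped Classical in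
theorem adjMatrix_apply_of_lt {t : Finset (Σ _ : Fin n, Fin n)} {i j : Fin n} (h : i < j) :
    adjMatrix t i j = if ⟨i, j⟩ ∈ t then 1 else 0 := by
  simp [adjMatrix, h, h.not_gt]

theorem isAdjacency_adjMatrix (t : Finset (Σ _ : Fin n, Fin n)) : IsAdjacency (adjMatrix t) where
  zero_or_one i j := by
    simp only [adjMatrix, Matrix.of_apply]
    split_ifs <;> simp
  symm := by
    ext i j
    simp only [adjMatrix, Matrix.of_apply, Matrix.transpose_apply]
    exact if_congr or_comm rfl rfl
  hollow i := by simp [adjMatrix]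

theorem IsAdjacency.exists_eq_adjMatrix {a : Matrix (Fin n) (Fin n) ℝ} (h : IsAdjacency a) :
    ∃ t ∈ (edges n).powerset, a = adjMatrix t := by
  classical
  refine ⟨(edges n).filter fun e => a e.1 e.2 = 1, by simp, ?_⟩
  have hlt : ∀ i j, i < j → a i j = adjMatrix ((edges n).filter fun e => a e.1 e.2 = 1) i j := by
    intro i j hij
    rw [adjMatrix_apply_of_lt hij]
    rcases h.zero_or_one i j with h0 | h0 <;> simp [h0, mem_edges, hij]
  ext i j
  rcases lt_trichotomy i j with hij | rfl | hij
  · exact hlt i j hij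
  · rw [h.hollow, (isAdjacency_adjMatrix _).hollow]
  · have h1 := congrFun (congrFun h.symm i) j
    have h2 := congrFun (congrFun (isAdjacency_adjMatrix
      ((edges n).filter fun e => a e.1 e.2 = 1)).symm i) j
    rw [Matrix.transpose_apply] at h1 h2
    rw [← h1, ← h2]
    exact hlt j i hij

/-- Puts the weight of a graph in the shape of `Finset.prod_add`, so that a sum over all graphs of a
product over edges factorizes into one-edge expectations. The arbitrary `f` carries the exponential
tilt. -/
theorem condProb_adjMatrix (r : ℝ) (x : Fin n → EuclideanSpace ℝ (Fin d))
    {t : Finset (Σ _ : Fin n, Fin n)} (ht : t ∈ (edges n).powerset) (f : ℝ → Fin n → Fin n → ℝ) :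
    condProb r x (adjMatrix t) * ∏ e ∈ edges n, f (adjMatrix t e.1 e.2) e.1 e.2 =
      (∏ e ∈ t, edgeProb r x e.1 e.2 * f 1 e.1 e.2) *
        ∏ e ∈ edges n \ t, (1 - edgeProb r x e.1 e.2) * f 0 e.1 e.2 := by
  classical
  have h1 : condProb r x (adjMatrix t) = ∏ e ∈ edges n,
      if adjMatrix t e.1 e.2 = 1 then edgeProb r x e.1 e.2 else 1 - edgeProb r x e.1 e.2 := by
    rw [condProb, edges, Finset.prod_sigma]
  rw [h1, ← Finset.prod_mul_distrib, mul_comm (∏ e ∈ t, _),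
    ← Finset.prod_sdiff (Finset.mem_powerset.1 ht)]
  congr 1
  · refine Finset.prod_congr rfl fun e he => ?_
    rw [Finset.mem_sdiff] at he
    rw [adjMatrix_apply_of_lt (mem_edges.1 he.1), if_neg he.2]
    simp
  · refine Finset.prod_congr rfl fun e he => ?_
    rw [adjMatrix_apply_of_lt (mem_edges.1 (Finset.mem_powerset.1 ht he)), if_pos he]
    simp

/-- Latent positions whose inner products lie in `[0, 1]`. -/
def IsGood (x : Fin n → EuclideanSpace ℝ (Fin d)) : Prop :=
  ∀ i j, inner ℝ (x i) (x j) ∈ Set.Icc (0 : ℝ) 1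

theorem edgeProb_apply (r : ℝ) (x : Fin n → EuclideanSpace ℝ (Fin d)) (i j : Fin n) :
    edgeProb r x i j = r * inner ℝ (x i) (x j) := by
  simp only [edgeProb, latentMatrix, Matrix.smul_apply, Matrix.mul_apply, Matrix.of_apply,
    Matrix.transpose_apply, smul_eq_mul, PiLp.inner_apply]
  congr 1
  exact Finset.sum_congr rfl fun k _ => by simp [mul_comm]

theorem IsGood.edgeProb_mem {r : ℝ} (hr : 0 ≤ r) {x : Fin n → EuclideanSpace ℝ (Fin d)}
    (h : IsGood x) (i j : Fin n) : 0 ≤ edgeProb r x i j ∧ edgeProb r x i j ≤ r := by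
  rw [edgeProb_apply]
  exact ⟨mul_nonneg hr (h i j).1, mul_le_of_le_one_right hr (h i j).2⟩

theorem IsGood.norm_le {x : Fin n → EuclideanSpace ℝ (Fin d)} (h : IsGood x) (i : Fin n) :
    ‖x i‖ ≤ 1 := by
  have := (h i i).2
  rw [real_inner_self_eq_norm_sq] at this
  exact (sq_le_one_iff₀ (norm_nonneg _)).1 this

theorem IsGood.abs_apply_le {x : Fin n → EuclideanSpace ℝ (Fin d)} (h : IsGood x) (i : Fin n)
    (k : Fin d) : |x i k| ≤ 1 :=
  (PiLp.norm_apply_le (x i) k).trans (h.norm_le i)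

theorem ae_isGood {F : Measure (EuclideanSpace ℝ (Fin d))} (hF : IsInnerProductDistribution F) :
    ∀ᵐ x ∂(Measure.pi fun _ : Fin n => F), IsGood x := by
  obtain ⟨hp, S, hS, hSS⟩ := hF
  have : ∀ i : Fin n, ∀ᵐ x ∂(Measure.pi fun _ : Fin n => F), x i ∈ S := fun i =>
    (Measure.tendsto_eval_ae_ae (μ := fun _ : Fin n => F) (i := i)).eventually hS
  filter_upwards [ae_all_iff.2 this] with x hx i j
  exact hSS _ (hx i) _ (hx j)

theorem sum_condProb_mul_exp_le {r : ℝ} (hr : 0 ≤ r) (hr1 : r ≤ 1)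
    {x : Fin n → EuclideanSpace ℝ (Fin d)} (hx : IsGood x) (w : Fin n → Fin n → ℝ) {b q : ℝ}
    (hb : ∀ i j, |w i j| ≤ b) (hq : ∑ e ∈ edges n, w e.1 e.2 ^ 2 ≤ q) :
    ∑ t ∈ (edges n).powerset, condProb r x (adjMatrix t) *
      ∏ e ∈ edges n, Real.exp (w e.1 e.2 * (adjMatrix t e.1 e.2 - edgeProb r x e.1 e.2)) ≤
      Real.exp (r * (q * Real.exp b)) := by
  classical
  have h1 : ∀ t ∈ (edges n).powerset, condProb r x (adjMatrix t) *
      ∏ e ∈ edges n, Real.exp (w e.1 e.2 * (adjMatrix t e.1 e.2 - edgeProb r x e.1 e.2)) =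
      (∏ e ∈ t, edgeProb r x e.1 e.2 * Real.exp (w e.1 e.2 * (1 - edgeProb r x e.1 e.2))) *
        ∏ e ∈ edges n \ t,
          (1 - edgeProb r x e.1 e.2) * Real.exp (w e.1 e.2 * (0 - edgeProb r x e.1 e.2)) :=
    fun t ht => condProb_adjMatrix r x ht
      fun z i j => Real.exp (w i j * (z - edgeProb r x i j))
  rw [Finset.sum_congr rfl h1, ← Finset.prod_add]
  have h2 : ∀ e ∈ edges n,
      edgeProb r x e.1 e.2 * Real.exp (w e.1 e.2 * (1 - edgeProb r x e.1 e.2)) +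
        (1 - edgeProb r x e.1 e.2) * Real.exp (w e.1 e.2 * (0 - edgeProb r x e.1 e.2)) ≤
      Real.exp (r * (w e.1 e.2 ^ 2 * Real.exp b)) := by
    intro e _
    obtain ⟨hp0, hp1⟩ := hx.edgeProb_mem hr e.1 e.2
    refine (bernoulli_mgf_le hp0 _).trans (Real.exp_le_exp.2 ?_)
    exact mul_le_mul hp1 (mul_le_mul_of_nonneg_left (Real.exp_le_exp.2 (hb _ _)) (sq_nonneg _))
      (by positivity) hr
  refine (Finset.prod_le_prod (fun e _ => ?_) h2).trans ?_
  · obtain ⟨hp0, hp1⟩ := hx.edgeProb_mem hr e.1 e.2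
    have : 0 ≤ 1 - edgeProb r x e.1 e.2 := by linarith
    positivity
  · rw [← Real.exp_sum]
    refine Real.exp_le_exp.2 ?_
    rw [← Finset.mul_sum, ← Finset.sum_mul]
    exact mul_le_mul_of_nonneg_left (mul_le_mul_of_nonneg_right hq (Real.exp_pos _).le) hr

theorem condProb_nonneg {r : ℝ} (hr : 0 ≤ r) (hr1 : r ≤ 1)
    {x : Fin n → EuclideanSpace ℝ (Fin d)} (hx : IsGood x) (a : Matrix (Fin n) (Fin n) ℝ) :
    0 ≤ condProb r x a := by
  refine Finset.prod_nonneg fun i _ => Finset.prod_nonneg fun j _ => ?_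
  obtain ⟨hp0, hp1⟩ := hx.edgeProb_mem hr i j
  split_ifs
  · exact hp0
  · linarith

theorem measurable_edgeProb (r : ℝ) (i j : Fin n) :
    Measurable fun x : Fin n → EuclideanSpace ℝ (Fin d) => edgeProb r x i j := by
  simp only [edgeProb_apply]
  fun_prop

theorem measurable_condProb (r : ℝ) (a : Matrix (Fin n) (Fin n) ℝ) :
    Measurable fun x : Fin n → EuclideanSpace ℝ (Fin d) => condProb r x a := by
  classical
  unfold condProb
  refine Finset.measurable_prod _ fun i _ => Finset.measurable_prod _ fun j _ => ?_
  split_ifs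
  · exact measurable_edgeProb r i j
  · exact (measurable_edgeProb r i j).const_sub 1

/-- The off-diagonal part of `a - P`. -/
def offDiag (r : ℝ) (x : Fin n → EuclideanSpace ℝ (Fin d)) (a : Matrix (Fin n) (Fin n) ℝ) :
    Matrix (Fin n) (Fin n) ℝ :=
  Matrix.of fun i j => if i = j then 0 else a i j - edgeProb r x i j

theorem edgeProb_symm (r : ℝ) (x : Fin n → EuclideanSpace ℝ (Fin d)) (i j : Fin n) :
    edgeProb r x i j = edgeProb r x j i := by
  rw [edgeProb_apply, edgeProb_apply, real_inner_comm]

theorem offDiag_transpose {r : ℝ} {x : Fin n → EuclideanSpace ℝ (Fin d)}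
    {a : Matrix (Fin n) (Fin n) ℝ} (ha : aᵀ = a) : (offDiag r x a)ᵀ = offDiag r x a := by
  ext i j
  have : a j i = a i j := congrFun (congrFun ha i) j
  simp only [offDiag, Matrix.transpose_apply, Matrix.of_apply, this, edgeProb_symm r x j i]
  exact if_congr eq_comm rfl rfl

theorem sum_sum_eq_sum_edges (f : Fin n → Fin n → ℝ) (hf : ∀ i, f i i = 0) :
    ∑ i, ∑ j, f i j = ∑ e ∈ edges n, (f e.1 e.2 + f e.2 e.1) := by
  rw [edges, Finset.sum_sigma]
  simp only [Finset.sum_add_distrib]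
  have h1 : ∀ i : Fin n, ∑ j, f i j = ∑ j ∈ Finset.Ioi i, f i j + ∑ j ∈ Finset.Iio i, f i j := by
    intro i
    have h2 : ∀ j, f i j = (if j ∈ Finset.Ioi i then f i j else 0) +
        if j ∈ Finset.Iio i then f i j else 0 := by
      intro j
      rcases lt_trichotomy i j with h | rfl | h
      · simp [h, h.not_gt]
      · simp [hf]
      · simp [h, h.not_gt]
    rw [Finset.sum_congr rfl fun j _ => h2 j, Finset.sum_add_distrib, Finset.sum_ite_mem,
      Finset.sum_ite_mem, Finset.univ_inter, Finset.univ_inter]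
  rw [Finset.sum_congr rfl fun i _ => h1 i, Finset.sum_add_distrib]
  congr 1
  exact Finset.sum_comm' (by simp)

end Adjacency

section Concentration

variable {Ω : Type*} [MeasurableSpace Ω] {μ : Measure Ω} {n d : ℕ}
  {F : Measure (EuclideanSpace ℝ (Fin d))} {r : ℝ}
  {X : Ω → Fin n → EuclideanSpace ℝ (Fin d)} {A : Ω → Matrix (Fin n) (Fin n) ℝ}

/-- Chernoff's bound for bilinear forms in the off-diagonal part of `A - P`, with coefficients
that may depend on the latent positions. -/
theorem IsRDPG.measure_bilinear_ge_le (h : IsRDPG μ F r X A) (hF : IsInnerProductDistribution F)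
    (hr : 0 ≤ r) (hr1 : r ≤ 1) {u v : (Fin n → EuclideanSpace ℝ (Fin d)) → Fin n → ℝ}
    (hu : ∀ i, Measurable fun x => u x i) (hv : ∀ i, Measurable fun x => v x i)
    {θ t b q : ℝ} (hθ : 0 ≤ θ)
    (hb : ∀ x, IsGood x → ∀ i j, |u x i * v x j + u x j * v x i| ≤ b)
    (hq : ∀ x, IsGood x → (∑ i, u x i ^ 2) * (∑ j, v x j ^ 2) ≤ q) :
    μ {ω | t ≤ ∑ i, ∑ j, offDiag r (X ω) (A ω) i j * (u (X ω) i * v (X ω) j)} ≤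
      ENNReal.ofReal (Real.exp (-(θ * t) + 2 * r * θ ^ 2 * Real.exp (θ * b) * q)) := by
  have hprob := hF.1
  set w : (Fin n → EuclideanSpace ℝ (Fin d)) → Fin n → Fin n → ℝ :=
    fun x i j => u x i * v x j + u x j * v x i with hw
  have hwm : ∀ i j, Measurable fun x => w x i j := fun i j =>
    ((hu i).mul (hv j)).add ((hu j).mul (hv i))
  set f : (Fin n → EuclideanSpace ℝ (Fin d)) → Matrix (Fin n) (Fin n) ℝ → ℝ :=
    fun x a => ∑ e ∈ edges n, w x e.1 e.2 * (a e.1 e.2 - edgeProb r x e.1 e.2) with hf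
  have hfm : ∀ a, Measurable fun x => f x a := fun a =>
    Finset.measurable_sum _ fun e _ =>
      (hwm _ _).mul ((measurable_edgeProb r e.1 e.2).const_sub _)
  have hfeq : ∀ ω, ∑ i, ∑ j, offDiag r (X ω) (A ω) i j * (u (X ω) i * v (X ω) j) =
      f (X ω) (A ω) := by
    intro ω
    rw [sum_sum_eq_sum_edges _ (fun i => by simp [offDiag])]
    refine Finset.sum_congr rfl fun e he => ?_
    have hs := congrFun (congrFun (offDiag_transpose (r := r) (x := X ω)
      (h.isAdjacency ω).symm) e.1) e.2
    rw [Matrix.transpose_apply] at hs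
    rw [hs, offDiag, Matrix.of_apply, if_neg (mem_edges.1 he).ne]
    ring
  -- `A` takes finitely many values, one for each edge set, so the event splits into pieces to which
  -- `cond_law` applies. On each piece the indicator is dominated by the exponential tilt.
  have hsub : {ω | t ≤ ∑ i, ∑ j, offDiag r (X ω) (A ω) i j * (u (X ω) i * v (X ω) j)} ⊆
      ⋃ τ ∈ (edges n).powerset, {ω | X ω ∈ {x | t ≤ f x (adjMatrix τ)} ∧ A ω = adjMatrix τ} := by
    intro ω hω
    obtain ⟨τ, hτ, hA⟩ := (h.isAdjacency ω).exists_eq_adjMatrix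
    simp only [Set.mem_iUnion]
    refine ⟨τ, hτ, ?_, hA⟩
    have h1 : t ≤ _ := hω
    rw [hfeq, hA] at h1
    exact h1
  refine (measure_mono hsub).trans ((measure_biUnion_finset_le _ _).trans ?_)
  have hterm : ∀ τ ∈ (edges n).powerset,
      μ {ω | X ω ∈ {x | t ≤ f x (adjMatrix τ)} ∧ A ω = adjMatrix τ} ≤
      ∫⁻ x, ENNReal.ofReal (condProb r x (adjMatrix τ) *
        Real.exp (θ * (f x (adjMatrix τ) - t))) ∂(Measure.pi fun _ => F) := by
    intro τ _
    rw [h.cond_law _ (isAdjacency_adjMatrix τ) _ (measurableSet_le measurable_const (hfm _))]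
    refine (setLIntegral_mono' (measurableSet_le measurable_const (hfm _)) fun x hx => ?_).trans
      (setLIntegral_le_lintegral _ _)
    rw [ENNReal.ofReal_mul' (Real.exp_pos _).le]
    refine le_mul_of_one_le_right zero_le ?_
    rw [ENNReal.one_le_ofReal]
    exact Real.one_le_exp (mul_nonneg hθ (sub_nonneg.2 hx))
  refine (Finset.sum_le_sum hterm).trans ?_
  rw [← lintegral_finsetSum _ fun τ _ => ?_]
  swap
  · exact ((measurable_condProb r _).mul
      (((hfm _).sub_const t).const_mul θ).exp).ennreal_ofReal
  have hae : ∀ᵐ x ∂(Measure.pi fun _ : Fin n => F),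
      ∑ τ ∈ (edges n).powerset, ENNReal.ofReal (condProb r x (adjMatrix τ) *
        Real.exp (θ * (f x (adjMatrix τ) - t))) ≤
      ENNReal.ofReal (Real.exp (-(θ * t) + 2 * r * θ ^ 2 * Real.exp (θ * b) * q)) := by
    filter_upwards [ae_isGood hF] with x hx
    rw [← ENNReal.ofReal_sum_of_nonneg fun τ _ =>
      mul_nonneg (condProb_nonneg hr hr1 hx _) (Real.exp_pos _).le]
    refine ENNReal.ofReal_le_ofReal ?_
    have e1 : ∀ τ, Real.exp (θ * (f x (adjMatrix τ) - t)) = Real.exp (-(θ * t)) *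
        ∏ e ∈ edges n,
          Real.exp (θ * w x e.1 e.2 * (adjMatrix τ e.1 e.2 - edgeProb r x e.1 e.2)) := by
      intro τ
      rw [← Real.exp_sum, ← Real.exp_add, hf, mul_sub, Finset.mul_sum, sub_eq_neg_add]
      simp only [mul_assoc]
    have e2 : ∑ τ ∈ (edges n).powerset, condProb r x (adjMatrix τ) *
        Real.exp (θ * (f x (adjMatrix τ) - t)) = Real.exp (-(θ * t)) *
        ∑ τ ∈ (edges n).powerset, condProb r x (adjMatrix τ) * ∏ e ∈ edges n,
          Real.exp (θ * w x e.1 e.2 * (adjMatrix τ e.1 e.2 - edgeProb r x e.1 e.2)) := by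
      rw [Finset.mul_sum]
      exact Finset.sum_congr rfl fun τ _ => by rw [e1]; ring
    rw [e2, Real.exp_add]
    refine mul_le_mul_of_nonneg_left ?_ (Real.exp_pos _).le
    -- By symmetry an edge carries the coefficient `u i v j + u j v i`; the factor `2` is the loss
    -- in squaring this sum.
    have hq' : ∑ e ∈ edges n, (θ * w x e.1 e.2) ^ 2 ≤ 2 * θ ^ 2 * q := by
      have h1 : ∑ e ∈ edges n, (θ * w x e.1 e.2) ^ 2 ≤
          2 * θ ^ 2 * ∑ e ∈ edges n, ((if e.1 = e.2 then 0 else u x e.1 ^ 2 * v x e.2 ^ 2) +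
            (if e.2 = e.1 then 0 else u x e.2 ^ 2 * v x e.1 ^ 2)) := by
        rw [Finset.mul_sum]
        refine Finset.sum_le_sum fun e he => ?_
        rw [if_neg (mem_edges.1 he).ne, if_neg (mem_edges.1 he).ne']
        have := mul_nonneg (sq_nonneg θ) (sq_nonneg (u x e.1 * v x e.2 - u x e.2 * v x e.1))
        rw [hw]
        nlinarith
      refine h1.trans (mul_le_mul_of_nonneg_left ?_ (by positivity))
      refine le_trans ?_ (hq x hx)
      rw [← sum_sum_eq_sum_edges
        (fun i j => if i = j then 0 else u x i ^ 2 * v x j ^ 2) (fun i => if_pos rfl),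
        Finset.sum_mul_sum]
      refine Finset.sum_le_sum fun i _ => Finset.sum_le_sum fun j _ => ?_
      split_ifs
      · positivity
      · exact le_rfl
    have hb' : ∀ i j, |θ * w x i j| ≤ θ * b := fun i j => by
      rw [abs_mul, abs_of_nonneg hθ]
      exact mul_le_mul_of_nonneg_left (hb x hx i j) hθ
    refine (sum_condProb_mul_exp_le hr hr1 hx (fun i j => θ * w x i j) hb' hq').trans ?_
    exact (congrArg Real.exp (by ring)).le
  refine (lintegral_mono_ae hae).trans ?_
  simp

end Concentration

/-! ### Entropy of vertex subsets. -/

section Entropy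

/-- `t log (1 + n / t)`. -/
noncomputable def entropyRate (n t : ℝ) : ℝ := t * Real.log (1 + n / t)

/-- Bernoulli's inequality `1 + n/s ≤ (1 + n/t)^{t/s}`, after taking logarithms. -/
theorem entropyRate_mono {n s t : ℝ} (hn : 0 ≤ n) (hs : 0 < s) (hst : s ≤ t) :
    entropyRate n s ≤ entropyRate n t := by
  have ht : 0 < t := hs.trans_le hst
  have h1 := one_add_mul_self_le_rpow_one_add (s := n / t) (p := t / s)
    (by have : 0 ≤ n / t := by positivity
        linarith) (by rwa [one_le_div hs])
  have h2 : t / s * (n / t) = n / s := by field_simp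
  rw [h2] at h1
  have h3 := Real.log_le_log (by positivity) h1
  rw [Real.log_rpow (by positivity)] at h3
  have h4 := mul_le_mul_of_nonneg_left h3 hs.le
  refine h4.trans (le_of_eq ?_)
  rw [entropyRate]
  field_simp

/-- `n.choose t ≤ (e n / t)^t`, and `e x ≤ (1 + x)²` for `x ≥ 0`. -/
theorem choose_le_exp_entropyRate {n t : ℕ} (ht : 0 < t) :
    (n.choose t : ℝ) ≤ Real.exp (2 * entropyRate n t) := by
  have ht' : (0 : ℝ) < t := by exact_mod_cast ht
  have h1 : (n.choose t : ℝ) ≤ (n : ℝ) ^ t / t.factorial := Nat.choose_le_pow_div t n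
  have h2 : (t : ℝ) ^ t / t.factorial ≤ Real.exp t := Real.pow_div_factorial_le_exp _ ht'.le _
  have h3 : (n : ℝ) ^ t / t.factorial = ((n : ℝ) / t) ^ t * ((t : ℝ) ^ t / t.factorial) := by
    rw [div_pow]; field_simp
  have h4 : ((n : ℝ) / t) ^ t * Real.exp t = (n / t * Real.exp 1) ^ t := by
    rw [mul_pow, ← Real.exp_nat_mul, mul_one]
  have h5 : (n : ℝ) / t * Real.exp 1 ≤ (1 + n / t) ^ 2 := by
    have h6 : (0 : ℝ) ≤ n / t := by positivity
    nlinarith [sq_nonneg ((n : ℝ) / t - 1), Real.exp_one_lt_three]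
  have h6 : Real.exp (2 * entropyRate n t) = ((1 + (n : ℝ) / t) ^ 2) ^ t := by
    have h7 : (0 : ℝ) < 1 + n / t := by positivity
    rw [← pow_mul, entropyRate, ← mul_assoc, mul_comm _ (Real.log _), Real.exp_mul,
      Real.exp_log h7]
    rw [← Real.rpow_natCast]
    push_cast
    ring_nf
  rw [h6]
  calc (n.choose t : ℝ) ≤ ((n : ℝ) / t) ^ t * ((t : ℝ) ^ t / t.factorial) := h3 ▸ h1
    _ ≤ ((n : ℝ) / t) ^ t * Real.exp t := mul_le_mul_of_nonneg_left h2 (by positivity)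
    _ = (n / t * Real.exp 1) ^ t := h4
    _ ≤ _ := pow_le_pow_left₀ (by positivity) h5 t

/-- Weights for the union bound over subsets. The weight `3` beats the entropy `2` by one rate, at
least `log (1 + n)`, so each of the `n` sizes contributes at most `1 / (1 + n)`. -/
theorem sum_exp_entropyRate_le (n : ℕ) :
    ∑ S : Finset (Fin n), (if S.card = 0 then 0 else Real.exp (-(3 * entropyRate n S.card))) ≤
      1 := by
  have h1 := Finset.sum_powerset_apply_card
    (fun t => if t = 0 then 0 else Real.exp (-(3 * entropyRate n t))) (x := (Finset.univ : Finset (Fin n)))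
  rw [Finset.powerset_univ, Finset.card_univ, Fintype.card_fin] at h1
  rw [h1]
  have h2 : ∀ t ∈ Finset.range n, n.choose (t + 1) •
      (if t + 1 = 0 then 0 else Real.exp (-(3 * entropyRate n (t + 1 : ℕ)))) ≤ 1 / (1 + (n : ℝ)) := by
    intro t ht
    rw [if_neg (Nat.succ_ne_zero t), nsmul_eq_mul]
    calc (n.choose (t + 1) : ℝ) * Real.exp (-(3 * entropyRate n (t + 1 : ℕ)))
        ≤ Real.exp (2 * entropyRate n (t + 1 : ℕ)) *
          Real.exp (-(3 * entropyRate n (t + 1 : ℕ))) :=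
          mul_le_mul_of_nonneg_right (choose_le_exp_entropyRate (Nat.succ_pos t)) (Real.exp_pos _).le
      _ = Real.exp (-entropyRate n (t + 1 : ℕ)) := by rw [← Real.exp_add]; ring_nf
      _ ≤ Real.exp (-entropyRate n 1) := by
          refine Real.exp_le_exp.2 (neg_le_neg (entropyRate_mono (Nat.cast_nonneg n) one_pos ?_))
          push_cast
          linarith [Nat.cast_nonneg (α := ℝ) t]
      _ = 1 / (1 + (n : ℝ)) := by
          rw [entropyRate, one_mul, div_one, Real.exp_neg, Real.exp_log (by positivity), one_div]
  rw [Finset.sum_range_succ']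
  refine (add_le_add (Finset.sum_le_sum h2) le_rfl).trans ?_
  simp only [Finset.sum_const, Finset.card_range, nsmul_eq_mul, if_true, smul_zero, add_zero]
  rw [mul_one_div, div_le_one (by positivity)]
  linarith

/-- With `h = √(Dst)` and `R = √(1 + n/h)`, the choice `e^{2θ} = R` makes the variance term at most
`(1/2) h log R`, because `R log R ≤ R² - 1`. The exponent is then at most `-24 h log R`, which is
`-12` times the entropy rate at `h`. Since `s`, `t` and `√D` are all at most `h` (for `t` this is `t
≤ D s`), the right side costs `3 + 3 + 6 = 12` such rates; this is where `49` comes from. -/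
theorem chernoff_exponent_le {D n s t : ℝ} (hD : 1 ≤ D) (hDn : D ≤ n) (hs : 1 ≤ s) (hst : s ≤ t)
    (htD : t ≤ D * s) :
    ∃ θ : ℝ, 0 ≤ θ ∧
      -(θ * (49 * √(D * s * t))) + 2 * (D / n) * θ ^ 2 * Real.exp (θ * 2) * (s * t) ≤
        -(3 * entropyRate n s) + -(3 * entropyRate n t) - 3 * (√D * Real.log n) := by
  set h := √(D * s * t) with hh
  have hn : 0 < n := by linarith
  have ht : 1 ≤ t := hs.trans hst
  have hh2 : h * h = D * s * t := Real.mul_self_sqrt (by positivity)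
  have hht : t ≤ h := Real.le_sqrt_of_sq_le (by nlinarith)
  have hhD : √D ≤ h := Real.sqrt_le_sqrt (by nlinarith [mul_le_mul hs ht zero_le_one (by linarith)])
  have hD0 : 0 < √D := Real.sqrt_pos.2 (by linarith)
  have hh0 : 0 < h := hD0.trans_le hhD
  set R := √(1 + n / h) with hR
  have hq : 0 < n / h := by positivity
  have hRR : R * R = 1 + n / h := Real.mul_self_sqrt (by positivity)
  have hR1 : 1 < R := by
    rw [hR, Real.lt_sqrt (by norm_num)]; linarith
  have hlog : Real.log (1 + n / h) = 2 * Real.log R := by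
    rw [← hRR, Real.log_mul (by positivity) (by positivity)]; ring
  have hlR : 0 ≤ Real.log R := Real.log_nonneg hR1.le
  have hlR1 : Real.log R ≤ R - 1 := Real.log_le_sub_one_of_pos (by linarith)
  refine ⟨Real.log R / 2, by linarith, ?_⟩
  have he : Real.exp (Real.log R / 2 * 2) = R := by
    rw [div_mul_cancel₀ _ two_ne_zero, Real.exp_log (by linarith)]
  have hnh : n = (R * R - 1) * h := by rw [hRR]; field_simp; ring
  have hst2 : D / n * (s * t) = h / (R * R - 1) := by
    have : 0 < R * R - 1 := by nlinarith
    rw [eq_div_iff this.ne', div_mul_eq_mul_div, div_mul_eq_mul_div, div_eq_iff hn.ne']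
    conv_rhs => rw [hnh]
    nlinarith
  have hquad : 2 * (D / n) * (Real.log R / 2) ^ 2 * Real.exp (Real.log R / 2 * 2) * (s * t) ≤
      Real.log R / 2 * h := by
    rw [he]
    have h1 : 0 < R * R - 1 := by nlinarith
    calc 2 * (D / n) * (Real.log R / 2) ^ 2 * R * (s * t)
        = Real.log R / 2 * (Real.log R * R * (D / n * (s * t))) := by ring
      _ = Real.log R / 2 * (Real.log R * R * (h / (R * R - 1))) := by rw [hst2]
      _ ≤ Real.log R / 2 * h := by
          refine mul_le_mul_of_nonneg_left ?_ (by linarith)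
          rw [← mul_div_assoc, div_le_iff₀ h1, mul_comm h]
          refine mul_le_mul_of_nonneg_right ?_ hh0.le
          nlinarith
  have hrate : entropyRate n h = 2 * (h * Real.log R) := by rw [entropyRate, hlog]; ring
  have h1 := entropyRate_mono hn.le (by linarith) hht
  have h2 := entropyRate_mono hn.le (by linarith) hst
  have h3 := entropyRate_mono hn.le hD0 hhD
  have h4 : √D * (Real.log n / 2) ≤ entropyRate n √D := by
    refine mul_le_mul_of_nonneg_left ?_ hD0.le
    rw [← Real.log_sqrt hn.le]
    refine Real.log_le_log (Real.sqrt_pos.2 hn) ?_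
    have h5 : √D ≤ √n := Real.sqrt_le_sqrt hDn
    have h6 : √n ≤ n / √D := by
      rw [le_div_iff₀ hD0]
      calc √n * √D ≤ √n * √n := mul_le_mul_of_nonneg_left h5 (Real.sqrt_nonneg _)
        _ = n := Real.mul_self_sqrt hn.le
    linarith
  nlinarith

end Entropy

/-! ### Tails of degrees, Gram forms and block sums. -/

section Events

variable {Ω : Type*} [MeasurableSpace Ω] {μ : Measure Ω} {n d : ℕ}
  {F : Measure (EuclideanSpace ℝ (Fin d))} {r : ℝ}
  {X : Ω → Fin n → EuclideanSpace ℝ (Fin d)} {A : Ω → Matrix (Fin n) (Fin n) ℝ}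

theorem IsRDPG.measure_row_sum_ge_le (h : IsRDPG μ F r X A) (hF : IsInnerProductDistribution F)
    (hr : 0 ≤ r) (hr1 : r ≤ 1) {θ : ℝ} (hθ : 0 ≤ θ) (t : ℝ) :
    μ {ω | ∃ i, t ≤ ∑ j, offDiag r (X ω) (A ω) i j} ≤
      ENNReal.ofReal (n * Real.exp (-(θ * t) + 2 * (n * r) * θ ^ 2 * Real.exp (θ * 2))) := by
  have h1 : ∀ i : Fin n, μ {ω | t ≤ ∑ j, offDiag r (X ω) (A ω) i j} ≤
      ENNReal.ofReal (Real.exp (-(θ * t) + 2 * (n * r) * θ ^ 2 * Real.exp (θ * 2))) := by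
    intro i
    have h2 := h.measure_bilinear_ge_le hF hr hr1 (u := fun _ => Pi.single i 1) (v := fun _ _ => 1)
      (fun _ => measurable_const) (fun _ => measurable_const) (t := t) (b := 2) (q := n) hθ
      (fun x _ j k => by
        have : ∀ l, |(Pi.single i 1 : Fin n → ℝ) l| ≤ 1 := fun l => by
          by_cases hl : l = i <;> simp [hl]
        rw [mul_one, mul_one]
        exact (abs_add_le _ _).trans (by linarith [this j, this k]))
      (fun x _ => by simp [Pi.single_apply, ite_pow])
    have e1 : ∀ ω, ∑ k, ∑ j, offDiag r (X ω) (A ω) k j * ((Pi.single i 1 : Fin n → ℝ) k * 1) =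
        ∑ j, offDiag r (X ω) (A ω) i j := by
      intro ω
      rw [Finset.sum_eq_single i (fun k _ hk => by simp [Pi.single_eq_of_ne hk]) (by simp)]
      simp
    simp only [e1] at h2
    refine h2.trans (le_of_eq ?_)
    congr 2; ring
  have h3 : {ω | ∃ i, t ≤ ∑ j, offDiag r (X ω) (A ω) i j} ⊆
      ⋃ i ∈ (Finset.univ : Finset (Fin n)), {ω | t ≤ ∑ j, offDiag r (X ω) (A ω) i j} := by
    rintro ω ⟨i, hi⟩
    simp only [Set.mem_iUnion]
    exact ⟨i, Finset.mem_univ i, hi⟩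
  refine (measure_mono h3).trans ((measure_biUnion_finset_le _ _).trans ?_)
  refine (Finset.sum_le_sum fun i _ => h1 i).trans ?_
  rw [Finset.sum_const, Finset.card_univ, Fintype.card_fin, nsmul_eq_mul,
    ENNReal.ofReal_mul (Nat.cast_nonneg _), ENNReal.ofReal_natCast]

/-- The standard deviation is at most of order `n`, so a deviation `n log n` has superpolynomially
small probability, which beats every `n^{-c}`. The choice `θ = log n / (8n)` gives `-log² n / 8`
plus a variance term of at most `log² n / 16`. -/
theorem IsRDPG.measure_gram_ge_le (h : IsRDPG μ F r X A) (hF : IsInnerProductDistribution F)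
    (hr : 0 ≤ r) (hr1 : r ≤ 1) (hn : 1 ≤ n) {σ : ℝ} (hσ : |σ| = 1) (k l : Fin d) :
    μ {ω | n * Real.log n ≤
        σ * ∑ i, ∑ j, offDiag r (X ω) (A ω) i j * (X ω i k * X ω j l)} ≤
      ENNReal.ofReal (Real.exp (-(Real.log n ^ 2 / 16))) := by
  have hn' : (1 : ℝ) ≤ n := by exact_mod_cast hn
  have hlog : 0 ≤ Real.log n := Real.log_nonneg hn'
  have hσ2 : σ ^ 2 = 1 := by rw [← sq_abs, hσ, one_pow]
  have hx2 : ∀ x : Fin n → EuclideanSpace ℝ (Fin d), IsGood x → ∀ k, ∑ i, x i k ^ 2 ≤ n := by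
    intro x hx k
    refine (Finset.sum_le_sum fun i _ => (?_ : x i k ^ 2 ≤ 1)).trans (by simp)
    exact (sq_le_one_iff_abs_le_one _).2 (hx.abs_apply_le i k)
  have h1 := h.measure_bilinear_ge_le hF hr hr1 (u := fun x i => σ * x i k) (v := fun x j => x j l)
    (fun i => by fun_prop) (fun i => by fun_prop) (t := n * Real.log n) (b := 2)
    (q := (n : ℝ) ^ 2) (θ := Real.log n / (8 * n)) (by positivity)
    (fun x hx i j => by
      have h2 : ∀ i j, |σ * x i k * x j l| ≤ 1 := fun i j => by
        rw [abs_mul, abs_mul, hσ, one_mul]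
        exact mul_le_one₀ (hx.abs_apply_le i k) (abs_nonneg _) (hx.abs_apply_le j l)
      exact (abs_add_le _ _).trans (by linarith [h2 i j, h2 j i]))
    (fun x hx => by
      simp only [mul_pow, hσ2, one_mul]
      rw [sq (n : ℝ)]
      exact mul_le_mul (hx2 x hx k) (hx2 x hx l)
        (Finset.sum_nonneg fun _ _ => sq_nonneg _) (by positivity))
  have e1 : ∀ ω, ∑ i, ∑ j, offDiag r (X ω) (A ω) i j * (σ * X ω i k * X ω j l) =
      σ * ∑ i, ∑ j, offDiag r (X ω) (A ω) i j * (X ω i k * X ω j l) := by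
    intro ω
    simp only [Finset.mul_sum]
    exact Finset.sum_congr rfl fun i _ => Finset.sum_congr rfl fun j _ => by ring
  simp only [e1] at h1
  refine h1.trans (ENNReal.ofReal_le_ofReal (Real.exp_le_exp.2 ?_))
  have h3 : Real.log n / (8 * n) * 2 ≤ 1 / 4 := by
    have := Real.log_le_sub_one_of_pos (by linarith : (0 : ℝ) < n)
    rw [div_mul_eq_mul_div, div_le_iff₀ (by positivity)]
    linarith
  have h4 : Real.exp (Real.log n / (8 * n) * 2) ≤ 2 := by
    refine (Real.exp_le_exp.2 h3).trans ?_
    have := Real.exp_bound_div_one_sub_of_interval (x := 1 / 4) (by norm_num) (by norm_num)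
    linarith
  have h5 : 2 * r * (Real.log n / (8 * n)) ^ 2 * Real.exp (Real.log n / (8 * n) * 2) * n ^ 2 ≤
      2 * 1 * (Real.log n / (8 * n)) ^ 2 * 2 * n ^ 2 := by gcongr
  have h6 : 2 * 1 * (Real.log n / (8 * n)) ^ 2 * 2 * n ^ 2 = Real.log n ^ 2 / 16 := by
    field_simp; ring
  have h7 : Real.log n / (8 * n) * (n * Real.log n) = Real.log n ^ 2 / 8 := by
    field_simp
  rw [h7]
  linarith

theorem IsRDPG.measure_block_sum_ge_le (h : IsRDPG μ F r X A) (hF : IsInnerProductDistribution F)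
    (hr : 0 ≤ r) (hr1 : r ≤ 1) (hD : 1 ≤ n * r) {σ : ℝ} (hσ : |σ| = 1) :
    μ {ω | ∃ S T : Finset (Fin n), 1 ≤ S.card ∧ S.card ≤ T.card ∧
        (T.card : ℝ) ≤ n * r * S.card ∧ 49 * √(n * r * S.card * T.card) ≤
        σ * ∑ i ∈ S, ∑ j ∈ T, offDiag r (X ω) (A ω) i j} ≤
      ENNReal.ofReal (Real.exp (-(3 * (√(n * r) * Real.log n)))) := by
  classical
  set D := (n : ℝ) * r with hDdef
  have hn0 : (n : ℝ) ≠ 0 := fun h0 => by rw [hDdef, h0] at hD; linarith [zero_mul r]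
  have hn : (0 : ℝ) < n := (Nat.cast_nonneg n).lt_of_ne hn0.symm
  have hDn : D ≤ n := mul_le_of_le_one_right hn.le hr1
  have hrD : r = D / n := by rw [hDdef]; field_simp
  have hσ2 : σ ^ 2 = 1 := by rw [← sq_abs, hσ, one_pow]
  -- Each pair of blocks fails with probability at most `f S * f T` times the target, and the
  -- weights `f` sum to at most `1`.
  set f : Finset (Fin n) → ℝ :=
    fun S => if S.card = 0 then 0 else Real.exp (-(3 * entropyRate n S.card)) with hf
  set K : Finset (Finset (Fin n) × Finset (Fin n)) :=
    Finset.univ.filter fun p => 1 ≤ p.1.card ∧ p.1.card ≤ p.2.card ∧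
      (p.2.card : ℝ) ≤ D * p.1.card with hK
  have h1 : ∀ p ∈ K, μ {ω | 49 * √(D * p.1.card * p.2.card) ≤
      σ * ∑ i ∈ p.1, ∑ j ∈ p.2, offDiag r (X ω) (A ω) i j} ≤
      ENNReal.ofReal (f p.1 * f p.2 * Real.exp (-(3 * (√D * Real.log n)))) := by
    rintro ⟨S, T⟩ hp
    obtain ⟨hS, hST, hTD⟩ := (Finset.mem_filter.1 hp).2
    simp only at hS hST hTD ⊢
    obtain ⟨θ, hθ, hle⟩ := chernoff_exponent_le (s := S.card) (t := T.card) hD hDn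
      (by exact_mod_cast hS) (by exact_mod_cast hST) hTD
    have h2 := h.measure_bilinear_ge_le hF hr hr1 (u := fun _ i => if i ∈ S then σ else 0)
      (v := fun _ j => if j ∈ T then 1 else 0)
      (fun _ => measurable_const) (fun _ => measurable_const)
      (t := 49 * √(D * S.card * T.card)) (b := 2) (q := S.card * T.card) hθ
      (fun x _ i j => by
        have h3 : ∀ i j, |(if i ∈ S then σ else 0) * (if j ∈ T then (1 : ℝ) else 0)| ≤ 1 :=
          fun i j => by split_ifs <;> simp [hσ]
        exact (abs_add_le _ _).trans (by linarith [h3 i j, h3 j i]))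
      (fun x _ => by simp [ite_pow, hσ2])
    have e1 : ∀ ω, ∑ i, ∑ j, offDiag r (X ω) (A ω) i j *
        ((if i ∈ S then σ else 0) * (if j ∈ T then (1 : ℝ) else 0)) =
        σ * ∑ i ∈ S, ∑ j ∈ T, offDiag r (X ω) (A ω) i j := by
      intro ω
      rw [Finset.mul_sum, ← Finset.sum_subset (Finset.subset_univ S) fun i _ hi => by simp [hi]]
      refine Finset.sum_congr rfl fun i hi => ?_
      rw [Finset.mul_sum, ← Finset.sum_subset (Finset.subset_univ T) fun j _ hj => by simp [hj]]
      refine Finset.sum_congr rfl fun j hj => ?_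
      rw [if_pos hi, if_pos hj]
      ring
    simp only [e1] at h2
    refine h2.trans (ENNReal.ofReal_le_ofReal ?_)
    have hS0 : S.card ≠ 0 := by omega
    have hT0 : T.card ≠ 0 := by omega
    rw [hf]
    simp only [if_neg hS0, if_neg hT0]
    rw [← Real.exp_add, ← Real.exp_add]
    refine Real.exp_le_exp.2 ?_
    rw [hrD]
    linarith
  have hsub : {ω | ∃ S T : Finset (Fin n), 1 ≤ S.card ∧ S.card ≤ T.card ∧
        (T.card : ℝ) ≤ D * S.card ∧ 49 * √(D * S.card * T.card) ≤
        σ * ∑ i ∈ S, ∑ j ∈ T, offDiag r (X ω) (A ω) i j} ⊆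
      ⋃ p ∈ K, {ω | 49 * √(D * p.1.card * p.2.card) ≤
      σ * ∑ i ∈ p.1, ∑ j ∈ p.2, offDiag r (X ω) (A ω) i j} := by
    rintro ω ⟨S, T, hS, hST, hTD, hω⟩
    simp only [Set.mem_iUnion]
    exact ⟨(S, T), Finset.mem_filter.2 ⟨Finset.mem_univ _, hS, hST, hTD⟩, hω⟩
  refine (measure_mono hsub).trans ((measure_biUnion_finset_le _ _).trans ?_)
  refine (Finset.sum_le_sum h1).trans ?_
  have hf0 : ∀ S, 0 ≤ f S := fun S => by
    rw [hf]; simp only; split_ifs <;> positivity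
  rw [← ENNReal.ofReal_sum_of_nonneg fun p _ =>
    mul_nonneg (mul_nonneg (hf0 _) (hf0 _)) (Real.exp_pos _).le]
  refine ENNReal.ofReal_le_ofReal ?_
  rw [← Finset.sum_mul]
  refine mul_le_of_le_one_left (Real.exp_pos _).le ?_
  have hf1 : ∑ S, f S ≤ 1 := sum_exp_entropyRate_le n
  have hfs0 : 0 ≤ ∑ S, f S := Finset.sum_nonneg fun S _ => hf0 S
  calc ∑ p ∈ K, f p.1 * f p.2 ≤ ∑ p : Finset (Fin n) × Finset (Fin n), f p.1 * f p.2 :=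
        Finset.sum_le_sum_of_subset_of_nonneg (Finset.subset_univ _)
          fun p _ _ => mul_nonneg (hf0 _) (hf0 _)
    _ = (∑ S, f S) * ∑ T, f T := by rw [Fintype.sum_prod_type, Finset.sum_mul_sum]
    _ ≤ 1 := mul_le_one₀ hf1 hfs0 hf1

end Events

/-! ### Rounding to the integer lattice; latent Gram matrix. -/

section LatticeSum

theorem exists_sum_exp_le {a : ℝ} (ha : 0 < a) :
    ∃ G : ℝ, 0 < G ∧ ∀ N : ℕ,
      ∑ k ∈ Finset.Icc (-(N : ℤ)) N, Real.exp (-(a * (k : ℝ) ^ 2)) ≤ Real.exp G := by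
  have hs : Summable fun k : ℤ => Real.exp (-(a * (k : ℝ) ^ 2)) := by
    have h0 : Summable fun k : ℕ => Real.exp (-(a * (k : ℝ) ^ 2)) := by
      refine Summable.of_nonneg_of_le (fun _ => (Real.exp_pos _).le) (fun k => ?_)
        (Real.summable_exp_nat_mul_iff.2 (neg_lt_zero.2 ha))
      refine Real.exp_le_exp.2 ?_
      have : (k : ℝ) ≤ (k : ℝ) ^ 2 := by exact_mod_cast Nat.le_self_pow two_ne_zero k
      nlinarith
    exact Summable.of_nat_of_neg (by simpa using h0) (by simpa using h0)
  refine ⟨∑' k : ℤ, Real.exp (-(a * (k : ℝ) ^ 2)),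
    hs.tsum_pos (fun _ => (Real.exp_pos _).le) 0 (Real.exp_pos _), fun N => ?_⟩
  refine (hs.sum_le_tsum _ fun _ _ => (Real.exp_pos _).le).trans ?_
  linarith [Real.add_one_le_exp (∑' k : ℤ, Real.exp (-(a * (k : ℝ) ^ 2)))]

/-- With `m = round z`, the rounding error costs at most `|m|/2 ≤ m²/2`, as `|m| ≤ m²` for integers.
Rounding to `0` therefore loses nothing, and `round z` is a good test vector for `z`. -/
theorem round_mul_ge (z : ℝ) : (round z : ℝ) ^ 2 / 2 ≤ round z * z := by
  have h1 := abs_sub_round z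
  have h2 : |(round z : ℝ)| ≤ (round z : ℝ) ^ 2 := by
    rw [← sq_abs]
    have : |(round z)| ≤ |(round z)| ^ 2 := by
      rcases eq_or_ne (round z) 0 with h | h
      · simp [h]
      · have := Int.one_le_abs h
        nlinarith
    exact_mod_cast this
  have h3 : -(|(round z : ℝ)| * (1 / 2)) ≤ round z * (z - round z) := by
    have h4 : |(round z : ℝ) * (z - round z)| ≤ |(round z : ℝ)| * (1 / 2) := by
      rw [abs_mul]; exact mul_le_mul_of_nonneg_left h1 (abs_nonneg _)
    exact (abs_le.1 h4).1
  nlinarith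

theorem sq_le_two_round_sq (z : ℝ) : z ^ 2 ≤ 2 * (round z : ℝ) ^ 2 + 1 / 2 := by
  have h1 := abs_le.1 (abs_sub_round z)
  nlinarith [sq_nonneg (z - 2 * round z)]

end LatticeSum

section Events

variable {Ω : Type*} [MeasurableSpace Ω] {μ : Measure Ω} {n d : ℕ}
  {F : Measure (EuclideanSpace ℝ (Fin d))} {r : ℝ}
  {X : Ω → Fin n → EuclideanSpace ℝ (Fin d)} {A : Ω → Matrix (Fin n) (Fin n) ℝ}

/-- The columns of `(A - P) X` are small when the absolute row sums of `A - P` are. -/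
theorem exists_measure_column_ge_le {L : ℝ} (hL : 0 ≤ L) :
    ∃ C : ℝ, 0 < C ∧ ∀ {Ω : Type*} [MeasurableSpace Ω] {μ : Measure Ω} {n d : ℕ}
      {F : Measure (EuclideanSpace ℝ (Fin d))} {r : ℝ}
      {X : Ω → Fin n → EuclideanSpace ℝ (Fin d)} {A : Ω → Matrix (Fin n) (Fin n) ℝ},
      IsRDPG μ F r X A → IsInnerProductDistribution F → 0 ≤ r → r ≤ 1 → 1 ≤ n * r →
      ∀ k : Fin d,
      μ {ω | IsGood (X ω) ∧ (∀ i, ∑ j, |offDiag r (X ω) (A ω) i j| ≤ L * (n * r)) ∧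
        C * (n * (n * r)) ≤ ∑ i, (∑ j, offDiag r (X ω) (A ω) i j * X ω j k) ^ 2} ≤
      ENNReal.ofReal (Real.exp (-n)) := by
  -- The tilt is `θ = a / √D`. Integer coefficients are at most about `L √D`, so this `a` keeps `θ`
  -- times the coefficients bounded and makes the variance term at most half of the gain `a |m|² /
  -- 4`.
  set a : ℝ := 1 / (24 * (L + 1)) with ha
  have ha0 : 0 < a := by positivity
  obtain ⟨G, hG0, hG⟩ := exists_sum_exp_le (a := a / 8) (by positivity)
  -- The sum over integer vectors factorizes and is at most `e^{Gn}`; this `B` leaves `e^{Gn - aBn}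
  -- = e^{-n}`.
  set B := (G + 1) / a with hB
  have hB0 : 0 < B := by positivity
  refine ⟨8 * B + 1, by positivity, ?_⟩
  intro Ω _ μ n d F r X A h hF hr hr1 hD k
  set D := (n : ℝ) * r with hDdef
  have hn0 : (n : ℝ) ≠ 0 := fun h0 => by rw [hDdef, h0] at hD; linarith [zero_mul r]
  have hn : (0 : ℝ) < n := (Nat.cast_nonneg n).lt_of_ne hn0.symm
  have hr0 : r ≠ 0 := fun h0 => by rw [hDdef, h0] at hD; linarith [mul_zero (n : ℝ)]
  set q := √D with hq
  have hq1 : 1 ≤ q := Real.one_le_sqrt.2 hD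
  have hqq : q * q = D := Real.mul_self_sqrt (by linarith)
  set N : ℕ := ⌈L * q⌉₊ + 1 with hN
  have hN1 : L * q + 1 ≤ N := by
    rw [hN]; push_cast; linarith [Nat.le_ceil (L * q)]
  have hN2 : (N : ℝ) ≤ L * q + 2 := by
    rw [hN]; push_cast; linarith [Nat.ceil_lt_add_one (show 0 ≤ L * q by positivity)]
  set K : Finset (Fin n → ℤ) := Fintype.piFinset fun _ => Finset.Icc (-(N : ℤ)) N with hK
  have hx2 : ∀ x : Fin n → EuclideanSpace ℝ (Fin d), IsGood x → ∑ i, x i k ^ 2 ≤ n := by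
    intro x hx
    refine (Finset.sum_le_sum fun i _ => (?_ : x i k ^ 2 ≤ 1)).trans (by simp)
    exact (sq_le_one_iff_abs_le_one _).2 (hx.abs_apply_le i k)
  have h1 : ∀ m ∈ K, μ {ω | q * ((∑ i, (m i : ℝ) ^ 2) / 4 + B * n) ≤
      ∑ i, ∑ j, offDiag r (X ω) (A ω) i j * ((m i : ℝ) * X ω j k)} ≤
      ENNReal.ofReal ((∏ i, Real.exp (-(a / 8 * (m i : ℝ) ^ 2))) * Real.exp (-(a * B * n))) := by
    intro m hm
    have hmN : ∀ i, |(m i : ℝ)| ≤ N := fun i => by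
      have := Finset.mem_Icc.1 (Fintype.mem_piFinset.1 hm i)
      rw [abs_le]
      exact ⟨by exact_mod_cast this.1, by exact_mod_cast this.2⟩
    set s := ∑ i, (m i : ℝ) ^ 2 with hs
    have hs0 : 0 ≤ s := Finset.sum_nonneg fun _ _ => sq_nonneg _
    have h2 := h.measure_bilinear_ge_le hF hr hr1 (u := fun _ i => (m i : ℝ))
      (v := fun x j => x j k) (fun _ => measurable_const) (fun i => by fun_prop)
      (t := q * (s / 4 + B * n)) (b := 2 * N) (q := s * n) (θ := a / q) (by positivity)
      (fun x hx i j => by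
        have h3 : ∀ i j, |(m i : ℝ) * x j k| ≤ N := fun i j => by
          rw [abs_mul]
          exact (mul_le_mul (hmN i) (hx.abs_apply_le j k) (abs_nonneg _) (Nat.cast_nonneg _)).trans
            (mul_one _).le
        exact (abs_add_le _ _).trans (by linarith [h3 i j, h3 j i]))
      (fun x hx => mul_le_mul_of_nonneg_left (hx2 x hx) hs0)
    refine h2.trans (ENNReal.ofReal_le_ofReal ?_)
    rw [← Real.exp_sum, ← Real.exp_add]
    refine Real.exp_le_exp.2 ?_
    rw [Finset.sum_neg_distrib, ← Finset.mul_sum, ← hs]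
    have e1 : a / q * (q * (s / 4 + B * n)) = a * (s / 4 + B * n) := by field_simp
    have e2 : 2 * r * (a / q) ^ 2 * Real.exp (a / q * (2 * N)) * (s * n) =
        2 * a ^ 2 * s * Real.exp (a / q * (2 * N)) := by
      rw [div_pow, sq q, hqq, hDdef]; field_simp
    have h4 : a / q * (2 * N) ≤ 1 / 6 := by
      have h5 : (N : ℝ) ≤ 2 * (L + 1) * q := by nlinarith
      calc a / q * (2 * N) ≤ a / q * (2 * (2 * (L + 1) * q)) := by gcongr
        _ = 1 / 6 := by rw [ha]; field_simp; norm_num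
    have h5 : Real.exp (a / q * (2 * N)) ≤ 3 / 2 := by
      refine (Real.exp_le_exp.2 h4).trans ?_
      have := Real.exp_bound_div_one_sub_of_interval (x := 1 / 6) (by norm_num) (by norm_num)
      linarith
    have ha1 : a ≤ 1 / 24 := by
      rw [ha]; exact one_div_le_one_div_of_le (by norm_num) (by linarith)
    rw [e1, e2]
    have h6 : 2 * a ^ 2 * s * Real.exp (a / q * (2 * N)) ≤ 2 * a ^ 2 * s * (3 / 2) :=
      mul_le_mul_of_nonneg_left h5 (by positivity)
    have h7 : 2 * a ^ 2 * s * (3 / 2) ≤ a * s / 8 := by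
      have := mul_le_mul_of_nonneg_right ha1 (mul_nonneg ha0.le hs0)
      nlinarith
    linarith
  have hsub : {ω | IsGood (X ω) ∧ (∀ i, ∑ j, |offDiag r (X ω) (A ω) i j| ≤ L * D) ∧
        (8 * B + 1) * (n * D) ≤ ∑ i, (∑ j, offDiag r (X ω) (A ω) i j * X ω j k) ^ 2} ⊆
      ⋃ m ∈ K, {ω | q * ((∑ i, (m i : ℝ) ^ 2) / 4 + B * n) ≤
      ∑ i, ∑ j, offDiag r (X ω) (A ω) i j * ((m i : ℝ) * X ω j k)} := by
    rintro ω ⟨hgood, hrow, hω⟩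
    -- If the column `√D z` is long, the integer vector `m = round z` witnesses it: `m · z ≥
    -- |m|²/2`, and `|z|² ≥ (8B + 1) n` forces `|m|² ≥ 4Bn`. The row sums keep `z`, hence `m`, in a
    -- finite box.
    set z : Fin n → ℝ := fun i => (∑ j, offDiag r (X ω) (A ω) i j * X ω j k) / q with hz
    have hzq : ∀ i, ∑ j, offDiag r (X ω) (A ω) i j * X ω j k = q * z i := fun i => by
      rw [hz]; field_simp
    have hzL : ∀ i, |z i| ≤ L * q := by
      intro i
      rw [hz, abs_div, abs_of_pos (by linarith : (0 : ℝ) < q), div_le_iff₀ (by linarith),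
        mul_assoc, hqq]
      refine ((Finset.abs_sum_le_sum_abs _ _).trans (Finset.sum_le_sum fun j _ => ?_)).trans
        (hrow i)
      rw [abs_mul]
      exact mul_le_of_le_one_right (abs_nonneg _) (hgood.abs_apply_le j k)
    simp only [Set.mem_iUnion]
    refine ⟨fun i => round (z i), ?_, ?_⟩
    · rw [hK, Fintype.mem_piFinset]
      intro i
      have h2 := abs_le.1 (abs_sub_round (z i))
      have h3 := abs_le.1 (hzL i)
      rw [Finset.mem_Icc]
      constructor
      · have : -(N : ℝ) ≤ round (z i) := by linarith
        exact_mod_cast this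
      · have : (round (z i) : ℝ) ≤ N := by linarith
        exact_mod_cast this
    · change q * ((∑ i, (round (z i) : ℝ) ^ 2) / 4 + B * n) ≤
        ∑ i, ∑ j, offDiag r (X ω) (A ω) i j * ((round (z i) : ℝ) * X ω j k)
      have e1 : ∑ i, ∑ j, offDiag r (X ω) (A ω) i j * ((round (z i) : ℝ) * X ω j k) =
          q * ∑ i, (round (z i) : ℝ) * z i := by
        rw [Finset.mul_sum]
        refine Finset.sum_congr rfl fun i _ => ?_
        rw [mul_left_comm, ← hzq, Finset.mul_sum]
        exact Finset.sum_congr rfl fun j _ => by ring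
      rw [e1]
      refine mul_le_mul_of_nonneg_left ?_ (by linarith)
      have h2 : (∑ i, (round (z i) : ℝ) ^ 2) / 2 ≤ ∑ i, (round (z i) : ℝ) * z i := by
        rw [Finset.sum_div]
        exact Finset.sum_le_sum fun i _ => round_mul_ge (z i)
      have h3 : ∑ i, z i ^ 2 ≤ 2 * ∑ i, (round (z i) : ℝ) ^ 2 + n / 2 := by
        refine (Finset.sum_le_sum fun i _ => sq_le_two_round_sq (z i)).trans (le_of_eq ?_)
        rw [Finset.sum_add_distrib, ← Finset.mul_sum]
        simp; ring
      have h4 : (8 * B + 1) * n ≤ ∑ i, z i ^ 2 := by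
        have h5 : (8 * B + 1) * (n * D) ≤ D * ∑ i, z i ^ 2 := by
          refine hω.trans (le_of_eq ?_)
          rw [Finset.mul_sum]
          refine Finset.sum_congr rfl fun i _ => ?_
          rw [hzq, mul_pow, sq q, hqq]
        have h6 : D * ((8 * B + 1) * n) ≤ D * ∑ i, z i ^ 2 := by linarith
        exact le_of_mul_le_mul_left h6 (by linarith)
      linarith
  refine (measure_mono hsub).trans ((measure_biUnion_finset_le _ _).trans ?_)
  refine (Finset.sum_le_sum h1).trans ?_
  rw [← ENNReal.ofReal_sum_of_nonneg fun p _ => by positivity]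
  refine ENNReal.ofReal_le_ofReal ?_
  rw [← Finset.sum_mul, hK, ← Finset.prod_univ_sum (fun _ => Finset.Icc (-(N : ℤ)) N)
    (fun _ z => Real.exp (-(a / 8 * (z : ℝ) ^ 2)))]
  rw [Finset.prod_const, Finset.card_univ, Fintype.card_fin]
  have h2 := pow_le_pow_left₀ (Finset.sum_nonneg fun _ _ => (Real.exp_pos _).le) (hG N) n
  refine (mul_le_mul_of_nonneg_right h2 (Real.exp_pos _).le).trans (le_of_eq ?_)
  rw [← Real.exp_nat_mul, ← Real.exp_add]
  congr 1
  rw [hB]; field_simp; ring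

/-- Hoeffding's inequality for the Gram matrix of the latent positions. -/
theorem IsRDPG.measure_latent_gram_ge_le (h : IsRDPG μ F r X A)
    (hF : IsInnerProductDistribution F) {σ ε : ℝ} (hσ : |σ| = 1) (hε : 0 ≤ ε) (hn : 1 ≤ n)
    (k l : Fin d) :
    μ {ω | ε * n ≤ ∑ i, σ * (X ω i k * X ω i l - secondMoment F k l)} ≤
      ENNReal.ofReal (Real.exp (-(ε ^ 2 / 2 * n))) := by
  have hprob := hF.1
  set f : EuclideanSpace ℝ (Fin d) → ℝ := fun x => σ * (x k * x l) with hf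
  have hfm : Measurable f := by fun_prop
  have hfb : ∀ᵐ x ∂F, f x ∈ Set.Icc (-1 : ℝ) 1 := by
    obtain ⟨_, S, hS, hSS⟩ := hF
    filter_upwards [hS] with x hx
    have h1 : ∀ k, |x k| ≤ 1 := by
      intro k
      have h2 := (hSS x hx x hx).2
      rw [real_inner_self_eq_norm_sq] at h2
      exact (PiLp.norm_apply_le x k).trans ((sq_le_one_iff₀ (norm_nonneg _)).1 h2)
    rw [Set.mem_Icc, ← abs_le, hf, abs_mul, abs_mul, hσ, one_mul]
    exact mul_le_one₀ (h1 k) (abs_nonneg _) (h1 l)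
  have hint : ∫ x, f x ∂F = σ * secondMoment F k l := by
    rw [hf, integral_const_mul]; rfl
  have hset : MeasurableSet {x : Fin n → EuclideanSpace ℝ (Fin d) |
      ε * n ≤ ∑ i, (f (x i) - ∫ y, f y ∂F)} :=
    measurableSet_le measurable_const (Finset.measurable_sum _ fun i _ =>
      (hfm.comp (measurable_pi_apply i)).sub_const _)
  have hmap : μ {ω | ε * n ≤ ∑ i, σ * (X ω i k * X ω i l - secondMoment F k l)} =
      (Measure.pi fun _ : Fin n => F) {x | ε * n ≤ ∑ i, (f (x i) - ∫ y, f y ∂F)} := by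
    rw [← h.law_latent, Measure.map_apply h.measurable_latent hset]
    congr 1
    ext ω
    simp only [Set.mem_preimage, hint]
    simp only [hf]
    exact iff_of_eq (congrArg _ (Finset.sum_congr rfl fun i _ => by ring))
  rw [hmap]
  have hind : ProbabilityTheory.iIndepFun
      (fun (i : Fin n) (x : Fin n → EuclideanSpace ℝ (Fin d)) => f (x i) - ∫ y, f y ∂F)
      (Measure.pi fun _ : Fin n => F) :=
    ProbabilityTheory.iIndepFun_pi (μ := fun _ : Fin n => F)
      (X := fun _ x => f x - ∫ y, f y ∂F) fun _ => (hfm.sub_const _).aemeasurable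
  have hsub : ∀ i : Fin n, ProbabilityTheory.HasSubgaussianMGF
      (fun x : Fin n → EuclideanSpace ℝ (Fin d) => f (x i) - ∫ y, f y ∂F) 1
      (Measure.pi fun _ : Fin n => F) := by
    intro i
    have h1 := ProbabilityTheory.hasSubgaussianMGF_of_mem_Icc hfm.aemeasurable hfb
    have h2 : ((‖(1 : ℝ) - -1‖₊ / 2) ^ 2 : NNReal) = 1 := by
      ext; push_cast; norm_num
    rw [h2] at h1
    have h3 := (measurePreserving_eval (fun _ : Fin n => F) i).map_eq
    have h4 : ProbabilityTheory.HasSubgaussianMGF (fun x => f x - ∫ y, f y ∂F) 1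
      ((Measure.pi fun _ : Fin n => F).map (Function.eval i)) := by rw [h3]; exact h1
    have h5 : AEMeasurable (Function.eval i) (Measure.pi fun _ : Fin n => F) :=
      (measurable_pi_apply i).aemeasurable
    exact ProbabilityTheory.HasSubgaussianMGF.of_map h5 h4
  have hH := ProbabilityTheory.HasSubgaussianMGF.measure_sum_ge_le_of_iIndepFun hind
    (c := fun _ => 1) (s := Finset.univ) (fun i _ => hsub i) (ε := ε * n) (by positivity)
  rw [ENNReal.le_ofReal_iff_toReal_le (measure_ne_top _ _) (Real.exp_pos _).le]
  refine hH.trans (Real.exp_le_exp.2 (le_of_eq ?_))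
  have : (n : ℝ) ≠ 0 := by positivity
  simp
  field_simp

end Events

/-! ### Further operator bounds and nondegeneracy of the second moment. -/

section OpBound

variable {n : Type*} [Fintype n]

theorem opBound_norm (M : Matrix n n ℝ) : OpBound M ‖M‖ := by
  refine ⟨norm_nonneg _, fun v => ?_⟩
  rw [frobenius_sq, Finset.sum_mul]
  refine Finset.sum_le_sum fun i _ => ?_
  have := dotProduct_sq_le (M i) v
  simpa [Matrix.mulVec, dotProduct, sq] using this

theorem OpBound.add {M N : Matrix n n ℝ} {b c : ℝ} (hM : OpBound M b) (hN : OpBound N c) :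
    OpBound (M + N) (b + c) := by
  refine ⟨add_nonneg hM.1 hN.1, fun v => ?_⟩
  rw [Matrix.add_mulVec, add_dotProduct, dotProduct_add, dotProduct_add,
    dotProduct_comm (N *ᵥ v) (M *ᵥ v)]
  have h1 := hM.2 v
  have h2 := hN.2 v
  have h0 := dotProduct_self_nonneg_real v
  have h3 : (M *ᵥ v) ⬝ᵥ (N *ᵥ v) ≤ b * c * (v ⬝ᵥ v) := by
    refine abs_le_of_sq_le_sq' ?_ (mul_nonneg (mul_nonneg hM.1 hN.1) h0) |>.2
    have h4 := dotProduct_sq_le (M *ᵥ v) (N *ᵥ v)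
    have h5 := mul_le_mul h1 h2 (dotProduct_self_nonneg_real _)
      (mul_nonneg (sq_nonneg b) h0)
    nlinarith
  nlinarith

theorem opBound_diagonal [DecidableEq n] {f : n → ℝ} (hf : ∀ i, |f i| ≤ 1) :
    OpBound (Matrix.diagonal f) 1 := by
  refine ⟨zero_le_one, fun v => ?_⟩
  rw [one_pow, one_mul]
  refine Finset.sum_le_sum fun i _ => ?_
  rw [Matrix.mulVec_diagonal]
  have : f i * f i ≤ 1 := by
    rw [← sq]; exact (sq_le_one_iff_abs_le_one _).2 (hf i)
  nlinarith [mul_self_nonneg (v i)]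

end OpBound

section SecondMoment

variable {d : ℕ} {F : Measure (EuclideanSpace ℝ (Fin d))}

theorem secondMoment_quadratic_nonneg (hF : IsInnerProductDistribution F) (v : Fin d → ℝ) :
    0 ≤ v ⬝ᵥ (secondMoment F *ᵥ v) := by
  obtain ⟨hp, S, hS, hSS⟩ := hF
  have hb : ∀ᵐ x ∂F, ∀ k, |x k| ≤ 1 := by
    filter_upwards [hS] with x hx k
    have h2 := (hSS x hx x hx).2
    rw [real_inner_self_eq_norm_sq] at h2
    exact (PiLp.norm_apply_le x k).trans ((sq_le_one_iff₀ (norm_nonneg _)).1 h2)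
  have hint : ∀ k l, Integrable (fun x : EuclideanSpace ℝ (Fin d) => x k * x l) F := fun k l => by
    refine Integrable.of_bound (by fun_prop) 1 ?_
    filter_upwards [hb] with x hx
    rw [Real.norm_eq_abs, abs_mul]
    exact mul_le_one₀ (hx k) (abs_nonneg _) (hx l)
  have h1 : v ⬝ᵥ (secondMoment F *ᵥ v) =
      ∫ x, (∑ k, ∑ l, v k * v l * (x k * x l)) ∂F := by
    rw [integral_finsetSum _ fun k _ => integrable_finsetSum _ fun l _ => (hint k l).const_mul _]
    simp only [dotProduct, Matrix.mulVec, secondMoment, Matrix.of_apply, Finset.mul_sum]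
    refine Finset.sum_congr rfl fun k _ => ?_
    rw [integral_finsetSum _ fun l _ => (hint k l).const_mul _]
    refine Finset.sum_congr rfl fun l _ => ?_
    rw [integral_const_mul]; ring
  rw [h1]
  refine integral_nonneg fun x => ?_
  have : ∑ k, ∑ l, v k * v l * (x k * x l) = (∑ k, v k * x k) * ∑ l, v l * x l := by
    rw [Finset.sum_mul_sum]
    exact Finset.sum_congr rfl fun _ _ => Finset.sum_congr rfl fun _ _ => by ring
  simp only [this]
  exact mul_self_nonneg _

theorem secondMoment_transpose : (secondMoment F)ᵀ = secondMoment F := by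
  ext k l
  simp [secondMoment, mul_comm]

theorem exists_secondMoment_quadratic_ge (hF : IsInnerProductDistribution F)
    (hrank : (secondMoment F).rank = d) :
    ∃ c : ℝ, 0 < c ∧ ∀ v : Fin d → ℝ, c * (v ⬝ᵥ v) ≤ v ⬝ᵥ (secondMoment F *ᵥ v) := by
  set Δ := secondMoment F
  have hu : IsUnit Δ := by
    rw [← Matrix.mulVec_surjective_iff_isUnit]
    have htop : LinearMap.range Δ.mulVecLin = ⊤ :=
      Submodule.eq_top_of_finrank_eq (by rw [Module.finrank_fin_fun]; exact hrank)
    exact LinearMap.range_eq_top.1 htop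
  have hdet := (Matrix.isUnit_iff_isUnit_det _).1 hu
  set β := ‖Δ⁻¹‖ + 1 with hβ
  have hβ0 : 0 < β := by positivity
  refine ⟨1 / β, by positivity, fun v => ?_⟩
  set w := Δ⁻¹ *ᵥ v with hw
  have hΔw : Δ *ᵥ w = v := by
    rw [hw, Matrix.mulVec_mulVec, Matrix.mul_nonsing_inv _ hdet, Matrix.one_mulVec]
  -- Positivity at `v - w/β` with `w = Δ⁻¹ v` reads `v · Δv ≥ (2/β)|v|² - (1/β²) w · v`, and `w · v
  -- ≤ β |v|²`; so `1/β` is a lower bound without diagonalizing.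
  have h1 := secondMoment_quadratic_nonneg hF (v - (1 / β) • w)
  have h2 : w ⬝ᵥ (Δ *ᵥ v) = v ⬝ᵥ v := by
    rw [Matrix.dotProduct_mulVec, ← Matrix.mulVec_transpose, secondMoment_transpose, hΔw]
  rw [Matrix.mulVec_sub, Matrix.mulVec_smul, hΔw, sub_dotProduct, dotProduct_sub, dotProduct_sub,
    smul_dotProduct, smul_dotProduct, dotProduct_smul, dotProduct_smul, h2] at h1
  simp only [smul_eq_mul] at h1
  have h3 : w ⬝ᵥ v ≤ β * (v ⬝ᵥ v) := by
    rw [dotProduct_comm]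
    have := (opBound_norm Δ⁻¹).dotProduct_le v
    have h0 := dotProduct_self_nonneg_real v
    rw [hβ]; linarith
  have h4 : 1 / β * (1 / β * (w ⬝ᵥ v)) ≤ 1 / β * (v ⬝ᵥ v) := by
    refine mul_le_mul_of_nonneg_left ?_ (by positivity)
    rw [one_div_mul_eq_div, div_le_iff₀ hβ0]; linarith
  linarith

variable {n : ℕ} {x : Fin n → EuclideanSpace ℝ (Fin d)}

/-- An entrywise error of `cn / (2(d+1))` gives a Frobenius error of at most `cn/2`, half of the
lower bound for `n` times the second moment; `d + 1` avoids division by zero. -/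
theorem latent_quadratic_ge {c : ℝ} (hc : 0 < c)
    (hF : ∀ v : Fin d → ℝ, c * (v ⬝ᵥ v) ≤ v ⬝ᵥ (secondMoment F *ᵥ v))
    (hx : ∀ k l, |∑ i, (x i k * x i l - secondMoment F k l)| ≤ c / (2 * (d + 1)) * n)
    (v : Fin d → ℝ) :
    c / 2 * n * (v ⬝ᵥ v) ≤ (latentMatrix x *ᵥ v) ⬝ᵥ (latentMatrix x *ᵥ v) := by
  set G := (latentMatrix x)ᵀ * latentMatrix x - (n : ℝ) • secondMoment F with hG
  have hGe : ∀ k l, G k l = ∑ i, (x i k * x i l - secondMoment F k l) := by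
    intro k l
    simp [hG, Matrix.mul_apply, latentMatrix, Finset.sum_sub_distrib]
  have hGn : ‖G‖ ≤ c / 2 * n := by
    refine abs_le_of_sq_le_sq' ?_ (by positivity) |>.2
    rw [frobenius_sq]
    have h1 : ∀ k l, G k l ^ 2 ≤ (c / (2 * (d + 1)) * n) ^ 2 := fun k l => by
      rw [hGe, ← sq_abs]; exact pow_le_pow_left₀ (abs_nonneg _) (hx k l) 2
    refine (Finset.sum_le_sum fun k _ => Finset.sum_le_sum fun l _ => h1 k l).trans ?_
    simp only [Finset.sum_const, Finset.card_univ, Fintype.card_fin, nsmul_eq_mul]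
    have h2 : (d : ℝ) * (c / (2 * (d + 1)) * n) ≤ c / 2 * n := by
      rw [← mul_assoc]
      refine mul_le_mul_of_nonneg_right ?_ (Nat.cast_nonneg n)
      rw [mul_div_assoc', div_le_div_iff₀ (by positivity) two_pos]
      nlinarith
    have h3 := pow_le_pow_left₀ (by positivity) h2 2
    nlinarith
  have h1 := (opBound_norm G).neg_le_dotProduct v
  have h0 := dotProduct_self_nonneg_real v
  have h2 := mul_le_mul_of_nonneg_right hGn h0
  have h3 := mul_le_mul_of_nonneg_left (hF v) (Nat.cast_nonneg (α := ℝ) n)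
  rw [hG, Matrix.sub_mulVec, dotProduct_sub, Matrix.smul_mulVec, dotProduct_smul,
    smul_eq_mul] at h1
  rw [mulVec_dotProduct_mulVec]
  linarith

end SecondMoment

/-! ### The expansion on the good event. -/

section Regular

variable {n d : ℕ} {r c D L : ℝ} {x : Fin n → EuclideanSpace ℝ (Fin d)}
  {a : Matrix (Fin n) (Fin n) ℝ}

theorem FrobeniusExpansion.mono {ε ε' : ℝ} (h : FrobeniusExpansion r x a ε) (hε : ε ≤ ε') :
    FrobeniusExpansion r x a ε' := by
  refine ⟨h.1, fun UA sA hA UP sP hP => ?_⟩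
  obtain ⟨W, hW, hle⟩ := h.2 UA sA hA UP sP hP
  exact ⟨W, hW, hle.trans hε⟩

theorem IsGood.norm_latentMatrix_le (hx : IsGood x) : ‖latentMatrix x‖ ≤ √n := by
  refine Real.le_sqrt_of_sq_le ?_
  rw [frobenius_sq]
  have h1 : ∀ i, ∑ k, latentMatrix x i k ^ 2 ≤ 1 := by
    intro i
    have h2 := hx.norm_le i
    have h3 : ∑ k, latentMatrix x i k ^ 2 = ‖x i‖ ^ 2 := by
      rw [EuclideanSpace.norm_sq_eq]
      simp [latentMatrix]
    rw [h3]
    exact (sq_le_one_iff₀ (norm_nonneg _)).2 h2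
  refine (Finset.sum_le_sum fun i _ => h1 i).trans ?_
  simp

theorem IsGood.norm_smul_latentMatrix_le (hx : IsGood x) :
    ‖√r • latentMatrix x‖ ≤ √(n * r) := by
  rw [norm_smul, Real.norm_of_nonneg (Real.sqrt_nonneg _), mul_comm,
    Real.sqrt_mul (Nat.cast_nonneg n)]
  exact mul_le_mul_of_nonneg_right hx.norm_latentMatrix_le (Real.sqrt_nonneg _)

theorem smul_latent_quadratic_ge (hr : 0 ≤ r)
    (h : ∀ v : Fin d → ℝ, c * n * (v ⬝ᵥ v) ≤ (latentMatrix x *ᵥ v) ⬝ᵥ (latentMatrix x *ᵥ v))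
    (v : Fin d → ℝ) :
    c * (n * r) * (v ⬝ᵥ v) ≤ ((√r • latentMatrix x) *ᵥ v) ⬝ᵥ ((√r • latentMatrix x) *ᵥ v) := by
  rw [Matrix.smul_mulVec, dotProduct_smul, smul_dotProduct, smul_smul, Real.mul_self_sqrt hr,
    smul_eq_mul]
  have := mul_le_mul_of_nonneg_left (h v) hr
  linarith

theorem sub_edgeProb_eq (ha : IsAdjacency a) :
    a - edgeProb r x = offDiag r x a + Matrix.diagonal fun i => -edgeProb r x i i := by
  ext i j
  rw [Matrix.sub_apply, Matrix.add_apply, offDiag, Matrix.of_apply, Matrix.diagonal_apply]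
  split_ifs with h
  · rw [← h, ha.hollow]; ring
  · ring

theorem IsAdjacency.apply_nonneg (ha : IsAdjacency a) (i j : Fin n) : 0 ≤ a i j := by
  rcases ha.zero_or_one i j with h | h <;> rw [h]
  exact zero_le_one

theorem sum_edgeProb_le (hx : IsGood x) (hr : 0 ≤ r) (i : Fin n) :
    ∑ j, edgeProb r x i j ≤ n * r := by
  refine (Finset.sum_le_sum fun j _ => (hx.edgeProb_mem hr i j).2).trans ?_
  simp

theorem sum_abs_offDiag_le (hx : IsGood x) (hr : 0 ≤ r) (ha : IsAdjacency a) (i : Fin n) :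
    ∑ j, |offDiag r x a i j| ≤ ∑ j, offDiag r x a i j + 2 * (n * r) := by
  have h1 : ∀ j, |offDiag r x a i j| ≤ offDiag r x a i j + 2 * edgeProb r x i j := by
    intro j
    have h2 := hx.edgeProb_mem hr i j
    have h3 := ha.apply_nonneg i j
    simp only [offDiag, Matrix.of_apply]
    split_ifs
    · simp; exact h2.1
    · rw [abs_le]; constructor <;> linarith
  refine (Finset.sum_le_sum fun j _ => h1 j).trans ?_
  rw [Finset.sum_add_distrib, ← Finset.mul_sum]
  linarith [sum_edgeProb_le hx hr i]

theorem sum_abs_adjacency_le (hx : IsGood x) (hr : 0 ≤ r) (ha : IsAdjacency a) (i : Fin n) :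
    ∑ j, |a i j| ≤ ∑ j, offDiag r x a i j + n * r := by
  have h1 : ∀ j, |a i j| ≤ offDiag r x a i j + edgeProb r x i j := by
    intro j
    have h2 := hx.edgeProb_mem hr i j
    rw [abs_of_nonneg (ha.apply_nonneg i j)]
    simp only [offDiag, Matrix.of_apply]
    split_ifs with h
    · rw [← h, ha.hollow]; simp; exact (hx.edgeProb_mem hr i i).1
    · linarith
  refine (Finset.sum_le_sum fun j _ => h1 j).trans ?_
  rw [Finset.sum_add_distrib]
  linarith [sum_edgeProb_le hx hr i]

/-- Block sums of size comparable to the square root of the mean degree, for all blocks. -/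
theorem abs_block_sum_le (hD : 0 ≤ D) (hL : 0 ≤ L) {M : Matrix (Fin n) (Fin n) ℝ} (hM : Mᵀ = M)
    (hrow : ∀ i, ∑ j, |M i j| ≤ L * D)
    (hdisc : ∀ S T : Finset (Fin n), 1 ≤ S.card → S.card ≤ T.card → (T.card : ℝ) ≤ D * S.card →
      |∑ i ∈ S, ∑ j ∈ T, M i j| ≤ 49 * √(D * S.card * T.card)) (S T : Finset (Fin n)) :
    |∑ i ∈ S, ∑ j ∈ T, M i j| ≤ (49 + L) * √D * √(S.card * T.card) := by
  have key : ∀ S T : Finset (Fin n), S.card ≤ T.card →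
      |∑ i ∈ S, ∑ j ∈ T, M i j| ≤ (49 + L) * √D * √(S.card * T.card) := by
    intro S T hST
    have e : √(D * S.card * T.card) = √D * √(S.card * T.card) := by
      rw [mul_assoc, Real.sqrt_mul hD]
    have h0 : 0 ≤ √D * √(S.card * T.card) := by positivity
    rcases Nat.eq_zero_or_pos S.card with hS | hS
    · rw [Finset.card_eq_zero] at hS
      simp [hS]
    by_cases hT : (T.card : ℝ) ≤ D * S.card
    · have := hdisc S T hS hST hT
      rw [e] at this
      nlinarith
    -- For a block too unbalanced for the discrepancy bound, row sums suffice: `D |S| < |T|` gives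
    -- `D |S| ≤ √(D |S| |T|)`.
    · have h1 : |∑ i ∈ S, ∑ j ∈ T, M i j| ≤ L * D * S.card := by
        calc |∑ i ∈ S, ∑ j ∈ T, M i j| ≤ ∑ i ∈ S, ∑ j ∈ T, |M i j| :=
              (Finset.abs_sum_le_sum_abs _ _).trans
                (Finset.sum_le_sum fun i _ => Finset.abs_sum_le_sum_abs _ _)
          _ ≤ ∑ i ∈ S, L * D := by
              refine Finset.sum_le_sum fun i _ => le_trans ?_ (hrow i)
              exact Finset.sum_le_sum_of_subset_of_nonneg (Finset.subset_univ _)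
                fun _ _ _ => abs_nonneg _
          _ = L * D * S.card := by rw [Finset.sum_const, nsmul_eq_mul]; ring
      have h2 : D * S.card ≤ √D * √(S.card * T.card) := by
        rw [← e]
        refine Real.le_sqrt_of_sq_le ?_
        have h3 : D * S.card * (D * S.card) ≤ D * S.card * T.card :=
          mul_le_mul_of_nonneg_left (not_le.1 hT).le (by positivity)
        nlinarith
      have h3 := mul_le_mul_of_nonneg_left h2 hL
      nlinarith
  rcases le_total S.card T.card with h | h
  · exact key S T h
  · have h1 := key T S h
    rw [mul_comm (T.card : ℝ), Finset.sum_comm (f := fun i j => M i j)] at h1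
    have : ∑ i ∈ S, ∑ j ∈ T, M j i = ∑ i ∈ S, ∑ j ∈ T, M i j :=
      Finset.sum_congr rfl fun i _ => Finset.sum_congr rfl fun j _ => congrFun (congrFun hM i) j
    rwa [this] at h1

/-- The cutoff between near and far dyadic levels: `2^g ≥ √D` brings the row sum term `L D 2⁻ᵍ` down
to `L √D`, while the number of offsets grows only like `log D`. -/
theorem exists_pow_two_ge (hD : 1 ≤ D) :
    ∃ g : ℕ, √D ≤ 2 ^ g ∧ (g : ℝ) ≤ Real.log D + 1 := by
  refine ⟨⌈Real.logb 2 √D⌉₊, ?_, ?_⟩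
  · have h1 := Nat.le_ceil (Real.logb 2 √D)
    rw [Real.logb_le_iff_le_rpow one_lt_two (Real.sqrt_pos.2 (by linarith)),
      Real.rpow_natCast] at h1
    exact h1
  · have h0 : 0 ≤ Real.log √D := Real.log_nonneg (Real.one_le_sqrt.2 hD)
    have h1 := Nat.ceil_lt_add_one
      (show 0 ≤ Real.logb 2 √D from div_nonneg h0 (Real.log_nonneg one_le_two))
    refine h1.le.trans ?_
    have h2 : Real.logb 2 √D ≤ Real.log D := by
      rw [Real.logb, div_le_iff₀ (Real.log_pos one_lt_two), Real.log_sqrt (by linarith)]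
      nlinarith [Real.log_two_gt_d9, Real.log_nonneg hD]
    linarith

/-- Operator norm constant in terms of the row sum constant. -/
noncomputable def opConst (L : ℝ) : ℝ := 4 * (294 + 7 * L) + 1

theorem opBound_sub_edgeProb (hD : 1 ≤ n * r) (hr : 0 ≤ r) (hr1 : r ≤ 1) (hL : 0 ≤ L)
    (hx : IsGood x) (ha : IsAdjacency a)
    (hrow : ∀ i, ∑ j, |offDiag r x a i j| ≤ L * (n * r))
    (hdisc : ∀ S T : Finset (Fin n), 1 ≤ S.card → S.card ≤ T.card →
      (T.card : ℝ) ≤ n * r * S.card →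
      |∑ i ∈ S, ∑ j ∈ T, offDiag r x a i j| ≤ 49 * √(n * r * S.card * T.card)) :
    ∃ b, OpBound (a - edgeProb r x) b ∧
      b ≤ opConst L * (√(n * r) * (1 + Real.log (n * r))) := by
  set D := (n : ℝ) * r
  have hsymm := offDiag_transpose (r := r) (x := x) ha.symm
  obtain ⟨g, hg1, hg2⟩ := exists_pow_two_ge hD
  have h1 := opBound_of_discrepancy (α := (49 + L) * √D) (L := L * D) (by positivity)
    (by positivity) hsymm (abs_block_sum_le (by linarith) hL hsymm hrow hdisc) hrow g
  have h2 := opBound_diagonal (f := fun i => -edgeProb r x i i) fun i => by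
    have := hx.edgeProb_mem hr i i
    rw [abs_neg, abs_of_nonneg this.1]; linarith
  refine ⟨_, (sub_edgeProb_eq ha) ▸ h1.add h2, ?_⟩
  set q := √D with hq
  have hq1 : 1 ≤ q := Real.one_le_sqrt.2 hD
  have hqq : q * q = D := Real.mul_self_sqrt (by linarith)
  have hl : 0 ≤ Real.log D := Real.log_nonneg hD
  have h3 : L * D * 2⁻¹ ^ g ≤ L * q := by
    rw [inv_pow, ← div_eq_mul_inv, div_le_iff₀ (by positivity), ← hqq]
    have : 0 ≤ L * q := by positivity
    nlinarith
  have h4 : 2 * (2 * (g : ℝ) + 1) * ((49 + L) * q) ≤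
      2 * (2 * (Real.log D + 1) + 1) * ((49 + L) * q) := by gcongr
  have h5 : 1 ≤ q * (1 + Real.log D) := by nlinarith
  have h6 : 0 ≤ q * Real.log D := by positivity
  have h7 : 0 ≤ L * (q * Real.log D) := by positivity
  rw [opConst]
  nlinarith

end Regular

section Regular

variable {n d : ℕ} {r c B C L : ℝ} {x : Fin n → EuclideanSpace ℝ (Fin d)}
  {a : Matrix (Fin n) (Fin n) ℝ}

theorem norm_offDiag_mul_latentMatrix_le (hB : 0 ≤ B)
    (hcol : ∀ k, ∑ i, (∑ j, offDiag r x a i j * x j k) ^ 2 ≤ B * (n * (n * r))) :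
    ‖offDiag r x a * latentMatrix x‖ ≤ √(d * B) * √(n * (n * r)) := by
  rw [← Real.sqrt_mul (by positivity)]
  refine Real.le_sqrt_of_sq_le ?_
  rw [frobenius_sq, Finset.sum_comm]
  refine (Finset.sum_le_sum fun k _ => hcol k).trans (le_of_eq ?_)
  simp [mul_assoc]

theorem norm_transpose_mul_offDiag_mul_le {t : ℝ} (ht : 0 ≤ t)
    (hgram : ∀ k l, |∑ i, ∑ j, offDiag r x a i j * (x i k * x j l)| ≤ t) :
    ‖(latentMatrix x)ᵀ * offDiag r x a * latentMatrix x‖ ≤ d * t := by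
  refine abs_le_of_sq_le_sq' ?_ (by positivity) |>.2
  rw [frobenius_sq]
  have h1 : ∀ k l, ((latentMatrix x)ᵀ * offDiag r x a * latentMatrix x) k l ^ 2 ≤ t ^ 2 := by
    intro k l
    have h2 : ((latentMatrix x)ᵀ * offDiag r x a * latentMatrix x) k l =
        ∑ i, ∑ j, offDiag r x a i j * (x i k * x j l) := by
      rw [Finset.sum_comm]
      simp only [Matrix.mul_apply, latentMatrix, Matrix.transpose_apply, Matrix.of_apply,
        Finset.sum_mul]
      exact Finset.sum_congr rfl fun _ _ => Finset.sum_congr rfl fun _ _ => by ring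
    rw [h2, ← sq_abs]
    exact pow_le_pow_left₀ (abs_nonneg _) (hgram k l) 2
  refine (Finset.sum_le_sum fun k _ => Finset.sum_le_sum fun l _ => h1 k l).trans (le_of_eq ?_)
  simp only [Finset.sum_const, Finset.card_univ, Fintype.card_fin, nsmul_eq_mul]
  ring

theorem opBound_diagonal_edgeProb (hx : IsGood x) (hr : 0 ≤ r) (hr1 : r ≤ 1) :
    OpBound (Matrix.diagonal fun i => -edgeProb r x i i) 1 :=
  opBound_diagonal fun i => by
    have := hx.edgeProb_mem hr i i
    rw [abs_neg, abs_of_nonneg this.1]; linarith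

/-- `hC` compares the row-sum and column constants `L`, `B` with `C log n` only after multiplication
by `1 + log D`. Thus `C` can stay fixed while `L` and `B` grow, provided `log D` is much smaller
than `log n`. The diagonal of `P`, absent from `offDiag`, has norm at most `1` and adds lower-order
terms. -/
theorem frobeniusExpansion_of_dense (hD : 1 ≤ n * r) (hr : 0 ≤ r) (hr1 : r ≤ 1)
    (hlog : 1 ≤ Real.log n) (hL : 0 ≤ L) (hB : 0 ≤ B) (hc : 0 < c)
    (hx : IsGood x) (ha : IsAdjacency a)
    (hrow : ∀ i, ∑ j, |offDiag r x a i j| ≤ L * (n * r))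
    (hdisc : ∀ S T : Finset (Fin n), 1 ≤ S.card → S.card ≤ T.card →
      (T.card : ℝ) ≤ n * r * S.card →
      |∑ i ∈ S, ∑ j ∈ T, offDiag r x a i j| ≤ 49 * √(n * r * S.card * T.card))
    (hcol : ∀ k, ∑ i, (∑ j, offDiag r x a i j * x j k) ^ 2 ≤ B * (n * (n * r)))
    (hgram : ∀ k l, |∑ i, ∑ j, offDiag r x a i j * (x i k * x j l)| ≤ n * Real.log n)
    (hquad : ∀ v : Fin d → ℝ,
      c * n * (v ⬝ᵥ v) ≤ (latentMatrix x *ᵥ v) ⬝ᵥ (latentMatrix x *ᵥ v))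
    (hop : opConst L * (√(n * r) * (1 + Real.log (n * r))) ≤ c * (n * r) / 8)
    (hC : opConst L * (√(d * B) + 1) * (1 + Real.log (n * r)) ≤ C * Real.log n)
    (hdC : (d : ℝ) + 1 ≤ C) :
    FrobeniusExpansion r x a (expansionConst c C * (Real.log n / √(n * r))) := by
  obtain ⟨b, hb, hble⟩ := opBound_sub_edgeProb hD hr hr1 hL hx ha hrow hdisc
  have hn0 : (0 : ℝ) ≤ n := Nat.cast_nonneg n
  have hdiag := opBound_diagonal_edgeProb hx hr hr1
  have hXn := hx.norm_latentMatrix_le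
  set X := latentMatrix x with hX
  set G := Matrix.diagonal fun i => -edgeProb r x i i with hG
  have hE : a - edgeProb r x = offDiag r x a + G := sub_edgeProb_eq ha
  have hGX : ‖G * X‖ ≤ √n := (hdiag.norm_mul_le X).trans (by rw [one_mul]; exact hXn)
  set D := (n : ℝ) * r with hDdef
  have hq1 : 1 ≤ √D := Real.one_le_sqrt.2 hD
  have hqq : √D * √D = D := Real.mul_self_sqrt (by linarith)
  have hrn : √r * √n = √D := by rw [hDdef, mul_comm (n : ℝ), Real.sqrt_mul hr]
  have h1 : ‖(a - edgeProb r x) * (√r • X)‖ ≤ D * (√(d * B) + 1) := by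
    rw [Matrix.mul_smul, norm_smul, Real.norm_of_nonneg (Real.sqrt_nonneg r), hE, Matrix.add_mul]
    have h2 := norm_offDiag_mul_latentMatrix_le hB hcol
    rw [← hX, ← hDdef, Real.sqrt_mul hn0] at h2
    have h3 := mul_le_mul_of_nonneg_left ((norm_add_le _ _).trans (add_le_add h2 hGX))
      (Real.sqrt_nonneg r)
    have h4 : √r * (√(d * B) * (√n * √D) + √n) = √(d * B) * ((√r * √n) * √D) + √r * √n := by
      ring
    rw [h4, hrn, hqq] at h3
    nlinarith
  have h5 : ‖(√r • X)ᵀ * (a - edgeProb r x) * (√r • X)‖ ≤ (d + 1) * (D * Real.log n) := by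
    rw [Matrix.mul_smul, Matrix.transpose_smul, Matrix.smul_mul, Matrix.smul_mul, smul_smul,
      Real.mul_self_sqrt hr, norm_smul, Real.norm_of_nonneg hr, hE, Matrix.mul_add, Matrix.add_mul,
      Matrix.mul_assoc Xᵀ G]
    have h2 := norm_transpose_mul_offDiag_mul_le (t := n * Real.log n) (by positivity) hgram
    have h3 : ‖Xᵀ * (G * X)‖ ≤ n := by
      refine (Matrix.frobenius_norm_mul _ _).trans ?_
      rw [Matrix.frobenius_norm_transpose, ← Real.mul_self_sqrt hn0]
      exact mul_le_mul hXn hGX (norm_nonneg _) (Real.sqrt_nonneg _)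
    have h4 := mul_le_mul_of_nonneg_left ((norm_add_le _ _).trans (add_le_add h2 h3)) hr
    refine h4.trans ?_
    rw [hDdef]
    have : 0 ≤ (n : ℝ) * r := by positivity
    nlinarith
  have hC0 : 0 ≤ C := le_trans (by positivity) hdC
  refine frobeniusExpansion_of_bounds hr hc (by linarith) hC0 ha.symm
    (smul_latent_quadratic_ge hr hquad) hx.norm_smul_latentMatrix_le (hble.trans hop) hb ?_ ?_
  · have hl : 0 ≤ Real.log D := Real.log_nonneg hD
    have h6 := mul_le_mul hble h1 (norm_nonneg _) (hb.1.trans hble)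
    refine h6.trans ?_
    have h7 := mul_le_mul_of_nonneg_left hC (show 0 ≤ D * √D by positivity)
    linarith
  · exact h5.trans (mul_le_mul_of_nonneg_right hdC (by positivity))

/-- Schur's test bounds `A` by its largest degree, at most `l`; with `D ≤ l` every term of the crude
estimate is of order `l / √D`. -/
theorem frobeniusExpansion_of_sparse (hD : 0 < n * r) (hr : 0 ≤ r) (hc : 0 < c) {l : ℝ}
    (hl : n * r ≤ l) (hx : IsGood x) (ha : IsAdjacency a) (hrow : ∀ i, ∑ j, |a i j| ≤ l)
    (hquad : ∀ v : Fin d → ℝ,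
      c * n * (v ⬝ᵥ v) ≤ (latentMatrix x *ᵥ v) ⬝ᵥ (latentMatrix x *ᵥ v)) :
    FrobeniusExpansion r x a ((√d + 2 + √(d / c)) * (l / √(n * r))) := by
  set D := (n : ℝ) * r with hDdef
  have hl0 : 0 ≤ l := hD.le.trans hl
  refine (frobeniusExpansion_of_opBound hr (mul_pos hc hD) (smul_latent_quadratic_ge hr hquad)
    hx.norm_smul_latentMatrix_le (opBound_of_row_sums hl0 ha.symm hrow)).mono ?_
  have hq : 0 < √D := Real.sqrt_pos.2 hD
  have hqq : √D * √D = D := Real.mul_self_sqrt hD.le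
  have h1 : √(d * l) ≤ √d * (l / √D) := by
    rw [Real.sqrt_mul (Nat.cast_nonneg d)]
    refine mul_le_mul_of_nonneg_left ?_ (Real.sqrt_nonneg _)
    rw [le_div_iff₀ hq]
    calc √l * √D ≤ √l * √l := by gcongr
      _ = l := Real.mul_self_sqrt hl0
  have h2 : √D ≤ l / √D := by rw [le_div_iff₀ hq, hqq]; exact hl
  have h3 : √(d / (c * D)) = √(d / c) / √D := by
    rw [← div_div, Real.sqrt_div (by positivity)]
  have h4 : l * (√(d / c) / √D) = √(d / c) * (l / √D) := by ring
  rw [h3, h4]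
  linarith

end Regular

/-! ### Probability of the good event. -/

section Probability

variable {Ω : Type*} [MeasurableSpace Ω] {μ : Measure Ω} {n d : ℕ}
  {F : Measure (EuclideanSpace ℝ (Fin d))} {r : ℝ}
  {X : Ω → Fin n → EuclideanSpace ℝ (Fin d)} {A : Ω → Matrix (Fin n) (Fin n) ℝ}

theorem measure_abs_ge_le {f : Ω → ℝ} {t : ℝ} {q : ENNReal}
    (h : ∀ σ : ℝ, |σ| = 1 → μ {ω | t ≤ σ * f ω} ≤ q) : μ {ω | t ≤ |f ω|} ≤ 2 * q := by
  have hsub : {ω | t ≤ |f ω|} ⊆ {ω | t ≤ 1 * f ω} ∪ {ω | t ≤ -1 * f ω} := by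
    intro ω hω
    rcases le_abs.1 (show t ≤ |f ω| from hω) with h1 | h1
    · left; simpa using h1
    · right; simpa using h1
  refine (measure_mono hsub).trans ((measure_union_le _ _).trans ?_)
  rw [two_mul]
  exact add_le_add (h 1 (by simp)) (h (-1) (by simp))

theorem measure_exists_le {ι : Type*} [Fintype ι] {p : ι → Ω → Prop} {q : ENNReal}
    (h : ∀ k, μ {ω | p k ω} ≤ q) : μ {ω | ∃ k, p k ω} ≤ Fintype.card ι * q := by
  rw [show {ω | ∃ k, p k ω} = ⋃ k, {ω | p k ω} by ext; simp]
  refine (measure_iUnion_fintype_le μ _).trans ((Finset.sum_le_sum fun k _ => h k).trans ?_)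
  simp

theorem IsRDPG.measure_not_isGood (h : IsRDPG μ F r X A) (hF : IsInnerProductDistribution F) :
    μ {ω | ¬ IsGood (X ω)} = 0 := by
  have h1 : ∀ᵐ x ∂(μ.map X), IsGood x := by rw [h.law_latent]; exact ae_isGood hF
  exact ae_of_ae_map h.measurable_latent.aemeasurable h1

theorem IsRDPG.measure_abs_latent_gram_ge_le (h : IsRDPG μ F r X A)
    (hF : IsInnerProductDistribution F) {ε p : ℝ} (hε : 0 ≤ ε) (hn : 1 ≤ n)
    (hp : p ≤ ε ^ 2 / 2 * n) :
    μ {ω | ∃ k l, ε * n ≤ |∑ i, (X ω i k * X ω i l - secondMoment F k l)|} ≤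
      d * (d * (2 * ENNReal.ofReal (Real.exp (-p)))) := by
  have h1 : ∀ k l, μ {ω | ε * n ≤ |∑ i, (X ω i k * X ω i l - secondMoment F k l)|} ≤
      2 * ENNReal.ofReal (Real.exp (-p)) := fun k l =>
    measure_abs_ge_le fun σ hσ => by
      simp only [Finset.mul_sum]
      exact (h.measure_latent_gram_ge_le hF hσ hε hn k l).trans
        (ENNReal.ofReal_le_ofReal (Real.exp_le_exp.2 (neg_le_neg hp)))
  simpa using measure_exists_le fun k => measure_exists_le fun l => h1 k l

theorem IsRDPG.measure_abs_gram_ge_le (h : IsRDPG μ F r X A)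
    (hF : IsInnerProductDistribution F) (hr : 0 ≤ r) (hr1 : r ≤ 1) {p : ℝ} (hn : 1 ≤ n)
    (hp : p ≤ Real.log n ^ 2 / 16) :
    μ {ω | ∃ k l, n * Real.log n ≤
        |∑ i, ∑ j, offDiag r (X ω) (A ω) i j * (X ω i k * X ω j l)|} ≤
      d * (d * (2 * ENNReal.ofReal (Real.exp (-p)))) := by
  have h1 : ∀ k l, μ {ω | n * Real.log n ≤
      |∑ i, ∑ j, offDiag r (X ω) (A ω) i j * (X ω i k * X ω j l)|} ≤
      2 * ENNReal.ofReal (Real.exp (-p)) := fun k l =>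
    measure_abs_ge_le fun σ hσ =>
      (h.measure_gram_ge_le hF hr hr1 hn hσ k l).trans
        (ENNReal.ofReal_le_ofReal (Real.exp_le_exp.2 (neg_le_neg hp)))
  simpa using measure_exists_le fun k => measure_exists_le fun l => h1 k l

theorem IsRDPG.measure_abs_block_sum_ge_le (h : IsRDPG μ F r X A)
    (hF : IsInnerProductDistribution F) (hr : 0 ≤ r) (hr1 : r ≤ 1) (hD : 1 ≤ n * r) {p : ℝ}
    (hp : p ≤ 3 * (√(n * r) * Real.log n)) :
    μ {ω | ∃ S T : Finset (Fin n), 1 ≤ S.card ∧ S.card ≤ T.card ∧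
        (T.card : ℝ) ≤ n * r * S.card ∧ 49 * √(n * r * S.card * T.card) ≤
        |∑ i ∈ S, ∑ j ∈ T, offDiag r (X ω) (A ω) i j|} ≤
      2 * ENNReal.ofReal (Real.exp (-p)) := by
  have hσ : ∀ σ : ℝ, |σ| = 1 → μ {ω | ∃ S T : Finset (Fin n), 1 ≤ S.card ∧ S.card ≤ T.card ∧
        (T.card : ℝ) ≤ n * r * S.card ∧ 49 * √(n * r * S.card * T.card) ≤
        σ * ∑ i ∈ S, ∑ j ∈ T, offDiag r (X ω) (A ω) i j} ≤
      ENNReal.ofReal (Real.exp (-p)) := fun σ hσ =>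
    (h.measure_block_sum_ge_le hF hr hr1 hD hσ).trans
      (ENNReal.ofReal_le_ofReal (Real.exp_le_exp.2 (neg_le_neg hp)))
  rw [two_mul]
  refine le_trans (measure_mono ?_) ((measure_union_le _ _).trans
    (add_le_add (hσ 1 (by simp)) (hσ (-1) (by simp))))
  rintro ω ⟨S, T, h1, h2, h3, h4⟩
  rcases le_abs.1 h4 with h5 | h5
  · exact Or.inl ⟨S, T, h1, h2, h3, by rwa [one_mul]⟩
  · exact Or.inr ⟨S, T, h1, h2, h3, by rwa [neg_one_mul]⟩

theorem IsRDPG.measure_dense_compl_le (h : IsRDPG μ F r X A) (hF : IsInnerProductDistribution F)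
    (hr : 0 ≤ r) (hr1 : r ≤ 1) (hD : 1 ≤ n * r) (hlog : 1 ≤ Real.log n)
    {c K B C p : ℝ} (hc : 0 < c) (hK : 0 ≤ K) (hB : 0 ≤ B)
    (hquad : ∀ v : Fin d → ℝ, c * (v ⬝ᵥ v) ≤ v ⬝ᵥ (secondMoment F *ᵥ v))
    (hcol : ∀ k : Fin d,
      μ {ω | IsGood (X ω) ∧ (∀ i, ∑ j, |offDiag r (X ω) (A ω) i j| ≤ (K + 2) * (n * r)) ∧
        B * (n * (n * r)) ≤ ∑ i, (∑ j, offDiag r (X ω) (A ω) i j * X ω j k) ^ 2} ≤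
      ENNReal.ofReal (Real.exp (-n)))
    (hop : opConst (K + 2) * (√(n * r) * (1 + Real.log (n * r))) ≤ c / 2 * (n * r) / 8)
    (hC : opConst (K + 2) * (√(d * B) + 1) * (1 + Real.log (n * r)) ≤ C * Real.log n)
    (hdC : (d : ℝ) + 1 ≤ C)
    (hprow : p + Real.log n ≤ (K - 1) * (n * r) / 4)
    (hpblock : p ≤ 3 * (√(n * r) * Real.log n)) (hpn : p ≤ n)
    (hpgram : p ≤ Real.log n ^ 2 / 16) (hplat : p ≤ (c / (2 * (d + 1))) ^ 2 / 2 * n) :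
    μ {ω | FrobeniusExpansion r (X ω) (A ω)
      (expansionConst (c / 2) C * (Real.log n / √(n * r)))}ᶜ ≤
      (3 + d + 4 * d ^ 2) * ENNReal.ofReal (Real.exp (-p)) := by
  have hn : 1 ≤ n := by
    rcases Nat.eq_zero_or_pos n with h0 | h0
    · simp [h0] at hlog; linarith
    · exact h0
  have hnpos : (0 : ℝ) < n := by exact_mod_cast hn
  set q := ENNReal.ofReal (Real.exp (-p)) with hq
  have hrow : μ {ω | ∃ i, K * (n * r) ≤ ∑ j, offDiag r (X ω) (A ω) i j} ≤ q := by
    refine (h.measure_row_sum_ge_le hF hr hr1 (θ := 1 / 4) (by norm_num) _).trans ?_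
    refine ENNReal.ofReal_le_ofReal ?_
    rw [← Real.exp_log hnpos, ← Real.exp_add, Real.exp_log hnpos, Real.exp_le_exp]
    -- With `θ = 1/4` the Chernoff exponent for a row is at most `-(K - 1) D / 4`; the extra `log n`
    -- in `hprow` pays for the `n` rows.
    have h1 : Real.exp (1 / 4 * 2) ≤ 2 := by
      have h2 : Real.exp (1 / 4 * 2) ^ 2 ≤ 2 ^ 2 := by
        rw [← Real.exp_nat_mul]
        norm_num
        linarith [Real.exp_one_lt_d9]
      exact abs_le_of_sq_le_sq' h2 zero_le_two |>.2
    nlinarith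
  have hcol' : μ {ω | ∃ k, IsGood (X ω) ∧
      (∀ i, ∑ j, |offDiag r (X ω) (A ω) i j| ≤ (K + 2) * (n * r)) ∧
      B * (n * (n * r)) ≤ ∑ i, (∑ j, offDiag r (X ω) (A ω) i j * X ω j k) ^ 2} ≤ d * q := by
    simpa using measure_exists_le fun k => (hcol k).trans
      (ENNReal.ofReal_le_ofReal (Real.exp_le_exp.2 (neg_le_neg hpn)))
  have hgram := h.measure_abs_gram_ge_le hF hr hr1 hn hpgram
  have hblock := h.measure_abs_block_sum_ge_le hF hr hr1 hD hpblock
  have hlat := h.measure_abs_latent_gram_ge_le hF (ε := c / (2 * (d + 1))) (by positivity) hn hplat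
  have hgood := h.measure_not_isGood hF
  have htotal : (3 + d + 4 * d ^ 2) * q =
      0 + q + d * q + d * (d * (2 * q)) + 2 * q + d * (d * (2 * q)) := by ring
  rw [htotal]
  refine le_trans (measure_mono ?_) ((measure_union_le _ _).trans (add_le_add
    ((measure_union_le _ _).trans (add_le_add ((measure_union_le _ _).trans (add_le_add
    ((measure_union_le _ _).trans (add_le_add ((measure_union_le _ _).trans
    (add_le_add hgood.le hrow)) hcol')) hgram)) hblock)) hlat))
  intro ω hω
  by_contra hbad
  simp only [Set.mem_union, Set.mem_ofPred_eq, not_or, not_exists, not_and, not_le, not_not] at hbad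
  obtain ⟨⟨⟨⟨⟨b1, b2⟩, b3⟩, b4⟩, b5⟩, b6⟩ := hbad
  have hrow' : ∀ i, ∑ j, |offDiag r (X ω) (A ω) i j| ≤ (K + 2) * (n * r) := fun i => by
    linarith [sum_abs_offDiag_le b1 hr (h.isAdjacency ω) i, b2 i]
  exact hω (frobeniusExpansion_of_dense hD hr hr1 hlog (by linarith) hB (by linarith) b1
    (h.isAdjacency ω) hrow' (fun S T h1 h2 h3 => (b5 S T h1 h2 h3).le)
    (fun k => (b3 k b1 hrow').le) (fun k l => (b4 k l).le)
    (latent_quadratic_ge hc hquad fun k l => (b6 k l).le) hop hC hdC)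

theorem IsRDPG.measure_sparse_compl_le (h : IsRDPG μ F r X A) (hF : IsInnerProductDistribution F)
    (hD : 0 < n * r) (hr : 0 ≤ r) (hr1 : r ≤ 1) {c θ p : ℝ} (hc : 0 < c) (hθ : 0 ≤ θ)
    (hquad : ∀ v : Fin d → ℝ, c * (v ⬝ᵥ v) ≤ v ⬝ᵥ (secondMoment F *ᵥ v))
    (hDlog : 2 * (n * r) ≤ Real.log n)
    (hprow : p + Real.log n + 2 * (n * r) * θ ^ 2 * Real.exp (θ * 2) ≤ θ * (Real.log n / 2))
    (hplat : p ≤ (c / (2 * (d + 1))) ^ 2 / 2 * n) :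
    μ {ω | FrobeniusExpansion r (X ω) (A ω)
      ((√d + 2 + √(d / (c / 2))) * (Real.log n / √(n * r)))}ᶜ ≤
      (1 + 2 * d ^ 2) * ENNReal.ofReal (Real.exp (-p)) := by
  have hnpos : (0 : ℝ) < n := by
    by_contra h0
    have : (n : ℝ) = 0 := le_antisymm (not_lt.1 h0) (Nat.cast_nonneg n)
    simp [this] at hD
  have hn : 1 ≤ n := by exact_mod_cast hnpos
  set q := ENNReal.ofReal (Real.exp (-p)) with hq
  have hrow : μ {ω | ∃ i, Real.log n / 2 ≤ ∑ j, offDiag r (X ω) (A ω) i j} ≤ q := by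
    refine (h.measure_row_sum_ge_le hF hr hr1 hθ _).trans ?_
    refine ENNReal.ofReal_le_ofReal ?_
    rw [← Real.exp_log hnpos, ← Real.exp_add, Real.exp_log hnpos, Real.exp_le_exp]
    linarith
  have hlat := h.measure_abs_latent_gram_ge_le hF (ε := c / (2 * (d + 1))) (by positivity) hn hplat
  have hgood := h.measure_not_isGood hF
  have htotal : (1 + 2 * d ^ 2) * q = 0 + q + d * (d * (2 * q)) := by ring
  rw [htotal]
  refine le_trans (measure_mono ?_) ((measure_union_le _ _).trans (add_le_add
    ((measure_union_le _ _).trans (add_le_add hgood.le hrow)) hlat))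
  intro ω hω
  by_contra hbad
  simp only [Set.mem_union, Set.mem_ofPred_eq, not_or, not_exists, not_le, not_not] at hbad
  obtain ⟨⟨b1, b2⟩, b3⟩ := hbad
  exact hω (frobeniusExpansion_of_sparse hD hr (by linarith) (by linarith) b1
    (h.isAdjacency ω)
    (fun i => by linarith [sum_abs_adjacency_le b1 hr (h.isAdjacency ω) i, b2 i])
    (latent_quadratic_ge hc hquad fun k l => (b3 k l).le))

end Probability

/-! ### Growth comparisons. -/

section Asymptotics

open Filter Asymptotics

theorem one_add_log_isLittleO_sqrt :
    (fun y : ℝ => 1 + Real.log y) =o[atTop] fun y => √y := by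
  have h1 : (fun y : ℝ => Real.log y) =o[atTop] fun y => √y := by
    simpa only [Real.sqrt_eq_rpow] using isLittleO_log_rpow_atTop (show (0 : ℝ) < 1 / 2 by norm_num)
  refine IsLittleO.add ((isLittleO_const_left).2 (Or.inr ?_)) h1
  exact tendsto_norm_atTop_atTop.comp Real.tendsto_sqrt_atTop

theorem eventually_sqrt_mul_log_le (Γ : ℝ) {δ : ℝ} (hδ : 0 < δ) :
    ∀ᶠ y : ℝ in atTop, Γ * (√y * (1 + Real.log y)) ≤ δ * y := by
  filter_upwards [(one_add_log_isLittleO_sqrt.const_mul_left Γ).def hδ, eventually_ge_atTop 0]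
    with y hy hy0
  rw [Real.norm_eq_abs, Real.norm_of_nonneg (Real.sqrt_nonneg y)] at hy
  have h1 := mul_le_mul_of_nonneg_left ((le_abs_self _).trans hy) (Real.sqrt_nonneg y)
  have h2 := Real.mul_self_sqrt hy0
  calc Γ * (√y * (1 + Real.log y)) = √y * (Γ * (1 + Real.log y)) := by ring
    _ ≤ √y * (δ * √y) := h1
    _ = δ * y := by rw [mul_left_comm, h2]

theorem eventually_log_mul_le (Γ : ℝ) {M : ℝ} (hM : 0 < M) :
    ∀ᶠ y : ℝ in atTop, Γ * (1 + Real.log (M * y)) ≤ y := by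
  have h1 : (fun y : ℝ => Γ * ((1 + Real.log M) + Real.log y)) =o[atTop] fun y => y := by
    refine IsLittleO.const_mul_left (IsLittleO.add ((isLittleO_const_left).2 (Or.inr ?_))
      Real.isLittleO_log_id_atTop) Γ
    exact tendsto_norm_atTop_atTop
  filter_upwards [h1.def one_pos, eventually_gt_atTop 0] with y hy hy0
  rw [Real.norm_eq_abs, Real.norm_of_nonneg hy0.le, one_mul] at hy
  rw [Real.log_mul hM.ne' hy0.ne', ← add_assoc]
  exact (le_abs_self _).trans hy

theorem tendsto_log_natCast : Tendsto (fun n : ℕ => Real.log n) atTop atTop :=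
  Real.tendsto_log_atTop.comp tendsto_natCast_atTop_atTop

theorem eventually_mul_log_natCast_le (a : ℝ) {δ : ℝ} (hδ : 0 < δ) :
    ∀ᶠ n : ℕ in atTop, a * Real.log n ≤ δ * n := by
  filter_upwards [tendsto_natCast_atTop_atTop.eventually
    ((Real.isLittleO_log_id_atTop.const_mul_left a).def hδ)] with n hn
  rw [Real.norm_eq_abs, id, Real.norm_of_nonneg (Nat.cast_nonneg n)] at hn
  exact (le_abs_self _).trans hn

end Asymptotics

/-- A union bound over `m ≤ n` events of probability `n ^ (-(c + 1))`. -/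
theorem mul_ofReal_exp_le {n : ℕ} {m : ENNReal} (hn : 0 < n) (hm : m ≤ n) (c : ℝ) :
    m * ENNReal.ofReal (Real.exp (-((c + 1) * Real.log n))) ≤ ENNReal.ofReal ((n : ℝ) ^ (-c)) := by
  have hn' : (0 : ℝ) < n := Nat.cast_pos.2 hn
  refine (mul_le_mul_left hm _).trans (le_of_eq ?_)
  rw [← ENNReal.ofReal_natCast, ← ENNReal.ofReal_mul hn'.le, Real.rpow_def_of_pos hn']
  congr 1
  nth_rewrite 1 [← Real.exp_log hn']
  rw [← Real.exp_add]
  congr 1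
  ring

/-! ### Regimes of the mean degree and choice of constants. -/

section Main

open Filter

/-- Row sum and degree constants may depend on the required rate `c`; the final constant may
not, which is why degrees of order `log n` are handled separately from larger ones. -/
theorem exists_frobeniusExpansion_eventually {d : ℕ} (F : Measure (EuclideanSpace ℝ (Fin d)))
    (hF : IsInnerProductDistribution F) (hrank : (secondMoment F).rank = d)
    (ρ : ℕ → ℝ) (hρ : ∀ n, 0 < ρ n ∧ ρ n ≤ 1)
    {Ω : ℕ → Type*} [∀ n, MeasurableSpace (Ω n)] (μ : ∀ n, Measure (Ω n))
    (X : ∀ n, Ω n → Fin n → EuclideanSpace ℝ (Fin d))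
    (A : ∀ n, Ω n → Matrix (Fin n) (Fin n) ℝ)
    (hXA : ∀ n, IsRDPG (μ n) F (ρ n) (X n) (A n)) :
    ∃ C : ℝ, 0 < C ∧ ∀ c : ℝ, 0 < c → ∀ᶠ n : ℕ in atTop,
      μ n {ω | FrobeniusExpansion (ρ n) (X n ω) (A n ω) (C * (Real.log n / √(n * ρ n)))}ᶜ ≤
        ENNReal.ofReal ((n : ℝ) ^ (-c)) := by
  obtain ⟨lam, hlam, hquad⟩ := exists_secondMoment_quadratic_ge hF hrank
  -- Row-sum constant for large degrees (`K = 2`), chosen before `c`; with `log D ≤ log n`, it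
  -- yields the first entry of `C₀`.
  obtain ⟨B, hB, hcol⟩ := exists_measure_column_ge_le (L := 2 + 2) (by norm_num)
  set Γ := opConst (2 + 2) * (√(d * B) + 1) with hΓ
  have hΓ0 : 0 ≤ Γ := by rw [hΓ, opConst]; positivity
  set C₀ := max (2 * Γ) (d + 1) with hC₀
  set C₁ := √(d : ℝ) + 2 + √(d / (lam / 2)) with hC₁
  refine ⟨max (expansionConst (lam / 2) C₀) C₁, lt_max_of_lt_right (by positivity), fun c hc => ?_⟩
  have hmono : ∀ (n : ℕ) (ω : Ω n) (C' : ℝ), C' ≤ max (expansionConst (lam / 2) C₀) C₁ → 1 ≤ Real.log n →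
      FrobeniusExpansion (ρ n) (X n ω) (A n ω) (C' * (Real.log n / √(n * ρ n))) →
      FrobeniusExpansion (ρ n) (X n ω) (A n ω)
        (max (expansionConst (lam / 2) C₀) C₁ * (Real.log n / √(n * ρ n))) :=
    fun n ω C' hC' hl h => h.mono (mul_le_mul_of_nonneg_right hC' (by positivity))
  -- Sparse regime: the gain `θ l / 2 = (c + 3) l` pays for `(c + 1) l`, for `l` from the union over
  -- rows, and for a variance term that `κ` keeps below `l`. The bound `κ ≤ 1/2` gives `2D ≤ l`.
  set θ := 2 * (c + 3) with hθ
  set κ := min (1 / 2) (1 / (2 * θ ^ 2 * Real.exp (θ * 2))) with hκ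
  have hθ0 : 0 < θ := by positivity
  have hκ0 : 0 < κ := by positivity
  -- For `D ≥ M l`, the choice `K = 2` gives row exponent `D / 4 ≥ (c + 2) l`. For `D ≥ κ l` only,
  -- `K = 1 + M / κ` restores the same exponent.
  set M := 4 * (c + 2) with hM
  have hM0 : 0 < M := by positivity
  set K := 1 + M / κ with hK
  have hK0 : 0 ≤ K := by positivity
  obtain ⟨B', hB', hcol'⟩ := exists_measure_column_ge_le (L := K + 2) (by linarith)
  obtain ⟨D₀, hD₀⟩ := eventually_atTop.1
    (((eventually_sqrt_mul_log_le (opConst (2 + 2)) (show 0 < lam / 2 / 8 by positivity)).and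
      (eventually_sqrt_mul_log_le (opConst (K + 2)) (show 0 < lam / 2 / 8 by positivity))).and
      (((Real.tendsto_sqrt_atTop).eventually_ge_atTop (c + 1)).and (eventually_ge_atTop 1)))
  filter_upwards [tendsto_log_natCast.eventually_ge_atTop 1,
    tendsto_log_natCast.eventually_ge_atTop (16 * (c + 1)),
    tendsto_log_natCast.eventually_ge_atTop (D₀ / κ),
    tendsto_log_natCast.eventually
      (eventually_log_mul_le (opConst (K + 2) * (√(d * B') + 1)) hM0),
    eventually_mul_log_natCast_le (c + 1) one_pos,
    eventually_mul_log_natCast_le (c + 1)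
      (show 0 < (lam / (2 * (d + 1))) ^ 2 / 2 by positivity),
    eventually_ge_atTop (3 + d + 4 * d ^ 2)] with n h1 h16 hDκ hlogM hpn hplat hm
  have hn : 0 < n := by omega
  have hnpos : (0 : ℝ) < n := Nat.cast_pos.2 hn
  obtain ⟨hr, hr1⟩ := hρ n
  have hDpos : 0 < n * ρ n := mul_pos hnpos hr
  have hm' : (3 + d + 4 * d ^ 2 : ENNReal) ≤ n := by exact_mod_cast hm
  have hm1 : (1 + 2 * d ^ 2 : ENNReal) ≤ n := by exact_mod_cast (show 1 + 2 * d ^ 2 ≤ n by omega)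
  set l := Real.log n with hl
  rcases le_or_gt (n * ρ n) (κ * l) with hcase | hcase
  · refine le_trans (measure_mono (Set.compl_subset_compl.2 fun ω hω => ?_))
      (((hXA n).measure_sparse_compl_le hF hDpos hr.le hr1 hlam hθ0.le hquad (p := (c + 1) * l)
        ?_ ?_ hplat).trans (mul_ofReal_exp_le hn hm1 c))
    · exact hmono n ω C₁ (le_max_right _ _) h1 hω
    · have : κ * l ≤ 1 / 2 * l := by gcongr; exact min_le_left _ _
      linarith
    · have h2 : κ * (2 * θ ^ 2 * Real.exp (θ * 2)) ≤ 1 := by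
        rw [← le_div_iff₀ (by positivity)]; exact min_le_right _ _
      have h3 : 2 * (n * ρ n) * θ ^ 2 * Real.exp (θ * 2) ≤ l := by
        calc 2 * (n * ρ n) * θ ^ 2 * Real.exp (θ * 2)
            = n * ρ n * (2 * θ ^ 2 * Real.exp (θ * 2)) := by ring
          _ ≤ κ * l * (2 * θ ^ 2 * Real.exp (θ * 2)) := by gcongr
          _ = κ * (2 * θ ^ 2 * Real.exp (θ * 2)) * l := by ring
          _ ≤ 1 * l := by gcongr
          _ = l := one_mul l
      rw [hθ] at h3 ⊢
      linarith
  -- Here `D > κ log n` tends to infinity, so the threshold `D₀`, which depends on `c`, is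
  -- eventually passed.
  · obtain ⟨⟨hop, hop'⟩, hsq, hD1⟩ := hD₀ (n * ρ n)
      (((div_le_iff₀' hκ0).1 hDκ).trans hcase.le)
    have hblock : (c + 1) * l ≤ 3 * (√(n * ρ n) * l) := by nlinarith
    have hgram : (c + 1) * l ≤ l ^ 2 / 16 := by nlinarith
    have hplain : (c + 1) * l ≤ n := by rwa [one_mul] at hpn
    rcases le_or_gt (M * l) (n * ρ n) with hbig | hsmall
    · refine le_trans (measure_mono (Set.compl_subset_compl.2 fun ω hω => ?_))
        (((hXA n).measure_dense_compl_le hF hr.le hr1 hD1 h1 hlam zero_le_two hB.le hquad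
          (fun k => hcol (hXA n) hF hr.le hr1 hD1 k) (by linarith) (C := C₀) ?_ (le_max_right _ _)
          ?_ hblock hplain hgram hplat).trans (mul_ofReal_exp_le hn hm' c))
      · exact hmono n ω _ (le_max_left _ _) h1 hω
      · have h2 : Real.log (n * ρ n) ≤ l :=
          Real.log_le_log hDpos (mul_le_of_le_one_right hnpos.le hr1)
        calc Γ * (1 + Real.log (n * ρ n)) ≤ Γ * (l + l) := by gcongr
          _ = 2 * Γ * l := by ring
          _ ≤ C₀ * l := by gcongr; exact le_max_left _ _
      · rw [hM] at hbig; linarith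
    -- Intermediate regime: `K` and `B'` depend on `c`, but `log D ≤ log (M l)` is doubly
    -- logarithmic, so their product with `1 + log D` is at most `l` and `C₀` is unaffected.
    · refine le_trans (measure_mono (Set.compl_subset_compl.2 fun ω hω => ?_))
        (((hXA n).measure_dense_compl_le hF hr.le hr1 hD1 h1 hlam hK0 hB'.le hquad
          (fun k => hcol' (hXA n) hF hr.le hr1 hD1 k) (by linarith) (C := C₀) ?_ (le_max_right _ _)
          ?_ hblock hplain hgram hplat).trans (mul_ofReal_exp_le hn hm' c))
      · exact hmono n ω _ (le_max_left _ _) h1 hω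
      · have h2 : Real.log (n * ρ n) ≤ Real.log (M * l) := Real.log_le_log hDpos hsmall.le
        have h3 : 1 ≤ C₀ := le_trans (by simp) (le_max_right _ _)
        have h4 : 0 ≤ opConst (K + 2) * (√(d * B') + 1) := by rw [opConst]; positivity
        calc opConst (K + 2) * (√(d * B') + 1) * (1 + Real.log (n * ρ n))
            ≤ opConst (K + 2) * (√(d * B') + 1) * (1 + Real.log (M * l)) := by gcongr
          _ ≤ l := hlogM
          _ ≤ C₀ * l := by nlinarith
      · have h2 : M * l ≤ (K - 1) * (n * ρ n) := by
          have h3 : M / κ * (κ * l) ≤ M / κ * (n * ρ n) := by gcongr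
          have h4 : M / κ * (κ * l) = M * l := by field_simp
          rw [hK]; linarith
        rw [hM] at h2; linarith

end Main

end RDPG

theorem mainTheorem3 {d : ℕ} (F : Measure (EuclideanSpace ℝ (Fin d)))
    (hF : RDPG.IsInnerProductDistribution F)
    (hrank : (RDPG.secondMoment F).rank = d)
    (ρ : ℕ → ℝ) (hρ : ∀ n, 0 < ρ n ∧ ρ n ≤ 1)
    {Ω : ℕ → Type*} [∀ n, MeasurableSpace (Ω n)]
    (μ : ∀ n, Measure (Ω n)) [∀ n, IsProbabilityMeasure (μ n)]
    (X : ∀ n, Ω n → Fin n → EuclideanSpace ℝ (Fin d))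
    (A : ∀ n, Ω n → Matrix (Fin n) (Fin n) ℝ)
    (hXA : ∀ n, RDPG.IsRDPG (μ n) F (ρ n) (X n) (A n)) :
    ∃ C : ℝ, 0 < C ∧
      RDPG.AsymptoticallyAlmostSurely μ fun n =>
        {ω | RDPG.FrobeniusExpansion (ρ n) (X n ω) (A n ω)
          (C * (Real.log n * (n * ρ n) ^ (-(1 / 2) : ℝ)))} := by
  obtain ⟨C, hC, h⟩ := RDPG.exists_frobeniusExpansion_eventually F hF hrank ρ hρ μ X A hXA
  refine ⟨C, hC, fun c hc => ?_⟩
  obtain ⟨n₀, hn₀⟩ := Filter.eventually_atTop.1 (h c hc)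
  refine ⟨n₀, fun n hn η hη _ => ?_⟩
  have hD : 0 ≤ (n : ℝ) * ρ n := mul_nonneg (Nat.cast_nonneg n) (hρ n).1.le
  have hpow : ((n : ℝ) * ρ n) ^ (-(1 / 2) : ℝ) = (√(n * ρ n))⁻¹ := by
    rw [Real.rpow_neg hD, Real.sqrt_eq_rpow]
  beta_reduce
  rw [hpow, ← div_eq_mul_inv]
  exact (hn₀ n hn.le).trans (ENNReal.ofReal_le_ofReal hη.le)
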